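/- Let $T$ be a locally finite simplicial tree which is uniform (some discrete group of automorphisms of $T$ without inversions has a finite quotient graph). Let $\Gamma$ be a discrete group of automorphisms of $T$ without inversions which is geometrically finite, and assume that $T$ is its own minimal $\Gamma$-invariant subtree. Thus $\Gamma$ preserves no point and no pair of points of $T\cup\partial T$, and $X=\Gamma\backslash T$, as a graph of finite groups, is the union of a finite graph and of finitely many cuspidal rays attached at their origins; here a cuspidal ray is a ray with consecutive edges $e_0,e_1,\dots$ such that, for every $n\ge 1$, the monomorphism from the group of $e_n$ to the group of its origin is onto. Suppose that the open maximal cuspidal rays of $X$, numbered $1,\dots,r$, are pairwise disjoint with complement a finite subgraph $X_0$, and that the stabilizer in $\Gamma$ of every vertex of $T$ lying over $X_0$ is trivial. Let $(a_{i,n})_{n\ge 0}$ be the consecutive edges of the $i$-th maximal cuspidal ray, oriented towards its end, and lift this ray to a ray $(\widetilde a_{i,n})_{n\geq 0}$ of $T$. Choose lifts $\widetilde\beta$ of the oriented edges $\beta$ of $X_0$ with $\widetilde{\overline\beta}=\overline{\widetilde\beta}$. Let $\Gamma_{i,n}$ be the stabilizer of the origin of $\widetilde a_{i,n}$. Let $\mathcal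 G T$ be the space of geodesics (injective simplicial maps) $\ell:\mathbb R\to T$, and let $\ell_k$ be the oriented edge from $\ell(k)$ to $\ell(k+1)$, $k\in\mathbb Z$. Let $\mathcal A$ be the disjoint union of the set of oriented edges of $X$ and of the sets $\big((\Gamma_{i,n+1}-\Gamma_{i,n})/\Gamma_{i,n}\big)\times\{+\}$ and $\big(\Gamma_{i,n}\backslash(\Gamma_{i,n+1}-\Gamma_{i,n})\big)\times\{-\}$, for $1\le i\le r$, $n\ge 0$, and put * $E_\beta=\{\ell:\ell_0=\widetilde\beta\}$ for an oriented edge $\beta$ of $X_0$; * $E_\beta=\{\ell:\ell_0=\widetilde a_{i,n},\ \ell_1=\widetilde a_{i,n+1},\ \ell_{-n}=\widetilde a_{i,0}\}$ for $\beta=a_{i,n}$; * $E_\beta=\{\ell:\ell_0=\overline{\widetilde a_{i,n}},\ \ell_{-1}=\overline{\widetilde a_{i,n+1}},\ \ell_{n}=\overline{\widetilde a_{i,0}}\}$ for $\beta=\overline{a_{i,n}}$; * $E_\beta=\{\ell:\ell_0=\widetilde a_{i,n},\ \ell_1=g\,\overline{\widetilde a_{i,n}},\ \ell_{-n}=\widetilde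 a_{i,0}\}$ for $\beta=(g,+)$, $g\in(\Gamma_{i,n+1}-\Gamma_{i,n})/\Gamma_{i,n}$; * $E_\beta=\{\ell:\ell_0=\overline{\widetilde a_{i,n}},\ \ell_{-1}=g^{-1}\widetilde a_{i,n},\ \ell_{n}=\overline{\widetilde a_{i,0}}\}$ for $\beta=(g,-)$, $g\in\Gamma_{i,n}\backslash(\Gamma_{i,n+1}-\Gamma_{i,n})$. Let $\delta$ be the critical exponent of $\Gamma$, and let $(\mu_x)_{x\in VT}$ be a Patterson–Sullivan measure of $\Gamma$: finite measures on $\partial T$, of support $\partial T$, with $\gamma_*\mu_x=\mu_{\gamma x}$ for $\gamma\in\Gamma$ and $\frac{d\mu_x}{d\mu_y}(\xi)=e^{-\delta\beta_\xi(x,y)}$, where $\beta_\xi(x,y)$ is the value of $d(x,z)-d(z,y)$ for all vertices $z$ close enough to $\xi$. Let $m_{BM}$ be the Bowen–Margulis measure on $\Gamma\backslash\mathcal G T$, induced by the measure $$d\widetilde m_{BM}(\ell)=\frac{d\mu_{x_0}(\ell_-)\,d\mu_{x_0}(\ell_+)\,dt}{d_{x_0}(\ell_-,\ell_+)^{2\delta}}$$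 on $\mathcal G T$, where $x_0$ is a vertex of $T$, $\ell_\pm$ are the ends of $\ell$, $t\in\mathbb Z$ is the algebraic distance along $\ell$ from $\ell(0)$ to the point of $\ell$ closest to $x_0$, $dt$ is the counting measure, and $d_{x_0}(\xi,\eta)=e^{-u}$ with $u$ the length of the intersection of the rays from $x_0$ to $\xi$ and to $\eta$. Then $m_{BM}$ is finite and non-zero, so that it can be normalized to a probability measure $\overline m_{BM}$; the images of the $E_\beta$ in $\Gamma\backslash\mathcal G T$, still denoted by $E_\beta$, form a Borel partition $\mathcal P=\{E_\beta\}_{\beta\in\mathcal A}$ of $\Gamma\backslash\mathcal G T$; and its entropy is finite: $$\sum_{\beta\in\mathcal A}-\,\overline m_{BM}(E_\beta)\log \overline m_{BM}(E_\beta)<\infty .$$ -/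

import Mathlib

open MeasureTheory Filter Topology
open scoped ENNReal NNReal

noncomputable section

namespace TreeFlow

variable {V : Type*} {G : SimpleGraph V}

/-! ### Groups of automorphisms of a tree -/

/-- Automorphisms act on oriented edges (`G.Dart`; `d.fst` is the origin, `d.snd` the terminal
vertex, `d.symm` the opposite edge). -/
instance : MulAction (G ≃g G) G.Dart where
  smul γ d := γ.toHom.mapDart d
  one_smul _ := rfl
  mul_smul _ _ _ := rfl

/-- No element of `Γ` exchanges the two ends of an edge. -/
def NoInversion (Γ : Subgroup (G ≃g G)) : Prop :=
  ∀ γ : Γ, ∀ d : G.Dart, γ • d ≠ d.symm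

/-- `Γ` is discrete for the topology of pointwise convergence on the discrete set of vertices (that
is, the compact-open topology): the identity is isolated. -/
def IsDiscrete (Γ : Subgroup (G ≃g G)) : Prop :=
  ∃ F : Finset V, ∀ γ : Γ, (∀ v ∈ F, γ • v = v) → γ = 1

/-- The tree has a discrete group of automorphisms (without inversions) with finite quotient
graph. For a locally finite tree it is enough to count orbits of vertices. -/
def IsUniform (G : SimpleGraph V) : Prop :=
  ∃ Γ : Subgroup (G ≃g G), NoInversion Γ ∧ IsDiscrete Γ ∧ Finite (MulAction.orbitRel.Quotient Γ V)

/-- There is no proper non-empty `Γ`-invariant subtree, i.e. the tree is equal to its minimal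
invariant subtree. -/
def IsMinimal (Γ : Subgroup (G ≃g G)) : Prop :=
  ∀ S : Set V, S.Nonempty → (∀ γ : Γ, ∀ v ∈ S, γ • v ∈ S) → (G.induce S).Connected → S = Set.univ

/-- `Γ`-equivalence of oriented edges: equality in the quotient graph `Γ\T`. -/
def EdgeEquiv (Γ : Subgroup (G ≃g G)) (d e : G.Dart) : Prop := ∃ γ : Γ, γ • d = e

/-! ### The space of ends and the space of geodesics -/

variable (G) in
/-- Geodesic rays, as sequences of vertices. -/
structure Ray where
  toFun : ℕ → V
  adj : ∀ n, G.Adj (toFun n) (toFun (n + 1))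
  inj : Function.Injective toFun

instance : CoeFun (Ray G) (fun _ => ℕ → V) := ⟨Ray.toFun⟩

instance : MulAction (G ≃g G) (Ray G) where
  smul γ r := ⟨fun n => γ • r n, fun n => γ.map_adj_iff.2 (r.adj n), γ.injective.comp r.inj⟩
  one_smul _ := rfl
  mul_smul _ _ _ := rfl

variable (G) in
/-- Two rays are equivalent if they eventually coincide, up to a shift. -/
def raySetoid : Setoid (Ray G) where
  r f g := ∃ m n : ℕ, ∀ k, f (m + k) = g (n + k)
  iseqv :=
    { refl := fun _ => ⟨0, 0, fun _ => rfl⟩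
      symm := fun ⟨m, n, h⟩ => ⟨n, m, fun k => (h k).symm⟩
      trans := by
        rintro f g h ⟨m, n, h1⟩ ⟨p, q, h2⟩
        refine ⟨m + p, q + n, fun k => ?_⟩
        have e1 := h1 (p + k)
        have e2 := h2 (n + k)
        rw [show m + p + k = m + (p + k) by ring, show q + n + k = q + (n + k) by ring, e1, ← e2]
        congr 1
        ring }

variable (G) in
/-- The space of ends `∂T` of the tree. -/
def Boundary : Type _ := Quotient (raySetoid G)

/-- The end of a ray. -/
def Ray.lim (r : Ray G) : Boundary G := Quotient.mk (raySetoid G) r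

instance : MulAction (G ≃g G) (Boundary G) where
  smul γ := Quotient.map (γ • ·) (by
    rintro f g ⟨m, n, h⟩
    exact ⟨m, n, fun k => congrArg (fun v => γ • v) (h k)⟩)
  one_smul := by rintro ⟨r⟩; rfl
  mul_smul := by rintro _ _ ⟨r⟩; rfl

/-- The ends reached by the rays whose first edge is `d`. This is one of the two pieces of `∂T`
cut out by the edge `d`. -/
def shadow (d : G.Dart) : Set (Boundary G) :=
  {ξ | ∃ r : Ray G, r 0 = d.fst ∧ r 1 = d.snd ∧ r.lim = ξ}

/-- The topology of the space of ends. -/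
instance : TopologicalSpace (Boundary G) :=
  TopologicalSpace.generateFrom (Set.range shadow)

instance : MeasurableSpace (Boundary G) := borel _

instance : BorelSpace (Boundary G) := ⟨rfl⟩

variable (G) in
/-- The space `𝒢T` of geodesics: injective simplicial maps from the line (with vertices `ℤ`) to
the tree. -/
structure Line where
  toFun : ℤ → V
  adj : ∀ n, G.Adj (toFun n) (toFun (n + 1))
  inj : Function.Injective toFun

instance : CoeFun (Line G) (fun _ => ℤ → V) := ⟨Line.toFun⟩

instance : MulAction (G ≃g G) (Line G) where
  smul γ l := ⟨fun n => γ • l n, fun n => γ.map_adj_iff.2 (l.adj n), γ.injective.comp l.inj⟩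
  one_smul _ := rfl
  mul_smul _ _ _ := rfl

/-- The Borel structure of the compact-open topology, i.e. of pointwise convergence: it is generated
by the maps `ℓ ↦ ℓ n`, with the discrete structure on the (countable) set of vertices. -/
instance : MeasurableSpace (Line G) :=
  MeasurableSpace.comap Line.toFun (@MeasurableSpace.pi ℤ (fun _ => V) (fun _ => ⊤))

/-- The `n`-th oriented edge `ℓ_n` of a geodesic, from `ℓ(n)` to `ℓ(n+1)`. -/
def Line.edge (l : Line G) (n : ℤ) : G.Dart := ⟨(l n, l (n + 1)), l.adj n⟩

/-- The terminal end `ℓ_+`. -/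
def Line.endPlus (l : Line G) : Boundary G :=
  Ray.lim ⟨fun n => l n, fun n => by simpa using l.adj n, fun a b h => by simpa using l.inj h⟩

/-- The initial end `ℓ_-`. -/
def Line.endMinus (l : Line G) : Boundary G :=
  Ray.lim ⟨fun n => l (-n),
    fun n => by
      have h := (l.adj (-(n : ℤ) - 1)).symm
      rw [sub_add_cancel] at h
      rw [show -((n + 1 : ℕ) : ℤ) = -(n : ℤ) - 1 by push_cast; ring]
      exact h,
    fun a b h => by simpa using l.inj h⟩

/-- `Γ\𝒢T`, with the quotient Borel structure. -/
abbrev QuotientLines (Γ : Subgroup (G ≃g G)) : Type _ := MulAction.orbitRel.Quotient Γ (Line G)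

/-- The projection `𝒢T → Γ\𝒢T`. -/
def proj (Γ : Subgroup (G ≃g G)) (l : Line G) : QuotientLines Γ := Quotient.mk _ l

/-! ### Geometrically finite groups -/

/-- `Γ` preserves no point and no pair of points of `T ∪ ∂T`. As `Γ` has no inversions, a group that
preserves a point or a pair of points of the geometric realisation of `T` fixes a vertex, and one
that preserves a mixed pair fixes its two members; so vertices and ends are enough. -/
def NonElementary (Γ : Subgroup (G ≃g G)) : Prop :=
  (∀ v w : V, ¬ ∀ γ : Γ, ({γ • v, γ • w} : Set V) = {v, w}) ∧
  (∀ ξ η : Boundary G, ¬ ∀ γ : Γ, ({γ • ξ, γ • η} : Set (Boundary G)) = {ξ, η})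

/-- `a` is a lift to `T` of a cuspidal ray of the quotient graph of groups `Γ\\T`: its edges are
consecutive, its vertices stay distinct in `Γ\T` (so that it projects to a ray), this ray is attached
to the rest of `Γ\T` by its initial vertex only, and for `n ≥ 1` the monomorphism from the group of
its `n`-th edge to the group of the origin of that edge is onto. -/
structure IsCuspidalRay (Γ : Subgroup (G ≃g G)) (a : ℕ → G.Dart) : Prop where
  consecutive : ∀ n, (a n).snd = (a (n + 1)).fst
  injective : ∀ m n, ∀ γ : Γ, γ • (a m).fst = (a n).fst → m = n
  attached : ∀ n, ∀ e : G.Dart, e.fst = (a (n + 1)).fst →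
    EdgeEquiv Γ (a (n + 1)) e ∨ EdgeEquiv Γ (a n).symm e
  surjective : ∀ n, ∀ γ : Γ, γ • (a (n + 1)).fst = (a (n + 1)).fst → γ • a (n + 1) = a (n + 1)

/-- The cuspidal ray is not a proper subray of a longer one. -/
def IsMaximalCuspidalRay (Γ : Subgroup (G ≃g G)) (a : ℕ → G.Dart) : Prop :=
  IsCuspidalRay Γ a ∧
    ∀ b : ℕ → G.Dart, IsCuspidalRay Γ b → ∀ k, (∀ n, b (n + k) = a n) → k = 0

/-- A description of `Γ\\T` as the union of a finite graph of groups and of `r` cuspidal rays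
attached by their origins, each ray being given by a lift to `T`. -/
structure CuspidalDecomposition (Γ : Subgroup (G ≃g G)) where
  r : ℕ
  ray : Fin r → ℕ → G.Dart
  cuspidal : ∀ i, IsCuspidalRay Γ (ray i)
  disjoint : ∀ i j, i ≠ j → ∀ m n,
    ¬ EdgeEquiv Γ (ray i m) (ray j n) ∧ ¬ EdgeEquiv Γ (ray i m) (ray j n).symm
  finite_core : Set.Finite ((Quotient.mk _ : V → MulAction.orbitRel.Quotient Γ V) ''
    {v | ∀ i n, ∀ γ : Γ, γ • (ray i (n + 1)).fst ≠ v})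

namespace CuspidalDecomposition

variable {Γ : Subgroup (G ≃g G)} (D : CuspidalDecomposition Γ)

/-- Vertices of `T` that project to `X₀`, the complement in `Γ\T` of the open cuspidal rays. -/
def coreVertices : Set V := {v | ∀ i n, ∀ γ : Γ, γ • (D.ray i (n + 1)).fst ≠ v}

/-- Oriented edges of `T` that project to `X₀`. -/
def coreEdges : Set G.Dart :=
  {d | ∀ i n, ¬ EdgeEquiv Γ (D.ray i n) d ∧ ¬ EdgeEquiv Γ (D.ray i n).symm d}

end CuspidalDecomposition

/-- Geometrically finite groups, when `T` is the minimal invariant subtree. -/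
def IsGeometricallyFinite (Γ : Subgroup (G ≃g G)) : Prop :=
  NonElementary Γ ∧ Nonempty (CuspidalDecomposition Γ)

/-! ### Patterson-Sullivan and Bowen-Margulis measures -/

/-- The critical exponent in `[0, ∞]` of the Poincaré series `∑ exp (-s d(x₀, γ x₀))`. -/
def criticalExponent (Γ : Subgroup (G ≃g G)) (x₀ : V) : ℝ≥0∞ :=
  sInf {t : ℝ≥0∞ | ∃ s : ℝ≥0, t = s ∧
    Summable fun γ : Γ => Real.exp (-(s : ℝ) * (G.dist x₀ (γ • x₀) : ℝ))}

/-- The Busemann cocycle `β_ξ(x, y)`: the eventual value of `d(x, z) - d(z, y)` as the vertex `z`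
goes to `ξ` (along any ray). -/
def busemann (ξ : Boundary G) (x y : V) : ℤ :=
  limUnder atTop fun n : ℕ =>
    (G.dist x ((Quotient.out ξ : Ray G) n) : ℤ) - (G.dist ((Quotient.out ξ : Ray G) n) y : ℤ)

/-- Patterson-Sullivan measures of dimension `δ`, when `T` is the minimal invariant subtree (so that
the support has to be all of `∂T`). -/
structure IsPattersonSullivan (Γ : Subgroup (G ≃g G)) (δ : ℝ) (μ : V → Measure (Boundary G)) :
    Prop where
  finite : ∀ x, IsFiniteMeasure (μ x)
  support : ∀ x, ∀ U : Set (Boundary G), IsOpen U → U.Nonempty → 0 < μ x U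
  equivariant : ∀ γ : Γ, ∀ x, (μ x).map (fun ξ => γ • ξ) = μ (γ • x)
  conformal : ∀ x y, μ x = (μ y).withDensity fun ξ =>
    ENNReal.ofReal (Real.exp (-δ * (busemann ξ x y : ℝ)))

open Classical in
/-- The distance `d_{x₀}(ξ, η) = exp (-u)` on `∂T`, with `u` the length of the intersection of the
rays from `x₀` to `ξ` and to `η`. -/
def visualDist (x₀ : V) (ξ η : Boundary G) : ℝ :=
  if ξ = η then 0 else
    Real.exp (-((sSup {n : ℕ | ∃ r s : Ray G, r 0 = x₀ ∧ s 0 = x₀ ∧ r.lim = ξ ∧ s.lim = η ∧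
      r n = s n} : ℕ) : ℝ))

/-- The algebraic distance along `ℓ` from `ℓ(0)` to the point of `ℓ` closest to `x₀`. -/
def nearestTime (x₀ : V) (l : Line G) : ℤ := Function.argmin fun n : ℤ => G.dist x₀ (l n)

/-- The parametrisation `ℓ ↦ (ℓ_-, ℓ_+, t)` of `𝒢T`; it is injective, with image
`{(ξ, η, t) | ξ ≠ η}`. -/
def hopf (x₀ : V) (l : Line G) : (Boundary G × Boundary G) × ℤ :=
  ((l.endMinus, l.endPlus), nearestTime x₀ l)

/-- The Bowen-Margulis measure on `𝒢T`:
`dμ_{x₀}(ℓ_-) dμ_{x₀}(ℓ_+) dt / d_{x₀}(ℓ_-, ℓ_+)^{2δ}` in the parametrisation `hopf x₀`. -/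
def bowenMargulisLift (δ : ℝ) (μ : V → Measure (Boundary G)) (x₀ : V) : Measure (Line G) :=
  Measure.comap (hopf x₀)
    ((((μ x₀).prod (μ x₀)).withDensity fun p =>
      (ENNReal.ofReal (visualDist x₀ p.1 p.2 ^ (2 * δ)))⁻¹).prod Measure.count)

/-- The measure induced on `Γ\𝒢T` by a `Γ`-invariant measure `m` on `𝒢T`. The geodesics with
`ℓ(0) ∈ Γv` are, modulo `Γ`, the geodesics with `ℓ(0) = v` modulo the finite group `Γ_v`; so one sums
over representatives `v` of the orbits of vertices the images of `m` restricted to `ℓ(0) = v`, divided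
by the order of `Γ_v`. When `Γ` acts freely on `𝒢T`, this is the measure `m'` with `m' (proj B) = m B`
whenever `proj` is injective on the Borel set `B`. -/
def quotientMeasure (Γ : Subgroup (G ≃g G)) (m : Measure (Line G)) : Measure (QuotientLines Γ) :=
  Measure.sum fun o : MulAction.orbitRel.Quotient Γ V =>
    ((Nat.card (MulAction.stabilizer Γ (Quotient.out o : V)) : ℝ≥0∞)⁻¹) •
      (m.restrict {l | l 0 = (Quotient.out o : V)}).map (proj Γ)

/-- The Bowen-Margulis measure on `Γ\𝒢T`, before normalisation, for a Patterson-Sullivan measure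
`μ` of dimension `δ`. -/
def bowenMargulis (Γ : Subgroup (G ≃g G)) (δ : ℝ) (μ : V → Measure (Boundary G)) (x₀ : V) :
    Measure (QuotientLines Γ) :=
  quotientMeasure Γ (bowenMargulisLift δ μ x₀)

/-! ### The coding partition -/

/-- The choices made for the coding: the lifts of the maximal cuspidal rays are those of a
decomposition, and the chosen lifts of the edges of `X₀` form a set of edges of `T` containing exactly
one representative of each edge of `X₀`, and stable under reversal. -/
structure CodingData (Γ : Subgroup (G ≃g G)) extends CuspidalDecomposition Γ where
  maximal : ∀ i, IsMaximalCuspidalRay Γ (ray i)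
  edgeLift : Set G.Dart
  edgeLift_core : edgeLift ⊆ toCuspidalDecomposition.coreEdges
  edgeLift_symm : ∀ d ∈ edgeLift, d.symm ∈ edgeLift
  edgeLift_unique : ∀ d ∈ toCuspidalDecomposition.coreEdges, ∃! e, e ∈ edgeLift ∧ EdgeEquiv Γ e d

namespace CodingData

variable {Γ : Subgroup (G ≃g G)} (D : CodingData Γ)

/-- `Γ_{i,n}`, the stabiliser of the origin of the edge `a_{i,n}`. -/
def cuspGroup (i : Fin D.r) (n : ℕ) : Subgroup Γ := MulAction.stabilizer Γ (D.ray i n).fst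

/-- The letters: the oriented edges of `Γ\T`, namely those of `X₀` (`core`), the `a_{i,n}` (`up`) and
their opposites (`down`), the elements of `(Γ_{i,n+1} - Γ_{i,n})/Γ_{i,n}` (`turnUp`) and those of
`Γ_{i,n}\(Γ_{i,n+1} - Γ_{i,n})` (`turnDown`). -/
inductive Letter
  | core (d : D.edgeLift)
  | up (i : Fin D.r) (n : ℕ)
  | down (i : Fin D.r) (n : ℕ)
  | turnUp (i : Fin D.r) (n : ℕ)
      (q : {q : Γ ⧸ D.cuspGroup i n //
        ∃ g, g ∈ D.cuspGroup i (n + 1) ∧ g ∉ D.cuspGroup i n ∧ QuotientGroup.mk g = q})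
  | turnDown (i : Fin D.r) (n : ℕ)
      (q : {q : Quotient (QuotientGroup.rightRel (D.cuspGroup i n)) //
        ∃ g, g ∈ D.cuspGroup i (n + 1) ∧ g ∉ D.cuspGroup i n ∧ Quotient.mk _ g = q})

/-- The sets `E_β` of geodesics of `T`. In the last two cases the condition does not depend on the
representative `g`. -/
def cell : D.Letter → Set (Line G)
  | .core d => {l | l.edge 0 = d}
  | .up i n => {l | l.edge 0 = D.ray i n ∧ l.edge 1 = D.ray i (n + 1) ∧ l.edge (-n) = D.ray i 0}
  | .down i n => {l | l.edge 0 = (D.ray i n).symm ∧ l.edge (-1) = (D.ray i (n + 1)).symm ∧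
      l.edge n = (D.ray i 0).symm}
  | .turnUp i n q => {l | l.edge 0 = D.ray i n ∧
      (∃ g : Γ, QuotientGroup.mk g = q.1 ∧ l.edge 1 = g • (D.ray i n).symm) ∧
      l.edge (-n) = D.ray i 0}
  | .turnDown i n q => {l | l.edge 0 = (D.ray i n).symm ∧
      (∃ g : Γ, Quotient.mk _ g = q.1 ∧ l.edge (-1) = g⁻¹ • D.ray i n) ∧
      l.edge n = (D.ray i 0).symm}

/-- The partition `𝒫`: the images of the sets `E_β` in `Γ\𝒢T`. -/
def piece (β : D.Letter) : Set (QuotientLines Γ) := proj Γ '' D.cell β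

end CodingData

/-- A family of sets is a partition into measurable sets. -/
structure IsMeasurablePartition {Ω A : Type*} [MeasurableSpace Ω] (E : A → Set Ω) : Prop where
  measurable : ∀ α, MeasurableSet (E α)
  disjoint : ∀ α β, α ≠ β → Disjoint (E α) (E β)
  cover : ⋃ α, E α = Set.univ

/-- The entropy `∑ -P(E_α) log P(E_α)`, in `[0, ∞]`, of a partition for the probability measure `P`
(with `0 log 0 = 0`). -/
def partitionEntropy {Ω A : Type*} [MeasurableSpace Ω] (P : Measure Ω) (E : A → Set Ω) : ℝ≥0∞ :=
  ∑' α, ENNReal.ofReal (Real.negMulLog (P.real (E α)))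

end TreeFlow

end

namespace TreeFlow

variable {V : Type*} {G : SimpleGraph V}

/-! ### Distances in trees -/

/-! Write p = e^{-δ}, and let A be the mass, seen from the origin of a cuspidal ray a, of the ends
which do not lie beyond its first edge (the exterior of the horoball). On geodesics through a vertex
v the Bowen-Margulis measure is the product μ_v × μ_v in the two ends: changing the base point
multiplies the product measure and its density by inverse factors (`pairMeasure_adj`), and the
density is 1 when the base point is on the geodesic. So a piece of level n in a cusp, where the
geodesic enters through the origin of the ray and is at height n, has mass at most μ(exterior)
μ(up), both factors seen from the n-th vertex; pieces of geodesics going down reduce to this one by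
conformality (`levelBound_bowenMargulis`).

The first factor is p^n A. For the second, split the ends according to the number k of further
levels climbed before the ray turns back. A ray turning at level m leaves through one of at most
|Γ_m| translates of the exterior, each of mass p^m A, and |Γ_m| is at most the largest number b_m of
vertices in a ball of radius m, because the core stabilisers are trivial. If the end of the cuspidal
ray is not an atom, the product is therefore at most A² ∑_{m ≥ n} b_m p^{2m}, and the decay in n is
exponential as soon as ∑ b_m y^m converges for y < p (`exists_horoball_bound`).

This convergence says that the tree grows no faster than the core. Disjoint shadows bound the series
of the core at every y < p (`coreSeries_lt_top`). A vertex of a horoball is reached by climbing k +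
j levels and descending j, so the series of the tree at y is controlled by that of the core at y and
by ∑ b_m y^{2m} (`sphereSeries_le`). Repeated squaring makes the argument as small as needed, and
for small arguments uniformity of the tree gives convergence, b being finite and submultiplicative
(`ballSeries_lt_top`).

It remains to exclude atoms (`measure_lim_eq_zero`). First δ > 0: otherwise all the μ_x coincide,
and the finite measure would give the same positive mass to arbitrarily many disjoint translates of
the exterior, since stabilisers grow along the cusp by minimality. If a cusp were an atom, its orbit
would have finite total mass, so the Poincaré series, hence ∑ b_m p^m, would converge at p. But by
submultiplicativity convergence is an open condition, and it would persist at an exponent smaller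
than the critical one (`ballSeries_eq_top`).

Finally there are finitely many core letters and boundedly many letters at each level of each cusp,
so the masses are summable, and -t log t ≤ 2√t keeps the entropy terms exponentially small. The
partition property rests on the trivial stabiliser of the origin of a cuspidal ray: a passage
through a cusp has exactly one translate entering along the chosen lift (`upSet_unique`). -/

/-- Both neighbours would be penultimate vertices of shortest paths from `b` to `v`, and a tree has
only one path between two vertices. -/
theorem parent_unique (hT : G.IsTree) (b : V) {u u' v : V} (h : G.Adj u v) (h' : G.Adj u' v)
    (hd : G.dist b v = G.dist b u + 1) (hd' : G.dist b v = G.dist b u' + 1) : u = u' := by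
  obtain ⟨p, hp⟩ := hT.connected.exists_walk_length_eq_dist b u
  obtain ⟨q, hq⟩ := hT.connected.exists_walk_length_eq_dist b u'
  have h1 := (p.concat h).isPath_of_length_eq_dist (by rw [SimpleGraph.Walk.length_concat]; omega)
  have h2 := (q.concat h').isPath_of_length_eq_dist (by rw [SimpleGraph.Walk.length_concat]; omega)
  have e := congrArg Subtype.val
    ((hT.isAcyclic.subsingleton_path _ _).elim (⟨_, h1⟩ : G.Path b v) ⟨_, h2⟩)
  have := congrArg SimpleGraph.Walk.penultimate e
  simpa using this

theorem exists_parent (hT : G.IsTree) {b v : V} (h : v ≠ b) :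
    ∃ p, G.Adj p v ∧ G.dist b v = G.dist b p + 1 := by
  obtain ⟨w, hw⟩ := hT.connected.exists_walk_length_eq_dist v b
  cases w with
  | nil => exact absurd rfl h
  | @cons _ p _ hadj w =>
    refine ⟨p, hadj.symm, ?_⟩
    have h1 : G.dist p b ≤ w.length := SimpleGraph.dist_le w
    rw [SimpleGraph.Walk.length_cons] at hw
    rcases hT.dist_eq_dist_add_one_of_adj b hadj with h2 | h2
    · exact h2
    · rw [SimpleGraph.dist_comm, G.dist_comm (u := b)] at h2
      omega

/-- Once the distance to `b` has increased, a decrease would lead back to the unique parent, which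
is the preceding vertex. -/
theorem dist_add_of_nonbacktracking (hT : G.IsTree) (b : V) {w : ℕ → V}
    (hadj : ∀ n, G.Adj (w n) (w (n + 1))) (hnb : ∀ n, w (n + 2) ≠ w n)
    (h0 : G.dist b (w 1) = G.dist b (w 0) + 1) (n : ℕ) :
    G.dist b (w n) = G.dist b (w 0) + n := by
  have key : ∀ n, G.dist b (w (n + 1)) = G.dist b (w n) + 1 := by
    intro n
    induction n with
    | zero => exact h0
    | succ n ih =>
      rcases hT.dist_eq_dist_add_one_of_adj b (hadj (n + 1)) with h | h
      · exact absurd (parent_unique hT b (hadj n) (hadj (n + 1)).symm ih h).symm (hnb n)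
      · exact h
  induction n with
  | zero => rfl
  | succ n ih => rw [key, ih]; ring

theorem dist_of_nonbacktracking (hT : G.IsTree) {w : ℕ → V}
    (hadj : ∀ n, G.Adj (w n) (w (n + 1))) (hnb : ∀ n, w (n + 2) ≠ w n) (n : ℕ) :
    G.dist (w 0) (w n) = n := by
  have := dist_add_of_nonbacktracking hT (w 0) hadj hnb
    (by simpa using SimpleGraph.dist_eq_one_iff_adj.2 (hadj 0)) n
  simpa using this

theorem injective_of_nonbacktracking (hT : G.IsTree) {w : ℕ → V}
    (hadj : ∀ n, G.Adj (w n) (w (n + 1))) (hnb : ∀ n, w (n + 2) ≠ w n) :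
    Function.Injective w := by
  have key : ∀ m k, w m = w (m + k) → k = 0 := by
    intro m k h
    have := dist_of_nonbacktracking hT (w := fun n => w (m + n)) (fun n => hadj (m + n))
      (fun n => hnb (m + n)) k
    simpa [← h] using this.symm
  intro m n h
  rcases le_total m n with hl | hl
  · obtain ⟨k, rfl⟩ := Nat.exists_eq_add_of_le hl
    rw [key m k h, add_zero]
  · obtain ⟨k, rfl⟩ := Nat.exists_eq_add_of_le hl
    rw [key n k h.symm, add_zero]

/-- The distance to `b` cannot decrease forever; `n` is the first time at which it increases. Along
a cuspidal ray it measures how far the geodesic towards `b` climbs. -/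
theorem exists_increasing (hT : G.IsTree) (b : V) {w : ℕ → V}
    (hadj : ∀ n, G.Adj (w n) (w (n + 1))) :
    ∃ n, G.dist b (w (n + 1)) = G.dist b (w n) + 1 ∧ G.dist b (w 0) = G.dist b (w n) + n := by
  have hex : ∃ n, G.dist b (w (n + 1)) = G.dist b (w n) + 1 := by
    by_contra! hcon
    have : ∀ n, G.dist b (w n) + n = G.dist b (w 0) := by
      intro n
      induction n with
      | zero => rfl
      | succ n ih =>
        rcases hT.dist_eq_dist_add_one_of_adj b (hadj n) with h | h
        · omega
        · exact absurd h (hcon n)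
    have := this (G.dist b (w 0) + 1)
    omega
  classical
  have hmin : ∀ m ≤ Nat.find hex, G.dist b (w 0) = G.dist b (w m) + m := by
    intro m
    induction m with
    | zero => simp
    | succ m ih =>
      intro hm
      have := ih (by omega)
      have h2 := Nat.find_min hex (m := m) (by omega)
      rcases hT.dist_eq_dist_add_one_of_adj b (hadj m) with h | h
      · omega
      · exact absurd h h2
  exact ⟨Nat.find hex, Nat.find_spec hex, hmin _ le_rfl⟩

theorem dist_smul_le (hT : G.IsTree) (γ : G ≃g G) (u v : V) :
    G.dist (γ • u) (γ • v) ≤ G.dist u v := by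
  obtain ⟨p, hp⟩ := hT.connected.exists_walk_length_eq_dist u v
  rw [← hp, ← SimpleGraph.Walk.length_map γ.toHom p]
  exact SimpleGraph.dist_le _

theorem dist_smul (hT : G.IsTree) (γ : G ≃g G) (u v : V) :
    G.dist (γ • u) (γ • v) = G.dist u v := by
  refine le_antisymm (dist_smul_le hT γ u v) ?_
  simpa using dist_smul_le hT γ⁻¹ (γ • u) (γ • v)

theorem adj_smul (γ : G ≃g G) {u v : V} (h : G.Adj u v) : G.Adj (γ • u) (γ • v) :=
  γ.map_adj_iff.2 h

/-- A set stable under passing to the parent towards `b` is a subtree. This is the form in which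
minimality of the tree is applied. -/
theorem induce_connected (S : Set V) {b : V} (hb : b ∈ S)
    (h : ∀ v ∈ S, v ≠ b → ∃ p ∈ S, G.Adj p v ∧ G.dist b v = G.dist b p + 1) :
    (G.induce S).Connected := by
  have key : ∀ n, ∀ v : S, G.dist b v = n → (G.induce S).Reachable ⟨b, hb⟩ v := by
    intro n
    induction n with
    | zero =>
      intro v hv
      by_cases hvb : v.1 = b
      · have : v = ⟨b, hb⟩ := Subtype.ext hvb
        rw [this]
      · obtain ⟨p, _, _, h2⟩ := h v v.2 hvb
        omega
    | succ n ih =>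
      intro v hv
      by_cases hvb : v.1 = b
      · rw [hvb] at hv; simp at hv
      · obtain ⟨p, hp, hadj, h2⟩ := h v v.2 hvb
        exact (ih ⟨p, hp⟩ (by simp only; omega)).trans
          (SimpleGraph.Adj.reachable (G := G.induce S) (u := ⟨p, hp⟩) (v := v) hadj)
  have : Nonempty S := ⟨⟨b, hb⟩⟩
  exact ⟨fun u v => (key _ u rfl).symm.trans (key _ v rfl)⟩

end TreeFlow

namespace TreeFlow

variable {V : Type*} {G : SimpleGraph V}

/-! ### Rays to ends -/

@[ext] theorem Ray.ext' {r s : Ray G} (h : ∀ n, r n = s n) : r = s := by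
  cases r; cases s
  congr
  exact funext h

theorem Ray.ne_add_two (r : Ray G) (n : ℕ) : r (n + 2) ≠ r n := fun h => by
  have := r.inj h
  omega

/-- The ray given by a sequence without backtracking. -/
def Ray.ofNonbacktracking (hT : G.IsTree) (w : ℕ → V) (hadj : ∀ n, G.Adj (w n) (w (n + 1)))
    (hnb : ∀ n, w (n + 2) ≠ w n) : Ray G :=
  ⟨w, hadj, injective_of_nonbacktracking hT hadj hnb⟩

theorem Ray.lim_eq_iff {r s : Ray G} :
    r.lim = s.lim ↔ ∃ m n : ℕ, ∀ k, r (m + k) = s (n + k) := Quotient.eq (r := raySetoid G)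

/-- The ray without its first edges. -/
def Ray.drop (r : Ray G) (k : ℕ) : Ray G :=
  ⟨fun n => r (k + n), fun n => r.adj (k + n), fun a b h => by simpa using r.inj h⟩

@[simp] theorem Ray.drop_apply (r : Ray G) (k n : ℕ) : r.drop k n = r (k + n) := rfl

@[simp] theorem Ray.lim_drop (r : Ray G) (k : ℕ) : (r.drop k).lim = r.lim :=
  Ray.lim_eq_iff.2 ⟨0, k, fun n => by simp⟩

/-- The ray with one more edge at its origin. -/
def Ray.cons (hT : G.IsTree) (r : Ray G) (x : V) (hadj : G.Adj x (r 0)) (hne : r 1 ≠ x) : Ray G :=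
  Ray.ofNonbacktracking hT (fun n => Nat.casesOn n x r)
    (fun n => by cases n with
      | zero => exact hadj
      | succ n => exact r.adj n)
    (fun n => by cases n with
      | zero => exact hne
      | succ n => exact r.ne_add_two n)

@[simp] theorem Ray.cons_zero (hT : G.IsTree) (r : Ray G) (x : V) (hadj : G.Adj x (r 0))
    (hne : r 1 ≠ x) : r.cons hT x hadj hne 0 = x := rfl

@[simp] theorem Ray.cons_succ (hT : G.IsTree) (r : Ray G) (x : V) (hadj : G.Adj x (r 0))
    (hne : r 1 ≠ x) (n : ℕ) : r.cons hT x hadj hne (n + 1) = r n := rfl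

@[simp] theorem Ray.lim_cons (hT : G.IsTree) (r : Ray G) (x : V) (hadj : G.Adj x (r 0))
    (hne : r 1 ≠ x) : (r.cons hT x hadj hne).lim = r.lim :=
  Ray.lim_eq_iff.2 ⟨1, 0, fun k => by rw [zero_add, add_comm, Ray.cons_succ]⟩

theorem Ray.dist_zero (hT : G.IsTree) (r : Ray G) (n : ℕ) : G.dist (r 0) (r n) = n :=
  dist_of_nonbacktracking hT r.adj r.ne_add_two n

theorem Ray.dist_add (hT : G.IsTree) (r : Ray G) (m n : ℕ) : G.dist (r m) (r (m + n)) = n :=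
  (r.drop m).dist_zero hT n

/-- Two sequences of vertices along which the distance to `b` is the same and grows, and which agree
from some time on, agree. -/
theorem eq_of_eventually_eq (hT : G.IsTree) (b : V) {r s : ℕ → V}
    (hr : ∀ n, G.Adj (r n) (r (n + 1))) (hs : ∀ n, G.Adj (s n) (s (n + 1))) {c : ℕ}
    (hdr : ∀ n, G.dist b (r n) = c + n) (hds : ∀ n, G.dist b (s n) = c + n) {n : ℕ}
    (h : r n = s n) : ∀ m ≤ n, r m = s m := by
  induction n with
  | zero => intro m hm; rwa [Nat.le_zero.1 hm]
  | succ n ih =>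
    intro m hm
    rcases Nat.le_succ_iff.1 hm with hm | rfl
    · refine ih (parent_unique hT b (hr n) (h ▸ hs n) ?_ ?_) m hm
      · rw [hdr, hdr]; ring
      · rw [hdr, hds]; ring
    · exact h

/-- The origin of a ray is moved along a walk to `x`: each step either removes the first edge of the
ray or adds one. -/
theorem exists_ray_from (hT : G.IsTree) (x : V) (ξ : Boundary G) :
    ∃ r : Ray G, r 0 = x ∧ r.lim = ξ := by
  obtain ⟨r, rfl⟩ : ∃ r : Ray G, r.lim = ξ := Quotient.exists_rep ξ
  obtain ⟨w⟩ := hT.connected (r 0) x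
  have key : ∀ (y z : V) (_ : G.Walk y z), (∃ s : Ray G, s 0 = y ∧ s.lim = r.lim) →
      ∃ s : Ray G, s 0 = z ∧ s.lim = r.lim := by
    intro y z w
    induction w with
    | nil => exact id
    | @cons y y' z hadj w ih =>
      rintro ⟨s, hs, hl⟩
      apply ih
      by_cases h1 : s 1 = y'
      · exact ⟨s.drop 1, h1, by rw [Ray.lim_drop, hl]⟩
      · exact ⟨s.cons hT y' (hs ▸ hadj.symm) h1, rfl, by rw [Ray.lim_cons, hl]⟩
  exact key _ _ w ⟨r, rfl, rfl⟩

/-- Time along a ray is the distance to its origin, so the two shifts in the equivalence are equal;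
then parents are compared backwards from the common tail. -/
theorem ray_unique (hT : G.IsTree) {r s : Ray G} (h0 : r 0 = s 0) (hl : r.lim = s.lim) : r = s := by
  obtain ⟨m, n, h⟩ := Ray.lim_eq_iff.1 hl
  have hmn : m = n := by
    have h1 := r.dist_zero hT m
    have h2 := s.dist_zero hT n
    have h3 := h 0
    simp only [add_zero] at h3
    rw [h0, h3, h2] at h1
    exact h1.symm
  subst hmn
  ext k
  refine eq_of_eventually_eq hT (r 0) (c := 0) r.adj s.adj (fun n => ?_) (fun n => ?_) (h k) k
    (by omega)
  · rw [zero_add, r.dist_zero hT]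
  · rw [zero_add, h0, s.dist_zero hT]

/-- The ray from a vertex to an end of the tree. -/
noncomputable def rayTo (hT : G.IsTree) (x : V) (ξ : Boundary G) : Ray G :=
  (exists_ray_from hT x ξ).choose

@[simp] theorem rayTo_zero (hT : G.IsTree) (x : V) (ξ : Boundary G) : rayTo hT x ξ 0 = x :=
  (exists_ray_from hT x ξ).choose_spec.1

@[simp] theorem lim_rayTo (hT : G.IsTree) (x : V) (ξ : Boundary G) : (rayTo hT x ξ).lim = ξ :=
  (exists_ray_from hT x ξ).choose_spec.2

theorem rayTo_lim (hT : G.IsTree) (r : Ray G) : rayTo hT (r 0) r.lim = r :=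
  ray_unique hT (by simp) (by simp)

theorem rayTo_eq (hT : G.IsTree) {r : Ray G} {x : V} {ξ : Boundary G} (h0 : r 0 = x)
    (hl : r.lim = ξ) : rayTo hT x ξ = r := by
  subst h0 hl; exact rayTo_lim hT r

theorem dist_rayTo (hT : G.IsTree) (x : V) (ξ : Boundary G) (n : ℕ) :
    G.dist x (rayTo hT x ξ n) = n := by
  simpa using (rayTo hT x ξ).dist_zero hT n

theorem rayTo_add (hT : G.IsTree) (x : V) (ξ : Boundary G) (m n : ℕ) :
    rayTo hT x ξ (m + n) = rayTo hT (rayTo hT x ξ m) ξ n := by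
  rw [rayTo_eq hT (x := rayTo hT x ξ m) (r := (rayTo hT x ξ).drop m) (by simp) (by simp)]
  rfl

theorem rayTo_of_adj (hT : G.IsTree) {x y : V} (hadj : G.Adj x y) {ξ : Boundary G}
    (h : rayTo hT y ξ 1 ≠ x) (n : ℕ) : rayTo hT x ξ (n + 1) = rayTo hT y ξ n := by
  rw [rayTo_eq hT (r := (rayTo hT y ξ).cons hT x (by simpa using hadj) h) (by simp) (by simp)]
  rfl

theorem rayTo_one_of_ne (hT : G.IsTree) {x y : V} (hadj : G.Adj x y) {ξ : Boundary G}
    (h : rayTo hT y ξ 1 ≠ x) : rayTo hT x ξ 1 = y := by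
  simpa using rayTo_of_adj hT hadj h 0

theorem rayTo_one_ne (hT : G.IsTree) {x y : V} {ξ : Boundary G}
    (h : rayTo hT x ξ 1 = y) : rayTo hT y ξ 1 ≠ x := by
  intro h2
  have := rayTo_add hT x ξ 1 1
  rw [h, h2] at this
  exact (rayTo hT x ξ).ne_add_two 0 (by simpa using this)

/-- An edge cuts the space of ends into two complementary pieces. -/
theorem rayTo_one_eq_iff (hT : G.IsTree) {x y : V} (hadj : G.Adj x y) {ξ : Boundary G} :
    rayTo hT x ξ 1 = y ↔ rayTo hT y ξ 1 ≠ x :=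
  ⟨rayTo_one_ne hT, rayTo_one_of_ne hT hadj⟩

theorem rayTo_eq_of_le (hT : G.IsTree) {x : V} {ξ η : Boundary G} {n : ℕ}
    (h : rayTo hT x ξ n = rayTo hT x η n) : ∀ m ≤ n, rayTo hT x ξ m = rayTo hT x η m :=
  eq_of_eventually_eq hT x (c := 0) (rayTo hT x ξ).adj (rayTo hT x η).adj
    (fun n => by rw [zero_add, dist_rayTo]) (fun n => by rw [zero_add, dist_rayTo]) h

theorem eq_of_rayTo_eq (hT : G.IsTree) {x : V} {ξ η : Boundary G}
    (h : ∀ n, rayTo hT x ξ n = rayTo hT x η n) : ξ = η := by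
  rw [← lim_rayTo hT x ξ, ← lim_rayTo hT x η, Ray.ext' h]

/-- If the distance to `x` grows along a ray, the ray from `x` to its end follows it. -/
theorem rayTo_of_dist (hT : G.IsTree) {x : V} {r : Ray G} {c : ℕ}
    (h : ∀ n, G.dist x (r n) = c + n) (n : ℕ) : rayTo hT x r.lim (c + n) = r n := by
  obtain ⟨m, k, hk⟩ := Ray.lim_eq_iff.1 (lim_rayTo hT x r.lim)
  have hm : m = c + k := by
    have := hk 0
    have h2 := dist_rayTo hT x r.lim m
    simp only [add_zero] at this
    rw [this, h] at h2
    exact h2.symm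
  subst hm
  refine eq_of_eventually_eq hT x (c := c) (r := fun n => rayTo hT x r.lim (c + n)) (s := r)
    (n := k + n) (fun n => (rayTo hT x r.lim).adj _) r.adj (fun n => dist_rayTo hT _ _ _) h ?_ n
    (by omega)
  rw [← add_assoc]
  exact hk n

theorem rayTo_of_dist_one (hT : G.IsTree) {x : V} {r : Ray G}
    (h : G.dist x (r 1) = G.dist x (r 0) + 1) (n : ℕ) :
    rayTo hT x r.lim (G.dist x (r 0) + n) = r n :=
  rayTo_of_dist hT (dist_add_of_nonbacktracking hT x r.adj r.ne_add_two h) n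

@[simp] theorem Ray.smul_apply (γ : G ≃g G) (r : Ray G) (n : ℕ) : (γ • r) n = γ • r n := rfl

theorem Ray.smul_lim (γ : G ≃g G) (r : Ray G) : (γ • r).lim = γ • r.lim := rfl

theorem rayTo_smul (hT : G.IsTree) (γ : G ≃g G) (x : V) (ξ : Boundary G) (n : ℕ) :
    rayTo hT (γ • x) (γ • ξ) n = γ • rayTo hT x ξ n := by
  rw [rayTo_eq hT (r := γ • rayTo hT x ξ) (by simp) (by rw [Ray.smul_lim, lim_rayTo])]
  rfl

/-! ### Shadows -/

theorem mem_shadow (hT : G.IsTree) {d : G.Dart} {ξ : Boundary G} :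
    ξ ∈ shadow d ↔ rayTo hT d.fst ξ 1 = d.snd := by
  constructor
  · rintro ⟨r, h0, h1, hl⟩
    rw [rayTo_eq hT h0 hl, h1]
  · intro h
    exact ⟨rayTo hT d.fst ξ, by simp, h, by simp⟩

theorem shadow_symm (hT : G.IsTree) (d : G.Dart) : shadow d.symm = (shadow d)ᶜ := by
  ext ξ
  rw [Set.mem_compl_iff, mem_shadow hT, mem_shadow hT, ← ne_eq, ← rayTo_one_eq_iff hT d.adj.symm]
  rfl

theorem isOpen_shadow (d : G.Dart) : IsOpen (shadow d) :=
  TopologicalSpace.isOpen_generateFrom_of_mem ⟨d, rfl⟩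

theorem measurableSet_shadow (d : G.Dart) : MeasurableSet (shadow d) :=
  (isOpen_shadow d).measurableSet

theorem smul_mem_shadow (hT : G.IsTree) (γ : G ≃g G) {d : G.Dart} {ξ : Boundary G} :
    γ • ξ ∈ shadow (γ • d) ↔ ξ ∈ shadow d := by
  rw [mem_shadow hT, mem_shadow hT]
  change rayTo hT (γ • d.fst) (γ • ξ) 1 = γ • d.snd ↔ _
  rw [rayTo_smul]
  exact smul_left_cancel_iff _

/-- When not empty and `n > 0`, the set is the shadow of the last edge of the path from `x` to `q`.
-/
theorem isOpen_rayTo_eq (hT : G.IsTree) (x : V) (n : ℕ) (q : V) :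
    IsOpen {ξ : Boundary G | rayTo hT x ξ n = q} := by
  rcases Set.eq_empty_or_nonempty {ξ : Boundary G | rayTo hT x ξ n = q} with h | ⟨ξ₀, h₀⟩
  · rw [h]; exact isOpen_empty
  cases n with
  | zero =>
    convert isOpen_univ
    ext ξ
    simp only [Set.mem_ofPred_eq, rayTo_zero] at h₀ ⊢
    simpa using h₀
  | succ n =>
    have hr := (rayTo hT x ξ₀).adj n
    convert isOpen_shadow ⟨(rayTo hT x ξ₀ n, rayTo hT x ξ₀ (n + 1)), hr⟩
    ext ξ
    rw [mem_shadow hT]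
    simp only [Set.mem_ofPred_eq] at h₀ ⊢
    constructor
    · intro h
      have h1 := rayTo_eq_of_le hT (h.trans h₀.symm) n (by omega)
      rw [← h1, ← rayTo_add, h, h₀]
    · intro h
      have h2 : rayTo hT x (rayTo hT (rayTo hT x ξ₀ n) ξ).lim (n + 1) =
          rayTo hT (rayTo hT x ξ₀ n) ξ 1 := by
        have := rayTo_of_dist_one hT (x := x) (r := rayTo hT (rayTo hT x ξ₀ n) ξ)
          (by rw [h, rayTo_zero, dist_rayTo, dist_rayTo]) 1
        rwa [rayTo_zero, dist_rayTo] at this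
      rw [lim_rayTo] at h2
      rw [h2, h, h₀]

theorem measurableSet_rayTo_eq (hT : G.IsTree) (x : V) (n : ℕ) (q : V) :
    MeasurableSet {ξ : Boundary G | rayTo hT x ξ n = q} :=
  (isOpen_rayTo_eq hT x n q).measurableSet

theorem measurable_smul_boundary (hT : G.IsTree) (γ : G ≃g G) :
    Measurable fun ξ : Boundary G => γ • ξ := by
  refine Continuous.measurable (continuous_generateFrom_iff.2 ?_)
  rintro _ ⟨d, rfl⟩
  convert isOpen_shadow (γ⁻¹ • d)
  ext ξ
  rw [Set.mem_preimage, ← smul_mem_shadow hT γ⁻¹, inv_smul_smul]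

end TreeFlow

namespace TreeFlow

variable {V : Type*} {G : SimpleGraph V}

/-! ### Conformal measures along edges and geodesics -/

/-- The definition takes the limit along a chosen representative of the end; any other ray to it
agrees eventually up to a shift, so it may be used instead. -/
theorem busemann_eq_of_ray {ξ : Boundary G} {x y : V} {c : ℤ} {s : Ray G} (hs : s.lim = ξ)
    (h : ∀ n, (G.dist x (s n) : ℤ) - G.dist (s n) y = c) : busemann ξ x y = c := by
  obtain ⟨m, n, hmn⟩ := Ray.lim_eq_iff.1 (show Ray.lim (Quotient.out ξ : Ray G) = s.lim by
    rw [hs]; exact Quotient.out_eq ξ)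
  refine Tendsto.limUnder_eq (tendsto_const_nhds.congr' ?_)
  filter_upwards [eventually_ge_atTop m] with k hk
  obtain ⟨j, rfl⟩ := Nat.exists_eq_add_of_le hk
  rw [hmn, h]

theorem busemann_eq_one (hT : G.IsTree) {x y : V} {ξ : Boundary G} (h : rayTo hT x ξ 1 = y) :
    busemann ξ x y = 1 := by
  refine busemann_eq_of_ray (s := (rayTo hT x ξ).drop 1) (by simp) fun n => ?_
  have h1 := dist_rayTo hT y ξ n
  rw [← h, ← rayTo_add] at h1
  rw [Ray.drop_apply, dist_rayTo, ← h, SimpleGraph.dist_comm, h1]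
  push_cast; ring

/-- The factor by which a conformal measure of dimension `δ` changes along an edge. -/
noncomputable def edgeFactor (δ : ℝ) : ℝ≥0∞ := ENNReal.ofReal (Real.exp (-δ))

theorem edgeFactor_ne_zero (δ : ℝ) : edgeFactor δ ≠ 0 := by
  simp [edgeFactor, Real.exp_pos]

theorem edgeFactor_ne_top (δ : ℝ) : edgeFactor δ ≠ ⊤ := ENNReal.ofReal_ne_top

theorem edgeFactor_pow (δ : ℝ) (n : ℕ) :
    edgeFactor δ ^ n = ENNReal.ofReal (Real.exp (-(n * δ))) := by
  rw [edgeFactor, ← ENNReal.ofReal_pow (Real.exp_pos _).le, ← Real.exp_nat_mul]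
  ring_nf

variable {Γ : Subgroup (G ≃g G)} {δ : ℝ} {μ : V → Measure (Boundary G)}

theorem measure_edge (hT : G.IsTree) (hμ : IsPattersonSullivan Γ δ μ) {x y : V}
    {E : Set (Boundary G)} (hE : MeasurableSet E) (h : ∀ ξ ∈ E, rayTo hT x ξ 1 = y) :
    μ x E = edgeFactor δ * μ y E := by
  rw [hμ.conformal x y, withDensity_apply _ hE, ← setLIntegral_const]
  refine setLIntegral_congr_fun hE fun ξ hξ => ?_
  rw [busemann_eq_one hT (h ξ hξ)]
  simp [edgeFactor]

/-- Moving the base point one edge towards all the ends of `E` divides the mass by e^{-δ}, the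
Busemann cocycle being constant equal to 1 there; the edges of the common path are crossed one by
one. -/
theorem measure_path (hT : G.IsTree) (hμ : IsPattersonSullivan Γ δ μ) {n : ℕ} :
    ∀ {x y : V} {E : Set (Boundary G)}, MeasurableSet E → (∀ ξ ∈ E, rayTo hT x ξ n = y) →
    μ x E = edgeFactor δ ^ n * μ y E := by
  induction n with
  | zero =>
    intro x y E _ h
    rcases E.eq_empty_or_nonempty with rfl | ⟨ξ, hξ⟩
    · simp
    · have := h ξ hξ
      rw [rayTo_zero] at this
      simp [this]
  | succ n ih =>
    intro x y E hE h
    rcases E.eq_empty_or_nonempty with rfl | ⟨ξ₀, h₀⟩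
    · simp
    have h1 : ∀ ξ ∈ E, rayTo hT x ξ 1 = rayTo hT x ξ₀ 1 := fun ξ hξ =>
      rayTo_eq_of_le hT ((h ξ hξ).trans (h ξ₀ h₀).symm) 1 (by omega)
    rw [measure_edge hT hμ hE h1, ih (x := rayTo hT x ξ₀ 1) (y := y) hE, pow_succ', mul_assoc]
    intro ξ hξ
    rw [← h ξ hξ, add_comm n 1, rayTo_add, h1 ξ hξ]

theorem measure_smul (hT : G.IsTree) (hμ : IsPattersonSullivan Γ δ μ) (γ : Γ) (x : V)
    {E : Set (Boundary G)} (hE : MeasurableSet E) :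
    μ (γ • x) E = μ x ((fun ξ => γ • ξ) ⁻¹' E) := by
  have h : Measurable fun ξ : Boundary G => γ • ξ := measurable_smul_boundary hT γ.1
  rw [← hμ.equivariant γ x, Measure.map_apply h hE]

theorem restrict_edge (hT : G.IsTree) (hμ : IsPattersonSullivan Γ δ μ) (x y : V) :
    (μ x).restrict {ξ | rayTo hT x ξ 1 = y} =
      edgeFactor δ • (μ y).restrict {ξ | rayTo hT x ξ 1 = y} := by
  have hS := measurableSet_rayTo_eq hT x 1 y
  ext E hE
  rw [Measure.smul_apply, Measure.restrict_apply hE, Measure.restrict_apply hE,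
    measure_edge hT hμ (hE.inter hS) fun ξ hξ => hξ.2, smul_eq_mul]

/-! ### The product measure on pairs of ends -/

theorem visualDist_eq (hT : G.IsTree) {x : V} {ξ η : Boundary G} {u : ℕ}
    (h : rayTo hT x ξ u = rayTo hT x η u) (h' : rayTo hT x ξ (u + 1) ≠ rayTo hT x η (u + 1)) :
    visualDist x ξ η = Real.exp (-(u : ℝ)) := by
  have hne : ξ ≠ η := fun e => h' (by rw [e])
  -- The times at which the two rays agree form an initial segment, so the supremum in the
  -- definition is a maximum and equals `u`.
  have hset : {n : ℕ | ∃ r s : Ray G, r 0 = x ∧ s 0 = x ∧ r.lim = ξ ∧ s.lim = η ∧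
      r n = s n} = Set.Iic u := by
    ext n
    rw [Set.mem_ofPred_eq, Set.mem_Iic]
    constructor
    · rintro ⟨r, s, hr, hs, hrl, hsl, hn⟩
      rw [← rayTo_eq hT hr hrl, ← rayTo_eq hT hs hsl] at hn
      by_contra! hlt
      exact h' (rayTo_eq_of_le hT hn _ hlt)
    · intro hn
      exact ⟨rayTo hT x ξ, rayTo hT x η, by simp, by simp, by simp, by simp,
        rayTo_eq_of_le hT h n hn⟩
  rw [visualDist, if_neg hne, hset, csSup_Iic]

theorem exists_split (hT : G.IsTree) (x : V) {ξ η : Boundary G} (hne : ξ ≠ η) :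
    ∃ u, rayTo hT x ξ u = rayTo hT x η u ∧ rayTo hT x ξ (u + 1) ≠ rayTo hT x η (u + 1) := by
  by_contra! hcon
  refine hne (eq_of_rayTo_eq hT (x := x) fun n => ?_)
  induction n with
  | zero => simp
  | succ n ih => exact hcon n ih

/-- The density of the Bowen-Margulis measure with respect to the product measure. -/
noncomputable def bmDensity (δ : ℝ) (x : V) (p : Boundary G × Boundary G) : ℝ≥0∞ :=
  (ENNReal.ofReal (visualDist x p.1 p.2 ^ (2 * δ)))⁻¹

theorem bmDensity_eq (hT : G.IsTree) {x : V} {p : Boundary G × Boundary G} {u : ℕ}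
    (h : rayTo hT x p.1 u = rayTo hT x p.2 u)
    (h' : rayTo hT x p.1 (u + 1) ≠ rayTo hT x p.2 (u + 1)) :
    bmDensity δ x p = (edgeFactor δ ^ (2 * u))⁻¹ := by
  rw [bmDensity, visualDist_eq hT h h', edgeFactor_pow, ← Real.exp_mul]
  push_cast
  ring_nf

/-- The measure on pairs of ends, seen from a vertex. -/
noncomputable def pairMeasure (δ : ℝ) (μ : V → Measure (Boundary G)) (x : V) :
    Measure (Boundary G × Boundary G) := ((μ x).prod (μ x)).withDensity (bmDensity δ x)

/-- Both ends lie beyond `y`: the product measure at `x` is e^{-2δ} times that at `y`, while the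
common part of the two rays is one edge longer and multiplies the density by e^{2δ}. -/
theorem pairMeasure_adj_diag (hT : G.IsTree) (hμ : IsPattersonSullivan Γ δ μ) {x y : V}
    {E : Set (Boundary G × Boundary G)} (hE : MeasurableSet E) (hne : ∀ p ∈ E, p.1 ≠ p.2)
    (hsub : ∀ p ∈ E, rayTo hT x p.1 1 = y ∧ rayTo hT x p.2 1 = y) :
    pairMeasure δ μ x E = pairMeasure δ μ y E := by
  have := hμ.finite x
  have := hμ.finite y
  set S := {ξ : Boundary G | rayTo hT x ξ 1 = y}
  have hES : E ⊆ S ×ˢ S := fun p hp => hsub p hp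
  have hres : ((μ x).prod (μ x)).restrict E =
      (edgeFactor δ ^ 2) • ((μ y).prod (μ y)).restrict E := by
    have : ((μ x).prod (μ x)).restrict (S ×ˢ S) =
        (edgeFactor δ ^ 2) • ((μ y).prod (μ y)).restrict (S ×ˢ S) := by
      rw [← Measure.prod_restrict, restrict_edge hT hμ x y, Measure.prod_smul_left,
        Measure.prod_smul_right, smul_smul, ← pow_two, Measure.prod_restrict]
    rw [← Set.inter_eq_self_of_subset_left hES, ← Measure.restrict_restrict hE, this,
      Measure.restrict_smul, Measure.restrict_restrict hE]
  rw [pairMeasure, pairMeasure, withDensity_apply _ hE, withDensity_apply _ hE, hres,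
    lintegral_smul_measure, smul_eq_mul, ← lintegral_const_mul' _ _
      (ENNReal.pow_ne_top (edgeFactor_ne_top δ))]
  refine setLIntegral_congr_fun hE fun p hp => ?_
  obtain ⟨u, hu, hu'⟩ := exists_split hT y (hne p hp)
  obtain ⟨h1, h2⟩ := hsub p hp
  have e : ∀ n, rayTo hT x p.1 (n + 1) = rayTo hT y p.1 n := fun n => by
    rw [add_comm, rayTo_add, h1]
  have e' : ∀ n, rayTo hT x p.2 (n + 1) = rayTo hT y p.2 n := fun n => by
    rw [add_comm, rayTo_add, h2]
  rw [bmDensity_eq hT hu hu', bmDensity_eq hT (x := x) (u := u + 1) (by rw [e, e', hu])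
    (by rwa [e, e']), mul_add, mul_one, pow_add,
    ENNReal.mul_inv (Or.inr (ENNReal.pow_ne_top (edgeFactor_ne_top δ)))
      (Or.inl (ENNReal.pow_ne_top (edgeFactor_ne_top δ))), mul_comm, mul_assoc,
    ENNReal.inv_mul_cancel (pow_ne_zero _ (edgeFactor_ne_zero δ))
      (ENNReal.pow_ne_top (edgeFactor_ne_top δ)), mul_one]

theorem pairMeasure_of_split (hT : G.IsTree) {x : V} {E : Set (Boundary G × Boundary G)}
    (hE : MeasurableSet E) (hsub : ∀ p ∈ E, rayTo hT x p.1 1 ≠ rayTo hT x p.2 1) :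
    pairMeasure δ μ x E = ((μ x).prod (μ x)) E := by
  rw [pairMeasure, withDensity_apply _ hE, ← setLIntegral_one]
  refine setLIntegral_congr_fun hE fun p hp => ?_
  rw [bmDensity_eq hT (u := 0) (by simp) (by simpa using hsub p hp)]
  simp

/-- The edge separates the two ends, so the density is 1 from both vertices, and what one factor of
the product gains in the change of base point the other loses. -/
theorem pairMeasure_adj_cross (hT : G.IsTree) (hμ : IsPattersonSullivan Γ δ μ) {x y : V}
    {E : Set (Boundary G × Boundary G)} (hE : MeasurableSet E)
    (hsub : ∀ p ∈ E, rayTo hT x p.1 1 = y ∧ rayTo hT y p.2 1 = x) :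
    pairMeasure δ μ x E = pairMeasure δ μ y E := by
  have := hμ.finite x
  have := hμ.finite y
  set S := {ξ : Boundary G | rayTo hT x ξ 1 = y}
  set S' := {ξ : Boundary G | rayTo hT y ξ 1 = x}
  have hES : E ⊆ S ×ˢ S' := fun p hp => hsub p hp
  rw [pairMeasure_of_split hT hE, pairMeasure_of_split hT hE]
  · have : ((μ x).prod (μ x)).restrict (S ×ˢ S') = ((μ y).prod (μ y)).restrict (S ×ˢ S') := by
      rw [← Measure.prod_restrict, ← Measure.prod_restrict, restrict_edge hT hμ x y,
        restrict_edge hT hμ y x, Measure.prod_smul_left, Measure.prod_smul_right]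
    have h2 := congrArg (fun m => m E) this
    simpa only [Measure.restrict_apply hE, Set.inter_eq_self_of_subset_left hES] using h2
  · intro p hp h
    obtain ⟨h1, h2⟩ := hsub p hp
    exact rayTo_one_ne hT h1 (h.trans h2)
  · intro p hp h
    obtain ⟨h1, h2⟩ := hsub p hp
    exact rayTo_one_ne hT h2 (h.symm.trans h1)

theorem pairMeasure_adj (hT : G.IsTree) (hμ : IsPattersonSullivan Γ δ μ) {x y : V}
    (hadj : G.Adj x y) {E : Set (Boundary G × Boundary G)} (hE : MeasurableSet E)
    (hne : ∀ p ∈ E, p.1 ≠ p.2) : pairMeasure δ μ x E = pairMeasure δ μ y E := by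
  have hm := measurableSet_rayTo_eq hT x 1 y
  have m1 : MeasurableSet {p : Boundary G × Boundary G | rayTo hT x p.1 1 = y} :=
    measurable_fst hm
  have m2 : MeasurableSet {p : Boundary G × Boundary G | rayTo hT x p.2 1 = y} :=
    measurable_snd hm
  have c : ∀ ξ : Boundary G, ¬ rayTo hT x ξ 1 = y ↔ rayTo hT y ξ 1 = x := fun ξ => by
    rw [rayTo_one_eq_iff hT hadj, not_not]
  rw [← measure_inter_add_sdiff E m1, ← measure_inter_add_sdiff (E ∩ _) m2,
    ← measure_inter_add_sdiff (E \ _) m2, ← measure_inter_add_sdiff (μ := pairMeasure δ μ y) E m1,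
    ← measure_inter_add_sdiff (μ := pairMeasure δ μ y) (E ∩ _) m2,
    ← measure_inter_add_sdiff (μ := pairMeasure δ μ y) (E \ _) m2]
  congr 2
  · exact pairMeasure_adj_diag hT hμ ((hE.inter m1).inter m2) (fun p hp => hne p hp.1.1)
      fun p hp => ⟨hp.1.2, hp.2⟩
  · exact pairMeasure_adj_cross hT hμ ((hE.inter m1).diff m2)
      fun p hp => ⟨hp.1.2, (c _).1 hp.2⟩
  · exact (pairMeasure_adj_cross hT hμ ((hE.diff m1).inter m2)
      fun p hp => ⟨(c _).1 hp.1.2, hp.2⟩).symm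
  · exact (pairMeasure_adj_diag hT hμ ((hE.diff m1).diff m2) (fun p hp => hne p hp.1.1)
      fun p hp => ⟨(c _).1 hp.1.2, (c _).1 hp.2⟩).symm

/-- The measure on pairs of distinct ends does not depend on the base point, which is moved along a
walk from `x` to `v`; seen from `v` the density is 1. -/
theorem pairMeasure_eq (hT : G.IsTree) (hμ : IsPattersonSullivan Γ δ μ) (x v : V)
    {E : Set (Boundary G × Boundary G)} (hE : MeasurableSet E)
    (hsub : ∀ p ∈ E, rayTo hT v p.1 1 ≠ rayTo hT v p.2 1) :
    pairMeasure δ μ x E = ((μ v).prod (μ v)) E := by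
  rw [← pairMeasure_of_split (δ := δ) hT hE hsub]
  have hne : ∀ p ∈ E, p.1 ≠ p.2 := fun p hp h => hsub p hp (by rw [h])
  obtain ⟨w⟩ := hT.connected x v
  clear hsub
  induction w with
  | nil => rfl
  | cons hadj _ ih => rw [pairMeasure_adj hT hμ hadj hE hne, ih]

end TreeFlow

namespace TreeFlow

variable {V : Type*} {G : SimpleGraph V}

/-! ### Geodesic lines and their ends -/

@[ext] theorem Line.ext' {l l' : Line G} (h : ∀ n, l n = l' n) : l = l' := by
  cases l; cases l'
  congr
  exact funext h

/-- The geodesic with the opposite direction. -/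
def Line.rev (l : Line G) : Line G :=
  ⟨fun n => l (-n), fun n => by
    have h := (l.adj (-n - 1)).symm
    rw [sub_add_cancel] at h
    rwa [neg_add, ← sub_eq_add_neg],
    fun a b h => by simpa using l.inj h⟩

@[simp] theorem Line.rev_apply (l : Line G) (n : ℤ) : l.rev n = l (-n) := rfl

theorem Line.endPlus_rev (l : Line G) : l.rev.endPlus = l.endMinus := rfl

/-- The half-line starting at time `m`. -/
def Line.rayFrom (l : Line G) (m : ℤ) : Ray G :=
  ⟨fun n => l (m + n), fun n => by
    have := l.adj (m + n); rwa [add_assoc] at this, fun a b h => by simpa using l.inj h⟩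

theorem Line.lim_rayFrom (l : Line G) (m : ℤ) : (l.rayFrom m).lim = l.endPlus := by
  refine Ray.lim_eq_iff.2 ⟨(-m).toNat, m.toNat, fun k => congrArg l.toFun ?_⟩
  push_cast
  rcases le_total 0 m with h | h
  · rw [Int.toNat_of_nonneg h, Int.toNat_of_nonpos (by omega)]; simp
  · rw [Int.toNat_of_nonpos h, Int.toNat_of_nonneg (by omega)]; simp

theorem Line.rayTo_endPlus (hT : G.IsTree) (l : Line G) (m : ℤ) (n : ℕ) :
    rayTo hT (l m) l.endPlus n = l (m + n) := by
  rw [rayTo_eq hT (r := l.rayFrom m) (by simp [Line.rayFrom]) (l.lim_rayFrom m)]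
  rfl

theorem Line.rayTo_endMinus (hT : G.IsTree) (l : Line G) (m : ℤ) (n : ℕ) :
    rayTo hT (l m) l.endMinus n = l (m - n) := by
  have := l.rev.rayTo_endPlus hT (-m) n
  rwa [Line.endPlus_rev, Line.rev_apply, Line.rev_apply, neg_neg, neg_add, neg_neg,
    ← sub_eq_add_neg] at this

/-- The vertices of the geodesic through `v` with given ends. -/
noncomputable def pairCoord (hT : G.IsTree) (v : V) (p : Boundary G × Boundary G) : ℤ → V
  | Int.ofNat n => rayTo hT v p.2 n
  | Int.negSucc n => rayTo hT v p.1 (n + 1)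

theorem pairCoord_natCast (hT : G.IsTree) (v : V) (p : Boundary G × Boundary G) (n : ℕ) :
    pairCoord hT v p n = rayTo hT v p.2 n := rfl

theorem pairCoord_neg_natCast (hT : G.IsTree) (v : V) (p : Boundary G × Boundary G) (n : ℕ) :
    pairCoord hT v p (-n) = rayTo hT v p.1 n := by
  cases n with
  | zero => rw [rayTo_zero]; exact rayTo_zero hT v p.2
  | succ n => rfl

theorem Line.eq_pairCoord (hT : G.IsTree) (l : Line G) (n : ℤ) :
    l n = pairCoord hT (l 0) (l.endMinus, l.endPlus) n := by
  obtain ⟨n, rfl | rfl⟩ := n.eq_nat_or_neg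
  · rw [pairCoord_natCast, Line.rayTo_endPlus, zero_add]
  · rw [pairCoord_neg_natCast, Line.rayTo_endMinus, zero_sub]

/-- The geodesic through `v` with given ends. -/
noncomputable def lineOf (hT : G.IsTree) (v : V) (p : Boundary G × Boundary G)
    (h : rayTo hT v p.1 1 ≠ rayTo hT v p.2 1) : Line G where
  toFun := pairCoord hT v p
  adj n := by
    rcases n with n | n
    · exact (rayTo hT v p.2).adj n
    · cases n with
      | zero =>
        have := (rayTo hT v p.1).adj 0
        rw [rayTo_zero] at this
        change G.Adj (rayTo hT v p.1 1) (rayTo hT v p.2 0)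
        rw [rayTo_zero]
        exact this.symm
      | succ n => exact ((rayTo hT v p.1).adj (n + 1)).symm
  inj := by
    have hadj : ∀ n : ℤ, G.Adj (pairCoord hT v p n) (pairCoord hT v p (n + 1)) := by
      intro n
      rcases n with n | n
      · exact (rayTo hT v p.2).adj n
      · cases n with
        | zero =>
          have := (rayTo hT v p.1).adj 0
          rw [rayTo_zero] at this
          change G.Adj (rayTo hT v p.1 1) (rayTo hT v p.2 0)
          rw [rayTo_zero]
          exact this.symm
        | succ n => exact ((rayTo hT v p.1).adj (n + 1)).symm
    have hnb : ∀ n : ℤ, pairCoord hT v p (n + 2) ≠ pairCoord hT v p n := by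
      intro n
      rcases n with n | n
      · exact (rayTo hT v p.2).ne_add_two n
      · match n with
        -- Here n = -1: this is the turn at `v`, the only place where the two rays must be assumed
        -- to differ.
        | 0 => exact h.symm
        | 1 =>
          change rayTo hT v p.2 0 ≠ rayTo hT v p.1 2
          intro h
          have h2 := dist_rayTo hT v p.1 2
          rw [← h, rayTo_zero, SimpleGraph.dist_self] at h2
          omega
        | n + 2 => exact ((rayTo hT v p.1).ne_add_two (n + 1)).symm
    have key : ∀ (m : ℤ) (k : ℕ), pairCoord hT v p m = pairCoord hT v p (m + k) → k = 0 := by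
      intro m k hk
      have := injective_of_nonbacktracking hT (w := fun k : ℕ => pairCoord hT v p (m + k))
        (fun k => by have := hadj (m + k); rwa [add_assoc] at this)
        (fun k => by have := hnb (m + k); rwa [add_assoc] at this) (a₁ := k) (a₂ := 0)
        (by simpa using hk.symm)
      exact this
    intro m n hmn
    rcases le_total m n with hl | hl
    · obtain ⟨k, rfl⟩ := Int.le.dest hl
      rw [key m k hmn]; simp
    · obtain ⟨k, rfl⟩ := Int.le.dest hl
      rw [key n k hmn.symm]; simp

theorem lineOf_apply (hT : G.IsTree) (v : V) (p : Boundary G × Boundary G)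
    (h : rayTo hT v p.1 1 ≠ rayTo hT v p.2 1) (n : ℤ) :
    lineOf hT v p h n = pairCoord hT v p n := rfl

theorem lineOf_zero (hT : G.IsTree) (v : V) (p : Boundary G × Boundary G)
    (h : rayTo hT v p.1 1 ≠ rayTo hT v p.2 1) : lineOf hT v p h 0 = v :=
  rayTo_zero hT v p.2

theorem endPlus_lineOf (hT : G.IsTree) (v : V) (p : Boundary G × Boundary G)
    (h : rayTo hT v p.1 1 ≠ rayTo hT v p.2 1) : (lineOf hT v p h).endPlus = p.2 := by
  refine eq_of_rayTo_eq hT (x := v) fun n => ?_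
  have := (lineOf hT v p h).rayTo_endPlus hT 0 n
  rwa [lineOf_zero, zero_add, lineOf_apply, pairCoord_natCast] at this

theorem endMinus_lineOf (hT : G.IsTree) (v : V) (p : Boundary G × Boundary G)
    (h : rayTo hT v p.1 1 ≠ rayTo hT v p.2 1) : (lineOf hT v p h).endMinus = p.1 := by
  refine eq_of_rayTo_eq hT (x := v) fun n => ?_
  have := (lineOf hT v p h).rayTo_endMinus hT 0 n
  rwa [lineOf_zero, zero_sub, lineOf_apply, pairCoord_neg_natCast] at this

theorem Line.ends_split (hT : G.IsTree) (l : Line G) :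
    rayTo hT (l 0) l.endMinus 1 ≠ rayTo hT (l 0) l.endPlus 1 := by
  rw [Line.rayTo_endMinus, Line.rayTo_endPlus]
  intro h
  have := l.inj h
  omega

/-! ### The Hopf parametrisation -/

theorem nearestTime_le (x : V) (l : Line G) (n : ℤ) :
    G.dist x (l (nearestTime x l)) ≤ G.dist x (l n) :=
  Function.argmin_le (fun n : ℤ => G.dist x (l n)) n

theorem Line.dist_of_isMin (hT : G.IsTree) {x : V} {l : Line G} {t : ℤ}
    (h : ∀ n, G.dist x (l t) ≤ G.dist x (l n)) (k : ℕ) :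
    G.dist x (l (t + k)) = G.dist x (l t) + k := by
  have := dist_add_of_nonbacktracking hT x (l.rayFrom t).adj (l.rayFrom t).ne_add_two ?_ k
  · simpa [Line.rayFrom] using this
  · have h1 := h (t + 1)
    rcases hT.dist_eq_dist_add_one_of_adj x (l.adj t) with h2 | h2
    · omega
    · simpa [Line.rayFrom] using h2

theorem Line.isMin_rev {x : V} {l : Line G} {t : ℤ}
    (h : ∀ n, G.dist x (l t) ≤ G.dist x (l n)) :
    ∀ n, G.dist x (l.rev (-t)) ≤ G.dist x (l.rev n) := fun n => by
  simpa using h (-n)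

theorem Line.isMin_unique (hT : G.IsTree) {x : V} {l : Line G} {t t' : ℤ}
    (h : ∀ n, G.dist x (l t) ≤ G.dist x (l n)) (h' : ∀ n, G.dist x (l t') ≤ G.dist x (l n)) :
    t = t' := by
  have h1 := le_antisymm (h t') (h' t)
  rcases le_total t t' with hl | hl
  · obtain ⟨k, rfl⟩ := Int.le.dest hl
    have := Line.dist_of_isMin hT h k
    have : k = 0 := by omega
    simp [this]
  · obtain ⟨k, rfl⟩ := Int.le.dest hl
    have := Line.dist_of_isMin hT h' k
    have : k = 0 := by omega
    simp [this]

theorem Line.rayTo_of_isMin (hT : G.IsTree) {x : V} {l : Line G} {t : ℤ}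
    (h : ∀ n, G.dist x (l t) ≤ G.dist x (l n)) (k : ℕ) :
    rayTo hT x l.endPlus (G.dist x (l t) + k) = l (t + k) := by
  have := rayTo_of_dist hT (x := x) (r := l.rayFrom t) (Line.dist_of_isMin hT h) k
  rwa [l.lim_rayFrom] at this

theorem Line.rayTo_of_isMin' (hT : G.IsTree) {x : V} {l : Line G} {t : ℤ}
    (h : ∀ n, G.dist x (l t) ≤ G.dist x (l n)) (k : ℕ) :
    rayTo hT x l.endMinus (G.dist x (l t) + k) = l (t - k) := by
  have := Line.rayTo_of_isMin hT (Line.isMin_rev h) k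
  rwa [Line.endPlus_rev, Line.rev_apply, Line.rev_apply, neg_neg, neg_add, neg_neg,
    ← sub_eq_add_neg] at this

/-- Both geodesics are at the point nearest to `x` at the same time, and the distance of that point
to `x` is the length of the common part of the rays to the two ends; the rays then determine all the
vertices. -/
theorem hopf_injective (hT : G.IsTree) (x : V) : Function.Injective (hopf (G := G) x) := by
  intro l l' h
  simp only [hopf, Prod.mk.injEq] at h
  obtain ⟨⟨hm, hp⟩, ht⟩ := h
  have hl := nearestTime_le x l
  have hl' := nearestTime_le x l'
  rw [← ht] at hl'
  set t := nearestTime x l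
  have key : ∀ (l l' : Line G), l.endMinus = l'.endMinus → l.endPlus = l'.endPlus →
      (∀ n, G.dist x (l t) ≤ G.dist x (l n)) → (∀ n, G.dist x (l' t) ≤ G.dist x (l' n)) →
      G.dist x (l' t) ≤ G.dist x (l t) := by
    intro l l' hm hp hl hl'
    by_contra! hlt
    -- If `l'` stayed farther from `x` than `l`, the rays from `x` to the two ends would still agree
    -- one step after leaving `l t`, where they pass through the distinct vertices at times t + 1
    -- and t - 1 of `l`.
    have h0 : rayTo hT x l'.endMinus (G.dist x (l' t)) = rayTo hT x l'.endPlus (G.dist x (l' t)) := by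
      have h1 := Line.rayTo_of_isMin hT hl' 0
      have h2 := Line.rayTo_of_isMin' hT hl' 0
      simp only [add_zero, Nat.cast_zero, sub_zero] at h1 h2
      rw [h1, h2]
    have h3 := rayTo_eq_of_le hT h0 (G.dist x (l t) + 1) hlt
    rw [← hm, ← hp, Line.rayTo_of_isMin hT hl, Line.rayTo_of_isMin' hT hl] at h3
    have := l.inj h3
    omega
  have hu := le_antisymm (key l' l hm.symm hp.symm hl' hl) (key l l' hm hp hl hl')
  ext n
  rcases le_total t n with h | h
  · obtain ⟨k, rfl⟩ := Int.le.dest h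
    rw [← Line.rayTo_of_isMin hT hl, ← Line.rayTo_of_isMin hT hl', hp, hu]
  · obtain ⟨k, hk⟩ := Int.le.dest h
    obtain rfl : n = t - k := by omega
    have h1 := Line.rayTo_of_isMin' hT hl k
    have h2 := Line.rayTo_of_isMin' hT hl' k
    rw [hm, hu, h2] at h1
    exact h1.symm

/-- The pairs of ends of geodesics through `v`. -/
def splitPairs (hT : G.IsTree) (v : V) : Set (Boundary G × Boundary G) :=
  {p | rayTo hT v p.1 1 ≠ rayTo hT v p.2 1}

theorem measurable_pairCoord [Countable V] (hT : G.IsTree) (v : V) (n : ℤ) :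
    @Measurable _ _ _ ⊤ fun p : Boundary G × Boundary G => pairCoord hT v p n := by
  let _ : MeasurableSpace V := ⊤
  refine measurable_to_countable' fun w => ?_
  obtain ⟨n, rfl | rfl⟩ := n.eq_nat_or_neg
  · exact measurable_snd (measurableSet_rayTo_eq hT v n w)
  · simp only [pairCoord_neg_natCast]
    exact measurable_fst (measurableSet_rayTo_eq hT v n w)

theorem measurableSet_splitPairs [Countable V] (hT : G.IsTree) (v : V) :
    MeasurableSet (splitPairs hT v) := by
  let _ : MeasurableSpace V := ⊤
  have h1 := measurable_pairCoord hT v 1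
  have h2 := measurable_pairCoord hT v (-1)
  exact (measurableSet_eq_fun h2 h1).compl

/-- The pair of ends of a geodesic. -/
def Line.ends (l : Line G) : Boundary G × Boundary G := (l.endMinus, l.endPlus)

/-- For geodesics through a fixed vertex the image is cut out by countably many conditions on the
ends and the time, which makes it measurable. -/
theorem hopf_image_eq (hT : G.IsTree) (x v : V) {s : Set (Line G)} (hv : ∀ l ∈ s, l 0 = v) :
    hopf x '' s = {q | q.1 ∈ Line.ends '' s ∧
      ∀ n, G.dist x (pairCoord hT v q.1 q.2) ≤ G.dist x (pairCoord hT v q.1 n)} := by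
  ext ⟨p, t⟩
  constructor
  · rintro ⟨l, hl, h⟩
    simp only [hopf, Prod.mk.injEq] at h
    obtain ⟨rfl, rfl⟩ := h
    refine ⟨⟨l, hl, rfl⟩, fun n => ?_⟩
    rw [← hv l hl, ← l.eq_pairCoord hT, ← l.eq_pairCoord hT]
    exact nearestTime_le x l n
  · rintro ⟨⟨l, hl, rfl⟩, h⟩
    refine ⟨l, hl, Prod.ext rfl (Line.isMin_unique hT (nearestTime_le x l) fun n => ?_)⟩
    have := h n
    rwa [← hv l hl, Line.ends, ← l.eq_pairCoord hT, ← l.eq_pairCoord hT] at this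

theorem ends_image_eq (hT : G.IsTree) (v : V) {S : Set (ℤ → V)} {s : Set (Line G)}
    (hs : Line.toFun ⁻¹' S = s) (hv : ∀ l ∈ s, l 0 = v) :
    Line.ends '' s = {p | p ∈ splitPairs hT v ∧ pairCoord hT v p ∈ S} := by
  ext p
  constructor
  · rintro ⟨l, hl, rfl⟩
    refine ⟨hv l hl ▸ l.ends_split hT, ?_⟩
    have : l.toFun = pairCoord hT v l.ends := funext fun n => by
      rw [← hv l hl, l.eq_pairCoord hT n]; rfl
    rw [← this]
    rw [← hs] at hl
    exact hl
  · rintro ⟨h1, h2⟩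
    exact ⟨lineOf hT v p h1, hs ▸ h2, Prod.ext (endMinus_lineOf _ _ _ _) (endPlus_lineOf _ _ _ _)⟩

theorem measurableSet_ends_image [Countable V] (hT : G.IsTree) (v : V) {s : Set (Line G)}
    (hs : MeasurableSet s) (hv : ∀ l ∈ s, l 0 = v) : MeasurableSet (Line.ends '' s) := by
  obtain ⟨S, hS, hSs⟩ := hs
  rw [ends_image_eq hT v hSs hv]
  let _ : MeasurableSpace V := ⊤
  exact (measurableSet_splitPairs hT v).inter
    ((measurable_pi_iff.2 fun n => measurable_pairCoord hT v n) hS)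

theorem measurableSet_hopf_image_of_zero [Countable V] (hT : G.IsTree) (x v : V)
    {s : Set (Line G)} (hs : MeasurableSet s) (hv : ∀ l ∈ s, l 0 = v) :
    MeasurableSet (hopf x '' s) := by
  have h1 := measurableSet_ends_image hT v hs hv
  rw [hopf_image_eq hT x v hv]
  let _ : MeasurableSpace V := ⊤
  have hd : ∀ n, Measurable fun p => G.dist x (pairCoord hT v p n) := fun n =>
    (measurable_from_top (f := G.dist x)).comp (measurable_pairCoord hT v n)
  have hd' : Measurable fun q : (Boundary G × Boundary G) × ℤ =>
      G.dist x (pairCoord hT v q.1 q.2) := measurable_from_prod_countable_left hd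
  have hm : MeasurableSet {q : (Boundary G × Boundary G) × ℤ |
      ∀ n, G.dist x (pairCoord hT v q.1 q.2) ≤ G.dist x (pairCoord hT v q.1 n)} := by
    rw [Set.ofPred_forall]
    exact MeasurableSet.iInter fun n => measurableSet_le hd' ((hd n).comp measurable_fst)
  exact (measurable_fst h1).inter hm

theorem measurable_line_apply (n : ℤ) : @Measurable (Line G) V _ ⊤ fun l => l n := by
  let _ : MeasurableSpace V := ⊤
  exact (measurable_pi_apply n).comp (comap_measurable Line.toFun)

theorem measurableSet_line_eq (n : ℤ) (v : V) : MeasurableSet {l : Line G | l n = v} := by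
  let _ : MeasurableSpace V := ⊤
  exact measurable_line_apply n (measurableSet_singleton v)

/-- `Measure.comap` takes the value zero by default unless the map is injective with null-measurable
images of measurable sets, so this is needed for the Bowen-Margulis measure to be the intended one.
-/
theorem measurableSet_hopf_image [Countable V] (hT : G.IsTree) (x : V)
    {s : Set (Line G)} (hs : MeasurableSet s) : MeasurableSet (hopf x '' s) := by
  have : s = ⋃ v, s ∩ {l | l 0 = v} := by
    rw [← Set.inter_iUnion]; ext l; simp
  rw [this, Set.image_iUnion]
  exact MeasurableSet.iUnion fun v => measurableSet_hopf_image_of_zero hT x v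
    (hs.inter (measurableSet_line_eq 0 v)) fun l hl => hl.2

variable {Γ : Subgroup (G ≃g G)} {δ : ℝ} {μ : V → Measure (Boundary G)}

/-- A geodesic through `v` at time 0 is determined by its ends, so the counting measure of each
fibre over a pair of ends is 0 or 1, and the base point can be moved to `v`. -/
theorem bowenMargulisLift_apply [Countable V] (hT : G.IsTree) (hμ : IsPattersonSullivan Γ δ μ)
    (x v : V) {s : Set (Line G)} (hs : MeasurableSet s) (hv : ∀ l ∈ s, l 0 = v) :
    bowenMargulisLift δ μ x s = ((μ v).prod (μ v)) (Line.ends '' s) := by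
  have hE := measurableSet_ends_image hT v hs hv
  have hH := measurableSet_hopf_image hT x hs
  rw [bowenMargulisLift, Measure.comap_apply _ (hopf_injective hT x)
    (fun s hs => measurableSet_hopf_image hT x hs) _ hs, Measure.prod_apply hH,
    ← pairMeasure_eq hT hμ x v hE, ← lintegral_indicator_one hE]
  · refine lintegral_congr fun p => ?_
    by_cases hp : p ∈ Line.ends '' s
    · rw [Set.indicator_of_mem hp]
      obtain ⟨l, hl, rfl⟩ := hp
      have : Prod.mk l.ends ⁻¹' (hopf x '' s) = {nearestTime x l} := by
        ext t
        constructor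
        · rintro ⟨l', hl', h⟩
          have h1 : l'.ends = l.ends := congrArg Prod.fst h
          have h2 : l' = l := by
            ext n
            have e := congrArg (fun p => pairCoord hT v p n) h1
            simp only [Line.ends] at e
            rwa [← hv l' hl', ← l'.eq_pairCoord hT, hv l' hl', ← hv l hl,
              ← l.eq_pairCoord hT] at e
          rw [← h2]
          exact (congrArg Prod.snd h).symm
        · rintro rfl
          exact ⟨l, hl, rfl⟩
      rw [this]
      simp
    · rw [Set.indicator_of_notMem hp]
      have : Prod.mk p ⁻¹' (hopf x '' s) = ∅ := by
        ext t
        simp only [Set.mem_preimage, Set.mem_empty_iff_false, iff_false]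
        rintro ⟨l', hl', h⟩
        exact hp ⟨l', hl', congrArg Prod.fst h⟩
      rw [this, measure_empty]
  · rintro _ ⟨l, hl, rfl⟩
    exact hv l hl ▸ l.ends_split hT

end TreeFlow

namespace TreeFlow

variable {V : Type*} {G : SimpleGraph V} {Γ : Subgroup (G ≃g G)}

/-! ### Cuspidal rays -/

theorem dist_smul' (hT : G.IsTree) (γ : Γ) (u v : V) : G.dist (γ • u) (γ • v) = G.dist u v :=
  dist_smul hT γ.1 u v

theorem dist_smul_left (hT : G.IsTree) (γ : Γ) (u v : V) :
    G.dist (γ • u) v = G.dist u (γ⁻¹ • v) := by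
  rw [← dist_smul' hT γ⁻¹, inv_smul_smul]

theorem adj_smul' (γ : Γ) {u v : V} (h : G.Adj u v) : G.Adj (γ • u) (γ • v) := adj_smul γ.1 h

theorem rayTo_smul' (hT : G.IsTree) (γ : Γ) (x : V) (ξ : Boundary G) (n : ℕ) :
    rayTo hT (γ • x) (γ • ξ) n = γ • rayTo hT x ξ n := rayTo_smul hT γ.1 x ξ n

theorem dart_smul_fst (γ : Γ) (d : G.Dart) : (γ • d).fst = γ • d.fst := rfl

theorem dart_smul_snd (γ : Γ) (d : G.Dart) : (γ • d).snd = γ • d.snd := rfl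

theorem dart_smul_symm (γ : Γ) (d : G.Dart) : (γ • d).symm = γ • d.symm := rfl

theorem dart_ext {d e : G.Dart} (h1 : d.fst = e.fst) (h2 : d.snd = e.snd) : d = e :=
  SimpleGraph.Dart.ext _ _ (Prod.ext h1 h2)

namespace IsCuspidalRay

variable {a : ℕ → G.Dart} (ha : IsCuspidalRay Γ a)
include ha

theorem adj (n : ℕ) : G.Adj (a n).fst (a (n + 1)).fst := ha.consecutive n ▸ (a n).adj

theorem smul_eq_of_le {γ : Γ} {m : ℕ} (h0 : γ • (a m).fst = (a m).fst)
    (h1 : γ • (a (m + 1)).fst = (a (m + 1)).fst) {n : ℕ} (hn : m ≤ n) :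
    γ • (a n).fst = (a n).fst := by
  have key : ∀ k, γ • (a (m + 1 + k)).fst = (a (m + 1 + k)).fst := by
    intro k
    induction k with
    | zero => exact h1
    | succ k ih =>
      have := congrArg (fun d : G.Dart => d.snd) (ha.surjective (m + k) γ (by
        rw [show m + k + 1 = m + 1 + k by ring]; exact ih))
      simp only [dart_smul_snd] at this
      rw [ha.consecutive, show m + k + 1 + 1 = m + 1 + (k + 1) by ring] at this
      exact this
  rcases hn.eq_or_lt with rfl | h
  · exact h0
  · obtain ⟨k, rfl⟩ := Nat.exists_eq_add_of_le (Nat.succ_le_of_lt h)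
    exact key k

theorem smul_succ {γ : Γ} {m : ℕ} (h : γ • (a (m + 1)).fst = (a (m + 1)).fst) :
    γ • (a (m + 2)).fst = (a (m + 2)).fst := by
  have := congrArg (fun d : G.Dart => d.snd) (ha.surjective m γ h)
  simp only [dart_smul_snd] at this
  rwa [ha.consecutive] at this

/-- Only one edge goes up, since the stabiliser of the vertex fixes it; the edges going down form
one orbit of this stabiliser. -/
theorem neighbor {n : ℕ} {p : V} (hp : G.Adj (a (n + 1)).fst p) :
    p = (a (n + 2)).fst ∨
      ∃ γ : Γ, γ • (a (n + 1)).fst = (a (n + 1)).fst ∧ p = γ • (a n).fst := by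
  rcases ha.attached n ⟨((a (n + 1)).fst, p), hp⟩ rfl with ⟨γ, h⟩ | ⟨γ, h⟩
  · left
    have h1 : γ • (a (n + 1)).fst = (a (n + 1)).fst := congrArg (fun d : G.Dart => d.fst) h
    rw [ha.surjective n γ h1] at h
    have h2 : (a (n + 1)).snd = p := congrArg (fun d : G.Dart => d.snd) h
    rw [← h2, ha.consecutive]
  · right
    have h1 : γ • (a n).snd = (a (n + 1)).fst := congrArg (fun d : G.Dart => d.fst) h
    have h2 : γ • (a n).fst = p := congrArg (fun d : G.Dart => d.snd) h
    exact ⟨γ, by rw [← ha.consecutive n] at h1 ⊢; exact h1, h2.symm⟩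

/-- The vertices of a lift of a cuspidal ray, as a geodesic ray. -/
def toRay : Ray G :=
  ⟨fun n => (a n).fst, ha.adj, fun m n h => ha.injective m n 1 (by rw [one_smul]; exact h)⟩

theorem dist_fst (hT : G.IsTree) (m k : ℕ) : G.dist (a m).fst (a (m + k)).fst = k :=
  ha.toRay.dist_add hT m k

/-- A geodesic from `b` to the `m`-th vertex of the ray which does not come from above has gone down
the horoball. -/
theorem descend_dist (hT : G.IsTree) (m : ℕ) : ∀ b : V, (∀ n, ∀ γ : Γ, γ • (a (n + 1)).fst ≠ b) →
    G.dist b (a (m + 1)).fst = G.dist b (a m).fst + 1 →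
    ∃ h : Γ, h • (a m).fst = (a m).fst ∧ h • (a (m + 1)).fst = (a (m + 1)).fst ∧
      G.dist b (a m).fst = G.dist b (h • (a 0).fst) + m ∧
      G.dist b (h • (a 1).fst) = G.dist b (h • (a 0).fst) + 1 := by
  induction m with
  | zero =>
    intro b _ hd
    exact ⟨1, one_smul _ _, one_smul _ _, by rw [one_smul, add_zero], by rwa [one_smul, one_smul]⟩
  | succ m ih =>
    intro b hb hd
    have hne : (a (m + 1)).fst ≠ b := fun h => hb m 1 (by rw [one_smul, h])
    obtain ⟨p, hp, hdp⟩ := exists_parent hT hne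
    -- The parent cannot be the next vertex of the ray, which is farther from `b`. So it is a
    -- translate by some `g` fixing the current vertex, and the induction hypothesis applies to `g⁻¹
    -- • b`.
    rcases ha.neighbor hp.symm with rfl | ⟨g, hg, rfl⟩
    · rw [show m + 1 + 1 = m + 2 from rfl] at hd
      omega
    · have e : ∀ v, G.dist (g⁻¹ • b) v = G.dist b (g • v) := fun v => by
        rw [dist_smul_left hT, inv_inv]
      obtain ⟨h, h1, h2, h3, h4⟩ := ih (g⁻¹ • b)
        (fun n γ hγ => hb n (g * γ) (by rw [mul_smul, hγ, smul_inv_smul])) (by rw [e, e, hg, hdp])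
      have h5 := ha.smul_eq_of_le h1 h2 (show m ≤ m + 1 + 1 by omega)
      refine ⟨g * h, by rw [mul_smul, h2, hg], ?_, ?_, ?_⟩
      · rw [mul_smul, h5, ha.smul_succ hg]
      · rw [hdp, ← e, h3, e, mul_smul]; ring
      · rw [mul_smul, mul_smul, ← e, ← e, h4]

/-- The passage of the geodesic from a vertex of a horoball to a vertex outside. -/
theorem exists_entry (hT : G.IsTree) {b : V} (hb : ∀ n, ∀ γ : Γ, γ • (a (n + 1)).fst ≠ b) (γ : Γ)
    (k : ℕ) : ∃ (j : ℕ) (γ' : Γ), γ' • (a (k + j)).fst = γ • (a (k + j)).fst ∧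
      G.dist b (γ • (a k).fst) = G.dist b (γ' • (a 0).fst) + 2 * j + k ∧
      G.dist b (γ' • (a 1).fst) = G.dist b (γ' • (a 0).fst) + 1 := by
  -- Seen from level k, the geodesic towards `b` climbs `j` levels and then descends k + j; this is
  -- the origin of the term 2j + k.
  obtain ⟨j, h1, h2⟩ := exists_increasing hT b (w := fun n => γ • (a (k + n)).fst)
    (fun n => adj_smul' γ (ha.adj (k + n)))
  have e : ∀ v, G.dist (γ⁻¹ • b) v = G.dist b (γ • v) := fun v => by
    rw [dist_smul_left hT, inv_inv]
  obtain ⟨h, h3, h4, h5, h6⟩ := ha.descend_dist hT (k + j) (γ⁻¹ • b)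
    (fun n g hg => hb n (γ * g) (by rw [mul_smul, hg, smul_inv_smul])) (by rw [e, e]; exact h1)
  refine ⟨j, γ * h, by rw [mul_smul, h3], ?_, ?_⟩
  · simp only [add_zero] at h2
    rw [h2, ← e, h5, e, mul_smul]; ring
  · rw [mul_smul, mul_smul, ← e, ← e, h6]

/-- A ray from the `m`-th vertex that does not go up goes down the horoball. -/
theorem descend_ray (hT : G.IsTree) (m : ℕ) : ∀ ξ : Boundary G,
    rayTo hT (a m).fst ξ 1 ≠ (a (m + 1)).fst →
    ∃ h : Γ, h • (a m).fst = (a m).fst ∧ h • (a (m + 1)).fst = (a (m + 1)).fst ∧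
      ∀ k ≤ m, rayTo hT (a m).fst ξ k = h • (a (m - k)).fst := by
  induction m with
  | zero =>
    intro ξ _
    refine ⟨1, one_smul _ _, one_smul _ _, fun k hk => ?_⟩
    obtain rfl := Nat.le_zero.1 hk
    rw [rayTo_zero, one_smul]
  | succ m ih =>
    intro ξ hξ
    have hadj := (rayTo hT (a (m + 1)).fst ξ).adj 0
    rw [rayTo_zero] at hadj
    rcases ha.neighbor hadj with h | ⟨g, hg, h⟩
    · exact absurd h hξ
    · have hs : ∀ (v : V) (n : ℕ), rayTo hT (g • v) ξ n = g • rayTo hT v (g⁻¹ • ξ) n := fun v n => by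
        rw [← rayTo_smul', smul_inv_smul]
      rw [zero_add] at h
      obtain ⟨h', h1, h2, h3⟩ := ih (g⁻¹ • ξ) (rayTo_one_ne hT (by
        have := hs (a (m + 1)).fst 1
        rw [hg, h] at this
        exact (smul_left_cancel g this).symm))
      have h5 := ha.smul_eq_of_le h1 h2 (show m ≤ m + 1 + 1 by omega)
      refine ⟨g * h', by rw [mul_smul, h2, hg], by rw [mul_smul, h5, ha.smul_succ hg], ?_⟩
      intro k hk
      cases k with
      | zero => rw [rayTo_zero, Nat.sub_zero, mul_smul, h2, hg]
      | succ k =>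
        rw [add_comm k 1, rayTo_add, h, hs, h3 k (by omega), mul_smul,
          show m + 1 - (1 + k) = m - k by omega]

end IsCuspidalRay

/-! ### Core vertices -/

namespace CuspidalDecomposition

variable (D : CuspidalDecomposition Γ)

theorem core_or_cusp (v : V) :
    v ∈ D.coreVertices ∨ ∃ i n, ∃ γ : Γ, γ • (D.ray i (n + 1)).fst = v := by
  by_cases h : v ∈ D.coreVertices
  · exact Or.inl h
  · right
    simpa [coreVertices] using h

theorem smul_mem_core {v : V} (hv : v ∈ D.coreVertices) (γ : Γ) : γ • v ∈ D.coreVertices :=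
  fun i n g hg => hv i n (γ⁻¹ * g) (by rw [mul_smul, hg, inv_smul_smul])

/-- Otherwise the first edge of the `i`-th ray would start at an inner vertex of a ray; within the
same ray this contradicts injectivity of the levels, and for another ray all the edges at that
vertex belong to it, contradicting disjointness. -/
theorem base_mem_core (i : Fin D.r) : (D.ray i 0).fst ∈ D.coreVertices := by
  intro j n γ h
  by_cases hij : j = i
  · subst hij
    have := (D.cuspidal j).injective _ _ γ h
    omega
  · rcases (D.cuspidal j).attached n (γ⁻¹ • D.ray i 0)
      (by rw [dart_smul_fst, ← h, inv_smul_smul]) with ⟨g, hg⟩ | ⟨g, hg⟩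
    · exact (D.disjoint j i hij (n + 1) 0).1 ⟨γ * g, by rw [mul_smul, hg, smul_inv_smul]⟩
    · refine (D.disjoint j i hij n 0).2 ⟨γ * g, ?_⟩
      rw [mul_smul]
      have : g • D.ray j n = (γ⁻¹ • D.ray i 0).symm := by rw [← hg]; rfl
      rw [this, dart_smul_symm, smul_inv_smul]

theorem exists_core [Nonempty V] : D.coreVertices.Nonempty := by
  obtain ⟨v⟩ := ‹Nonempty V›
  rcases D.core_or_cusp v with h | ⟨i, _⟩
  · exact ⟨v, h⟩
  · exact ⟨_, D.base_mem_core i⟩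

theorem fst_mem_core {d : G.Dart} (hd : d ∈ D.coreEdges) : d.fst ∈ D.coreVertices := by
  intro i n γ h
  rcases (D.cuspidal i).attached n (γ⁻¹ • d)
      (by rw [dart_smul_fst, ← h, inv_smul_smul]) with ⟨g, hg⟩ | ⟨g, hg⟩
  · exact (hd i (n + 1)).1 ⟨γ * g, by rw [mul_smul, hg, smul_inv_smul]⟩
  · exact (hd i n).2 ⟨γ * g, by rw [mul_smul, hg, smul_inv_smul]⟩

theorem exists_reps : ∃ Y : Set V, Y.Finite ∧ Y ⊆ D.coreVertices ∧
    ∀ v ∈ D.coreVertices, ∃ γ : Γ, ∃ y ∈ Y, γ • y = v := by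
  obtain ⟨Y, hY, hfin, himg⟩ := Set.exists_subset_bijOn D.coreVertices
    (Quotient.mk _ : V → MulAction.orbitRel.Quotient Γ V) |>.imp fun Y h =>
      (⟨h.1, (Set.Finite.of_injOn h.2.mapsTo h.2.injOn D.finite_core), h.2.surjOn⟩ :
        Y ⊆ D.coreVertices ∧ Y.Finite ∧ _)
  refine ⟨Y, hfin, hY, fun v hv => ?_⟩
  obtain ⟨y, hy, h⟩ := himg (Set.mem_image_of_mem _ hv)
  obtain ⟨γ, hγ⟩ := MulAction.orbitRel_apply.1 (Quotient.exact h)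
  exact ⟨γ⁻¹, y, hy, by rw [← hγ]; exact inv_smul_smul _ _⟩

variable (htriv : ∀ v ∈ D.coreVertices, ∀ γ : Γ, γ • v = v → γ = 1)
include htriv

theorem smul_injective_of_core {b : V} (hb : b ∈ D.coreVertices) :
    Function.Injective fun γ : Γ => γ • b := fun γ γ' h => by
  have := htriv b hb (γ'⁻¹ * γ) (by rw [mul_smul]; exact (inv_smul_eq_iff.2 h))
  exact (inv_mul_eq_one.1 this).symm

theorem countable_group [Countable V] [Nonempty V] : Countable Γ := by
  obtain ⟨b, hb⟩ := D.exists_core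
  exact (D.smul_injective_of_core htriv hb).countable

/-- The stabiliser acts freely on the orbit of a core vertex, and this orbit stays in a finite ball
around `v`. -/
theorem stabilizer_finite (hT : G.IsTree) (hball : ∀ (v : V) (n : ℕ), {w | G.dist v w ≤ n}.Finite)
    (v : V) : Finite (MulAction.stabilizer Γ v) := by
  have := hT.connected.nonempty
  obtain ⟨b, hb⟩ := D.exists_core
  have := (hball v (G.dist v b)).to_subtype
  refine Finite.of_injective (β := {w | G.dist v w ≤ G.dist v b}) (fun γ => ⟨γ.1 • b, ?_⟩)
    fun γ γ' h => Subtype.ext (D.smul_injective_of_core htriv hb (congrArg Subtype.val h))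
  have h1 : γ.1 • v = v := γ.2
  have h2 : G.dist (γ.1 • v) (γ.1 • b) = G.dist v b := dist_smul' hT _ _ _
  rw [h1] at h2
  exact h2.le

end CuspidalDecomposition

/-! ### Consequences of minimality -/

/-- The vertices with two neighbours form an invariant subtree. If there were none, the tree would
have at most two vertices, and the group would preserve a vertex or a pair of vertices. -/
theorem exists_two_neighbors (hT : G.IsTree) (hne : NonElementary Γ) (hmin : IsMinimal Γ) (v : V) :
    ∃ p q, p ≠ q ∧ G.Adj v p ∧ G.Adj v q := by
  set S : Set V := {v | ∃ p q, p ≠ q ∧ G.Adj v p ∧ G.Adj v q}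
  suffices S = Set.univ by
    have : v ∈ S := this ▸ Set.mem_univ v
    exact this
  rcases S.eq_empty_or_nonempty with hS | ⟨b, hb⟩
  · exfalso
    have huniq : ∀ v p q, G.Adj v p → G.Adj v q → p = q := by
      intro v p q hp hq
      by_contra h
      have : v ∈ S := ⟨p, q, h, hp, hq⟩
      rw [hS] at this
      exact this
    have hnb : ∀ u w, u ≠ v → w ≠ v → u = w := by
      have : ∀ u, u ≠ v → G.Adj u v := by
        intro u hu
        obtain ⟨p, hp, hd⟩ := exists_parent hT hu
        by_cases hpv : p = v
        · rw [← hpv]; exact hp.symm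
        · obtain ⟨p', hp', hd'⟩ := exists_parent hT hpv
          have := huniq p u p' hp hp'.symm
          subst this
          omega
      exact fun u w hu hw => huniq v u w (this u hu).symm (this w hw).symm
    by_cases hex : ∃ u, u ≠ v
    · obtain ⟨u, hu⟩ := hex
      have hall : ∀ w, w = v ∨ w = u := fun w => or_iff_not_imp_left.2 fun h => hnb w u h hu
      refine hne.1 v u fun γ => ?_
      have h1 : γ • u ≠ γ • v := fun h => hu (smul_left_cancel γ h)
      rcases hall (γ • v) with h2 | h2 <;> rcases hall (γ • u) with h3 | h3
      · exact absurd (h3.trans h2.symm) h1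
      · rw [h2, h3]
      · rw [h2, h3, Set.pair_comm]
      · exact absurd (h3.trans h2.symm) h1
    · push Not at hex
      exact hne.1 v v fun γ => by rw [hex (γ • v)]
  · refine hmin S ⟨b, hb⟩ ?_ (induce_connected S hb fun w hw hwb => ?_)
    · rintro γ w ⟨p, q, h, hp, hq⟩
      exact ⟨γ • p, γ • q, fun e => h (smul_left_cancel γ e), adj_smul' γ hp, adj_smul' γ hq⟩
    · obtain ⟨p, hp, hd⟩ := exists_parent hT hwb
      refine ⟨p, ?_, hp, hd⟩
      by_cases hpb : p = b
      · exact hpb ▸ hb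
      · obtain ⟨p', hp', hd'⟩ := exists_parent hT hpb
        exact ⟨w, p', fun e => by rw [e] at hd; omega, hp, hp'.symm⟩

/-- The shadow of an edge is not empty. -/
theorem shadow_nonempty (hT : G.IsTree) (hne : NonElementary Γ) (hmin : IsMinimal Γ) (d : G.Dart) :
    (shadow d).Nonempty := by
  have hstep : ∀ e : G.Dart, ∃ e' : G.Dart, e'.fst = e.snd ∧ e'.snd ≠ e.fst := by
    intro e
    obtain ⟨p, q, hpq, hp, hq⟩ := exists_two_neighbors hT hne hmin e.snd
    by_cases h : p = e.fst
    · exact ⟨⟨(e.snd, q), hq⟩, rfl, fun h' => hpq (h.trans h'.symm)⟩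
    · exact ⟨⟨(e.snd, p), hp⟩, rfl, h⟩
  choose f hf hf' using hstep
  let e : ℕ → G.Dart := fun n => f^[n] d
  have he : ∀ n, e (n + 1) = f (e n) := fun n => Function.iterate_succ_apply' f n d
  have h1 : ∀ n, (e (n + 1)).fst = (e n).snd := fun n => by rw [he, hf]
  refine ⟨(Ray.ofNonbacktracking hT (fun n => (e n).fst) (fun n => ?_) (fun n => ?_)).lim,
    _, rfl, h1 0, rfl⟩
  · rw [h1]; exact (e n).adj
  · rw [h1, he]; exact hf' _

/-- The stabilisers of the vertices along a cuspidal ray are not eventually constant. -/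
theorem exists_stabilizer_growth (hT : G.IsTree) (hmin : IsMinimal Γ) {a : ℕ → G.Dart}
    (ha : IsCuspidalRay Γ a) (N : ℕ) :
    ∃ n, N ≤ n ∧ ∃ γ : Γ, γ • (a (n + 1)).fst = (a (n + 1)).fst ∧ γ • (a n).fst ≠ (a n).fst := by
  by_contra! hcon
  have hnbr : ∀ n ≥ N, ∀ p, G.Adj (a (n + 1)).fst p → p = (a (n + 2)).fst ∨ p = (a n).fst := by
    intro n hn p hp
    rcases ha.neighbor hp with h | ⟨g, hg, h⟩
    · exact Or.inl h
    · exact Or.inr (h.trans (hcon n hn g hg))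
  -- If stabilisers stop growing, the translates of the tail of the ray have no branching, and
  -- removing them leaves a proper invariant subtree.
  set S : Set V := {v | ∀ n ≥ N, ∀ γ : Γ, γ • (a (n + 1)).fst ≠ v}
  have hb : ∀ n, ∀ γ : Γ, γ • (a (n + 1)).fst ≠ (a 0).fst := fun n γ h => by
    have := ha.injective _ _ γ h
    omega
  have hS : S = Set.univ := by
    refine hmin S ⟨_, fun n _ γ => hb n γ⟩ ?_
      (induce_connected S (b := (a 0).fst) (fun n _ γ => hb n γ) fun v hv hvb => ?_)
    · intro g v hv n hn γ h
      exact hv n hn (g⁻¹ * γ) (by rw [mul_smul, h, inv_smul_smul])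
    · obtain ⟨p, hp, hd⟩ := exists_parent hT hvb
      refine ⟨p, fun n hn γ h => ?_, hp, hd⟩
      subst h
      have hv' : v = γ • (a n).fst := by
        have h1 := adj_smul' γ⁻¹ hp
        rw [inv_smul_smul] at h1
        rcases hnbr n hn _ h1 with h2 | h2
        · exact absurd (by rw [← h2, smul_inv_smul]) (hv (n + 1) (by omega) γ)
        · rw [← h2, smul_inv_smul]
      subst hv'
      -- A vertex of `S` whose parent was removed would have a geodesic to the origin that climbs
      -- the translated ray forever.
      have hdec : ∀ k, G.dist (a 0).fst (γ • (a (n + k)).fst) =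
          G.dist (a 0).fst (γ • (a (n + k + 1)).fst) + 1 := by
        intro k
        induction k with
        | zero => exact hd
        | succ k ih =>
          obtain ⟨q, hq, hdq⟩ := exists_parent hT (hb (n + k) γ)
          have h1 := adj_smul' γ⁻¹ hq.symm
          rw [inv_smul_smul] at h1
          rcases hnbr (n + k) (by omega) _ h1 with h2 | h2
          · rw [inv_smul_eq_iff] at h2
            rw [h2] at hdq
            exact hdq
          · rw [inv_smul_eq_iff] at h2
            rw [h2] at hdq
            omega
      obtain ⟨k, hk, _⟩ := exists_increasing hT (a 0).fst (w := fun k => γ • (a (n + k)).fst)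
        fun k => adj_smul' γ (ha.adj (n + k))
      have := hdec k
      rw [show n + (k + 1) = n + k + 1 from rfl] at hk
      omega
  have : (a (N + 1)).fst ∈ S := hS ▸ Set.mem_univ _
  exact this N le_rfl 1 (one_smul _ _)

end TreeFlow

namespace TreeFlow

variable {V : Type*} {G : SimpleGraph V} {Γ : Subgroup (G ≃g G)}

/-! ### The quotient of the space of geodesics -/

theorem Line.smul_apply (γ : Γ) (l : Line G) (n : ℤ) : (γ • l) n = γ • l n := rfl

theorem Line.edge_smul (γ : Γ) (l : Line G) (n : ℤ) : (γ • l).edge n = γ • l.edge n := rfl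

theorem proj_eq_iff {l l' : Line G} : proj Γ l = proj Γ l' ↔ ∃ γ : Γ, γ • l = l' := by
  refine Quotient.eq.trans (MulAction.orbitRel_apply.trans ⟨?_, ?_⟩)
  · rintro ⟨γ, rfl⟩
    exact ⟨γ⁻¹, inv_smul_smul _ _⟩
  · rintro ⟨γ, rfl⟩
    exact ⟨γ⁻¹, inv_smul_smul _ _⟩

theorem measurable_proj : Measurable (proj Γ) := measurable_quotient_mk''

theorem measurable_smul_line (γ : Γ) : Measurable fun l : Line G => γ • l := by
  let _ : MeasurableSpace V := ⊤
  refine measurable_comap_iff.2 (measurable_pi_iff.2 fun n => ?_)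
  exact (measurable_from_top (f := fun v : V => γ • v)).comp (measurable_line_apply n)

theorem preimage_proj_image (C : Set (Line G)) :
    proj Γ ⁻¹' (proj Γ '' C) = ⋃ γ : Γ, (fun l => γ • l) ⁻¹' C := by
  ext l
  simp only [Set.mem_preimage, Set.mem_image, Set.mem_iUnion]
  constructor
  · rintro ⟨l', hl', h⟩
    obtain ⟨γ, hγ⟩ := proj_eq_iff.1 h.symm
    exact ⟨γ, hγ ▸ hl'⟩
  · rintro ⟨γ, h⟩
    exact ⟨γ • l, h, (proj_eq_iff.2 ⟨γ, rfl⟩).symm⟩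

theorem measurableSet_proj_image [Countable Γ] {C : Set (Line G)} (hC : MeasurableSet C) :
    MeasurableSet (proj Γ '' C) := by
  refine measurableSet_quotient.2 ?_
  change MeasurableSet (proj Γ ⁻¹' (proj Γ '' C))
  rw [preimage_proj_image]
  exact MeasurableSet.iUnion fun γ => measurable_smul_line γ hC

variable {δ : ℝ} {μ : V → Measure (Boundary G)}

theorem bowenMargulis_apply (x : V) {B : Set (QuotientLines Γ)} (hB : MeasurableSet B) :
    bowenMargulis Γ δ μ x B = ∑' o : MulAction.orbitRel.Quotient Γ V,
      ((Nat.card (MulAction.stabilizer Γ (Quotient.out o : V)) : ℝ≥0∞)⁻¹) *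
        bowenMargulisLift δ μ x (proj Γ ⁻¹' B ∩ {l | l 0 = (Quotient.out o : V)}) := by
  rw [bowenMargulis, quotientMeasure, Measure.sum_apply _ hB]
  refine tsum_congr fun o => ?_
  rw [Measure.smul_apply, Measure.map_apply measurable_proj hB,
    Measure.restrict_apply (measurable_proj hB), smul_eq_mul]

/-- An upper bound for the measure of the image in `Γ\𝒢T` of a set of geodesics through `v`. -/
theorem bowenMargulis_proj_image_le [Countable V] [Countable Γ] (hT : G.IsTree)
    (hμ : IsPattersonSullivan Γ δ μ) (hfin : ∀ v : V, Finite (MulAction.stabilizer Γ v)) (x v : V)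
    {C : Set (Line G)} (hC : MeasurableSet C) {A B : Set (Boundary G)} (hA : MeasurableSet A)
    (hB : MeasurableSet B)
    (h : ∀ l ∈ C, l 0 = v ∧ l.endMinus ∈ A ∧ l.endPlus ∈ B) :
    bowenMargulis Γ δ μ x (proj Γ '' C) ≤ μ v A * μ v B := by
  rw [bowenMargulis_apply x (measurableSet_proj_image hC), preimage_proj_image]
  set o : MulAction.orbitRel.Quotient Γ V := Quotient.mk _ v
  rw [tsum_eq_single o]
  · set w : V := Quotient.out o
    set T := {γ : Γ | γ • w = v}
    -- Among the translates of `C`, only those by elements carrying the representative `w` to `v`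
    -- contain geodesics through `w`.
    have hsub : (⋃ γ : Γ, (fun l : Line G => γ • l) ⁻¹' C) ∩ {l | l 0 = w} ⊆
        ⋃ γ : T, ((fun l : Line G => γ.1 • l) ⁻¹' C) := by
      rintro l ⟨hl, hw⟩
      obtain ⟨γ, hγ⟩ := Set.mem_iUnion.1 hl
      refine Set.mem_iUnion.2 ⟨⟨γ, ?_⟩, hγ⟩
      have hw' : l 0 = w := hw
      change γ • w = v
      rw [← hw']
      exact (h _ hγ).1
    have hterm : ∀ γ : T, bowenMargulisLift δ μ x ((fun l : Line G => γ.1 • l) ⁻¹' C) ≤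
        μ v A * μ v B := by
      rintro ⟨γ, hγ⟩
      have hγ' : γ⁻¹ • v = w := inv_smul_eq_iff.2 (Eq.symm hγ)
      have hm : ∀ {E : Set (Boundary G)}, MeasurableSet E →
          μ w ((fun ξ => γ • ξ) ⁻¹' E) = μ v E := fun {E} hE => by
        rw [← measure_smul hT hμ γ w hE]
        exact congrArg (fun u => μ u E) hγ
      rw [bowenMargulisLift_apply hT hμ x w (measurable_smul_line γ hC) fun l hl => by
        have := (h _ hl).1
        rw [Line.smul_apply] at this
        rw [← hγ', ← this, inv_smul_smul], ← hm hA, ← hm hB]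
      have := hμ.finite w
      rw [← Measure.prod_prod]
      refine measure_mono ?_
      rintro _ ⟨l, hl, rfl⟩
      exact (h _ hl).2
    -- These elements form a coset of the stabiliser of `w`, whose order cancels the weight in the
    -- quotient measure.
    have hcard : ENat.card T = Nat.card (MulAction.stabilizer Γ w) := by
      have := hfin w
      obtain ⟨γ₀, hγ₀⟩ : ∃ γ₀ : Γ, γ₀ • w = v := by
        have : (Quotient.mk _ w : MulAction.orbitRel.Quotient Γ V) = Quotient.mk _ v :=
          Quotient.out_eq o
        obtain ⟨g, hg⟩ := MulAction.orbitRel_apply.1 (Quotient.exact this)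
        exact ⟨g⁻¹, by rw [← hg]; exact inv_smul_smul _ _⟩
      let e : T ≃ MulAction.stabilizer Γ w :=
        { toFun := fun γ => ⟨γ₀⁻¹ * γ.1, by
            rw [MulAction.mem_stabilizer_iff, mul_smul, show γ.1 • w = v from γ.2, ← hγ₀,
              inv_smul_smul]⟩
          invFun := fun γ => ⟨γ₀ * γ.1, by
            change (γ₀ * γ.1) • w = v
            rw [mul_smul, show γ.1 • w = w from γ.2, hγ₀]⟩
          left_inv := fun γ => by simp
          right_inv := fun γ => by simp }
      rw [ENat.card_congr e, ENat.card_eq_coe_natCard]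
    have := hfin w
    have hpos : (Nat.card (MulAction.stabilizer Γ w) : ℝ≥0∞) ≠ 0 := by
      exact_mod_cast (Nat.card_pos (α := MulAction.stabilizer Γ w)).ne'
    have : Countable T := inferInstance
    calc _ ≤ (Nat.card (MulAction.stabilizer Γ w) : ℝ≥0∞)⁻¹ * ∑' _ : T, μ v A * μ v B := by
          gcongr
          exact (measure_mono hsub).trans ((measure_iUnion_le _).trans
            (ENNReal.tsum_le_tsum hterm))
      _ = μ v A * μ v B := by
          rw [ENNReal.tsum_const, hcard, ← mul_assoc]
          simp only [ENat.toENNReal_coe]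
          rw [ENNReal.inv_mul_cancel hpos (ENNReal.natCast_ne_top _), one_mul]
  · intro o' ho'
    have : (⋃ γ : Γ, (fun l : Line G => γ • l) ⁻¹' C) ∩ {l | l 0 = (Quotient.out o' : V)} = ∅ := by
      refine Set.eq_empty_of_forall_notMem ?_
      rintro l ⟨hl, hw⟩
      obtain ⟨γ, hγ⟩ := Set.mem_iUnion.1 hl
      refine ho' ?_
      rw [← Quotient.out_eq o']
      have hw' : l 0 = Quotient.out o' := hw
      rw [← hw']
      refine Quotient.sound (MulAction.orbitRel_apply.2 ⟨γ⁻¹, ?_⟩)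
      have := (h _ hγ).1
      rw [← this]
      exact inv_smul_smul _ _
    rw [this, measure_empty, mul_zero]

/-- Two neighbours of a vertex `w` give two disjoint shadows of positive mass, and any pair of ends
in their product is joined by a geodesic through `w`. -/
theorem bowenMargulis_univ_pos [Countable V] (hT : G.IsTree) (hμ : IsPattersonSullivan Γ δ μ)
    (hne : NonElementary Γ) (hmin : IsMinimal Γ) (x : V) :
    0 < bowenMargulis Γ δ μ x Set.univ := by
  rw [bowenMargulis_apply x MeasurableSet.univ]
  set o : MulAction.orbitRel.Quotient Γ V := Quotient.mk _ x
  refine lt_of_lt_of_le ?_ (ENNReal.le_tsum o)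
  set w : V := Quotient.out o
  refine ENNReal.mul_pos (ENNReal.inv_ne_zero.2 (ENNReal.natCast_ne_top _)) (ne_of_gt ?_)
  rw [Set.preimage_univ, Set.univ_inter,
    bowenMargulisLift_apply hT hμ x w (measurableSet_line_eq 0 w) fun l hl => hl]
  obtain ⟨p, q, hpq, hp, hq⟩ := exists_two_neighbors hT hne hmin w
  have := hμ.finite w
  have hpos : ∀ p (hp : G.Adj w p), μ w (shadow ⟨(w, p), hp⟩) ≠ 0 := fun p hp =>
    (hμ.support w _ (isOpen_shadow _) (shadow_nonempty hT hne hmin _)).ne'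
  refine lt_of_lt_of_le (ENNReal.mul_pos (hpos p hp) (hpos q hq)) ?_
  rw [← Measure.prod_prod]
  refine measure_mono ?_
  rintro ⟨ξ, η⟩ ⟨hξ, hη⟩
  have h : rayTo hT w ξ 1 ≠ rayTo hT w η 1 := by
    rw [mem_shadow hT] at hξ hη
    exact fun h => hpq (hξ.symm.trans (h.trans hη))
  exact ⟨lineOf hT w (ξ, η) h, lineOf_zero hT w _ h,
    Prod.ext (endMinus_lineOf _ _ _ _) (endPlus_lineOf _ _ _ _)⟩

end TreeFlow

namespace TreeFlow

variable {V : Type*} {G : SimpleGraph V} {Γ : Subgroup (G ≃g G)}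

/-! ### The coding partition -/

namespace CuspidalDecomposition

variable (D : CuspidalDecomposition Γ)

theorem ray_smul_eq {i j : Fin D.r} {m n : ℕ} {γ : Γ} (h : γ • D.ray i m = D.ray j n) :
    i = j ∧ m = n := by
  have hij : i = j := by
    by_contra hij
    exact (D.disjoint i j hij m n).1 ⟨γ, h⟩
  subst hij
  exact ⟨rfl, (D.cuspidal i).injective m n γ (congrArg (fun d : G.Dart => d.fst) h)⟩

theorem ray_smul_ne_symm {i j : Fin D.r} {m n : ℕ} {γ : Γ} :
    γ • D.ray i m ≠ (D.ray j n).symm := by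
  intro h
  by_cases hij : i = j
  · subst hij
    have h1 : γ • (D.ray i m).fst = (D.ray i n).snd := congrArg (fun d : G.Dart => d.fst) h
    have h2 : γ • (D.ray i m).snd = (D.ray i n).fst := congrArg (fun d : G.Dart => d.snd) h
    rw [(D.cuspidal i).consecutive] at h1 h2
    have := (D.cuspidal i).injective _ _ γ h1
    have := (D.cuspidal i).injective _ _ γ h2
    omega
  · exact (D.disjoint i j hij m n).2 ⟨γ, h⟩

end CuspidalDecomposition

/-- The geodesic `l` with the opposite direction and origin `l 1`. -/
def Line.flip (l : Line G) : Line G :=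
  ⟨fun n => l (1 - n), fun n => by
    have h := (l.adj (1 - (n + 1))).symm
    rwa [show 1 - (n + 1) + 1 = 1 - n by ring] at h,
    fun a b h => by simpa using l.inj h⟩

theorem Line.flip_edge (l : Line G) (n : ℤ) : l.flip.edge n = (l.edge (-n)).symm := by
  refine dart_ext (congrArg l.toFun ?_) (congrArg l.toFun ?_) <;> ring

theorem Line.flip_smul (γ : Γ) (l : Line G) : (γ • l).flip = γ • l.flip := rfl

/-- A geodesic through an edge of a cuspidal ray, in the direction of its end, comes from the origin
of the ray, up to the action of the group. -/
theorem exists_smul_edge_eq (hT : G.IsTree) {a : ℕ → G.Dart} (ha : IsCuspidalRay Γ a) {n : ℕ}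
    {l : Line G} (hl : l.edge 0 = a n) :
    ∃ h : Γ, (h • l).edge 0 = a n ∧ (h • l).edge (-n) = a 0 := by
  have h0 : l 0 = (a n).fst := congrArg (fun d : G.Dart => d.fst) hl
  have h1 : l 1 = (a (n + 1)).fst := by
    rw [← ha.consecutive]; exact congrArg (fun d : G.Dart => d.snd) hl
  have hr : ∀ k : ℕ, rayTo hT (a n).fst l.endMinus k = l (-k) := fun k => by
    rw [← h0, l.rayTo_endMinus, zero_sub]
  -- Followed backwards, the geodesic cannot return to time 1, so its past descends the horoball
  -- along a translate of the ray.
  obtain ⟨h, hn, hn', hk⟩ := ha.descend_ray hT n l.endMinus (by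
    rw [hr, ← h1]
    intro h
    have := l.inj h
    omega)
  have hall : ∀ k : ℕ, k ≤ n + 1 → l (1 - k) = h • (a (n + 1 - k)).fst := by
    intro k hk'
    cases k with
    | zero => rw [Nat.sub_zero, hn', ← h1]; simp
    | succ k =>
      have := hk k (by omega)
      rw [hr] at this
      rw [show (1 : ℤ) - (k + 1 : ℕ) = -k by push_cast; ring, this, Nat.add_sub_add_right]
  have hedge : ∀ k : ℕ, k ≤ n → (h⁻¹ • l).edge (-k) = a (n - k) := by
    intro k hk'
    have e1 := hall (k + 1) (by omega)
    have e2 := hall k (by omega)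
    refine dart_ext ?_ ?_
    · change h⁻¹ • l (-k) = _
      rw [show -(k : ℤ) = 1 - (k + 1 : ℕ) by push_cast; ring, e1, inv_smul_smul, Nat.add_sub_add_right]
    · change h⁻¹ • l (-k + 1) = _
      rw [show -(k : ℤ) + 1 = 1 - k by ring, e2, inv_smul_smul, ha.consecutive,
        show n + 1 - k = n - k + 1 by omega]
  exact ⟨h⁻¹, by simpa using hedge 0 (by omega), by simpa using hedge n le_rfl⟩

theorem edge_one_cases {a : ℕ → G.Dart} (ha : IsCuspidalRay Γ a) {n : ℕ}
    {l : Line G} (hl : l.edge 0 = a n) :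
    l.edge 1 = a (n + 1) ∨ ∃ g : Γ, g • (a (n + 1)).fst = (a (n + 1)).fst ∧
      g • (a n).fst ≠ (a n).fst ∧ l.edge 1 = g • (a n).symm := by
  have h0 : l 0 = (a n).fst := congrArg (fun d : G.Dart => d.fst) hl
  have h1 : l 1 = (a (n + 1)).fst := by
    rw [← ha.consecutive]; exact congrArg (fun d : G.Dart => d.snd) hl
  have hadj := l.adj 1
  rw [h1] at hadj
  rcases ha.neighbor hadj with h | ⟨g, hg, h⟩
  · exact Or.inl (dart_ext h1 (by rw [ha.consecutive]; exact h))
  · refine Or.inr ⟨g, hg, fun hgn => ?_, dart_ext ?_ h⟩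
    · rw [hgn, ← h0] at h
      have := l.inj h
      omega
    · change l 1 = g • (a n).snd
      rw [ha.consecutive, hg, h1]

theorem measurableSet_edge_eq (n : ℤ) (d : G.Dart) : MeasurableSet {l : Line G | l.edge n = d} := by
  have : {l : Line G | l.edge n = d} = {l | l n = d.fst} ∩ {l | l (n + 1) = d.snd} := by
    ext l
    exact ⟨fun h => ⟨congrArg (fun d : G.Dart => d.fst) h, congrArg (fun d : G.Dart => d.snd) h⟩,
      fun h => dart_ext h.1 h.2⟩
  rw [this]
  exact (measurableSet_line_eq _ _).inter (measurableSet_line_eq _ _)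

namespace CodingData

variable (D : CodingData Γ)

theorem measurableSet_cell [Countable Γ] (β : D.Letter) : MeasurableSet (D.cell β) := by
  have hex : ∀ (P : Γ → Prop) (n : ℤ) (d : Γ → G.Dart),
      MeasurableSet {l : Line G | ∃ g, P g ∧ l.edge n = d g} := by
    intro P n d
    have : {l : Line G | ∃ g, P g ∧ l.edge n = d g} = ⋃ g, ⋃ _ : P g, {l | l.edge n = d g} := by
      ext l; simp
    rw [this]
    exact MeasurableSet.iUnion fun g => MeasurableSet.iUnion fun _ => measurableSet_edge_eq _ _
  cases β with
  | core d => exact measurableSet_edge_eq _ _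
  | up i n =>
    exact MeasurableSet.inter (measurableSet_edge_eq _ _)
      (MeasurableSet.inter (measurableSet_edge_eq _ _) (measurableSet_edge_eq _ _))
  | down i n =>
    exact MeasurableSet.inter (measurableSet_edge_eq _ _)
      (MeasurableSet.inter (measurableSet_edge_eq _ _) (measurableSet_edge_eq _ _))
  | turnUp i n q =>
    exact MeasurableSet.inter (measurableSet_edge_eq _ _)
      (MeasurableSet.inter (hex _ _ _) (measurableSet_edge_eq _ _))
  | turnDown i n q =>
    exact MeasurableSet.inter (measurableSet_edge_eq _ _)
      (MeasurableSet.inter (hex _ _ _) (measurableSet_edge_eq _ _))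

/-- The geodesics entering the `i`-th horoball, at height `n` and going up. -/
def upSet (i : Fin D.r) (n : ℕ) : Set (Line G) :=
  {l | l.edge 0 = D.ray i n ∧ l.edge (-n) = D.ray i 0}

theorem flip_mem_upSet {i : Fin D.r} {n : ℕ} {l : Line G} :
    l.flip ∈ D.upSet i n ↔ l.edge 0 = (D.ray i n).symm ∧ l.edge n = (D.ray i 0).symm := by
  have key : ∀ (d e : G.Dart), d.symm = e ↔ d = e.symm := fun d e =>
    ⟨fun h => by rw [← h, SimpleGraph.Dart.symm_symm],
      fun h => by rw [h, SimpleGraph.Dart.symm_symm]⟩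
  simp only [upSet, Set.mem_ofPred_eq, Line.flip_edge, neg_neg, neg_zero, key]

theorem mem_upSet_of_up {i : Fin D.r} {n : ℕ} {l : Line G} (h : l ∈ D.cell (.up i n)) :
    l ∈ D.upSet i n := ⟨h.1, h.2.2⟩

theorem mem_upSet_of_turnUp {i : Fin D.r} {n : ℕ} {q} {l : Line G}
    (h : l ∈ D.cell (.turnUp i n q)) : l ∈ D.upSet i n := ⟨h.1, h.2.2⟩

theorem flip_mem_upSet_of_down {i : Fin D.r} {n : ℕ} {l : Line G}
    (h : l ∈ D.cell (.down i n)) : l.flip ∈ D.upSet i n := D.flip_mem_upSet.2 ⟨h.1, h.2.2⟩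

theorem flip_mem_upSet_of_turnDown {i : Fin D.r} {n : ℕ} {q} {l : Line G}
    (h : l ∈ D.cell (.turnDown i n q)) : l.flip ∈ D.upSet i n := D.flip_mem_upSet.2 ⟨h.1, h.2.2⟩

theorem upSet_flip_disjoint {i j : Fin D.r} {m n : ℕ} {l : Line G} {γ : Γ}
    (h : l ∈ D.upSet i m) (h' : (γ • l).flip ∈ D.upSet j n) : False := by
  have := (D.flip_mem_upSet.1 h').1
  rw [Line.edge_smul, h.1] at this
  exact D.ray_smul_ne_symm this

theorem upSet_core_disjoint {i : Fin D.r} {m : ℕ} {l : Line G} {γ : Γ} {d : D.edgeLift}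
    (h : l ∈ D.upSet i m) (h' : γ • l ∈ D.cell (.core d)) : False := by
  have : γ • D.ray i m = d := by rw [← h.1]; exact h'
  exact (D.edgeLift_core d.2 i m).1 ⟨γ, this⟩

theorem flip_upSet_core_disjoint {i : Fin D.r} {m : ℕ} {l : Line G} {γ : Γ} {d : D.edgeLift}
    (h : l.flip ∈ D.upSet i m) (h' : γ • l ∈ D.cell (.core d)) : False := by
  have : γ • (D.ray i m).symm = d := by rw [← (D.flip_mem_upSet.1 h).1]; exact h'
  exact (D.edgeLift_core d.2 i m).2 ⟨γ, this⟩

variable (htriv : ∀ v ∈ D.coreVertices, ∀ γ : Γ, γ • v = v → γ = 1)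
include htriv

/-- The group element fixes the origin of the cuspidal ray, a core vertex, which has trivial
stabiliser. -/
theorem upSet_unique {i j : Fin D.r} {m n : ℕ} {l : Line G} {γ : Γ} (h : l ∈ D.upSet i m)
    (h' : γ • l ∈ D.upSet j n) : i = j ∧ m = n ∧ γ = 1 := by
  have h1 := h'.1
  rw [Line.edge_smul, h.1] at h1
  obtain ⟨rfl, rfl⟩ := D.ray_smul_eq h1
  have h2 := h'.2
  rw [Line.edge_smul, h.2] at h2
  exact ⟨rfl, rfl, htriv _ (D.base_mem_core i) γ (congrArg (fun d : G.Dart => d.fst) h2)⟩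

/-- The edge at time 0 tells core, upward and downward letters apart. Within a cusp `upSet_unique`
makes the group element trivial, and the next (or previous) edge separates climbing from turning and
determines the coset. -/
theorem cell_unique {β β' : D.Letter} {l : Line G} {γ : Γ} (h : l ∈ D.cell β)
    (h' : γ • l ∈ D.cell β') : β = β' := by
  have hinv : γ⁻¹ • γ • l = l := inv_smul_smul _ _
  rcases β with d | ⟨i, n⟩ | ⟨i, n⟩ | ⟨i, n, q, hq⟩ | ⟨i, n, q, hq⟩
  · have hc : γ⁻¹ • γ • l ∈ D.cell (.core d) := by rwa [hinv]
    rcases β' with d' | ⟨j, m⟩ | ⟨j, m⟩ | ⟨j, m, q', hq'⟩ | ⟨j, m, q', hq'⟩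
    · congr 1
      have h1 : γ • d.1 = d'.1 := by rw [← show l.edge 0 = d from h]; exact h'
      obtain ⟨e, _, he⟩ := D.edgeLift_unique d'.1 (D.edgeLift_core d'.2)
      exact Subtype.ext ((he d.1 ⟨d.2, γ, h1⟩).trans
        (he d'.1 ⟨d'.2, 1, one_smul _ _⟩).symm)
    · exact (D.upSet_core_disjoint (D.mem_upSet_of_up h') hc).elim
    · exact (D.flip_upSet_core_disjoint (D.flip_mem_upSet_of_down h') hc).elim
    · exact (D.upSet_core_disjoint (D.mem_upSet_of_turnUp h') hc).elim
    · exact (D.flip_upSet_core_disjoint (D.flip_mem_upSet_of_turnDown h') hc).elim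
  · have hu := D.mem_upSet_of_up h
    rcases β' with d' | ⟨j, m⟩ | ⟨j, m⟩ | ⟨j, m, q', hq'⟩ | ⟨j, m, q', hq'⟩
    · exact (D.upSet_core_disjoint hu h').elim
    · obtain ⟨rfl, rfl, _⟩ := D.upSet_unique htriv hu (D.mem_upSet_of_up h')
      rfl
    · exact (D.upSet_flip_disjoint hu (D.flip_mem_upSet_of_down h')).elim
    · obtain ⟨rfl, rfl, rfl⟩ := D.upSet_unique htriv hu (D.mem_upSet_of_turnUp h')
      rw [one_smul] at h'
      obtain ⟨g, _, hg⟩ := h'.2.1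
      exact (D.ray_smul_ne_symm (γ := g⁻¹) (i := i) (j := i) (m := n + 1) (n := n) (by
        rw [← h.2.1, hg, inv_smul_smul])).elim
    · exact (D.upSet_flip_disjoint hu (D.flip_mem_upSet_of_turnDown h')).elim
  · have hu := D.flip_mem_upSet_of_down h
    have hc : (γ⁻¹ • γ • l).flip ∈ D.upSet i n := by rwa [hinv]
    rcases β' with d' | ⟨j, m⟩ | ⟨j, m⟩ | ⟨j, m, q', hq'⟩ | ⟨j, m, q', hq'⟩
    · exact (D.flip_upSet_core_disjoint hu h').elim
    · exact (D.upSet_flip_disjoint (D.mem_upSet_of_up h') hc).elim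
    · obtain ⟨rfl, rfl, _⟩ := D.upSet_unique htriv hu (D.flip_mem_upSet_of_down h')
      rfl
    · exact (D.upSet_flip_disjoint (D.mem_upSet_of_turnUp h') hc).elim
    · obtain ⟨rfl, rfl, rfl⟩ := D.upSet_unique htriv hu (D.flip_mem_upSet_of_turnDown h')
      rw [one_smul] at h'
      obtain ⟨g, _, hg⟩ := h'.2.1
      exact (D.ray_smul_ne_symm (γ := g⁻¹) (i := i) (j := i) (m := n) (n := n + 1) (by
        rw [← h.2.1, hg])).elim
  · have hu := D.mem_upSet_of_turnUp h
    rcases β' with d' | ⟨j, m⟩ | ⟨j, m⟩ | ⟨j, m, q', hq'⟩ | ⟨j, m, q', hq'⟩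
    · exact (D.upSet_core_disjoint hu h').elim
    · obtain ⟨rfl, rfl, rfl⟩ := D.upSet_unique htriv hu (D.mem_upSet_of_up h')
      rw [one_smul] at h'
      obtain ⟨g, _, hg⟩ := h.2.1
      exact (D.ray_smul_ne_symm (γ := g⁻¹) (i := i) (j := i) (m := n + 1) (n := n) (by
        rw [← h'.2.1, hg, inv_smul_smul])).elim
    · exact (D.upSet_flip_disjoint hu (D.flip_mem_upSet_of_down h')).elim
    · obtain ⟨rfl, rfl, rfl⟩ := D.upSet_unique htriv hu (D.mem_upSet_of_turnUp h')
      rw [one_smul] at h'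
      obtain ⟨g, hgq, hg⟩ := h.2.1
      obtain ⟨g', hgq', hg'⟩ := h'.2.1
      congr 1
      refine Subtype.ext (hgq.symm.trans ((QuotientGroup.eq.2 ?_).trans hgq'))
      have e : g • (D.ray i n).fst = g' • (D.ray i n).fst :=
        congrArg (fun d : G.Dart => d.snd) (hg.symm.trans hg')
      exact MulAction.mem_stabilizer_iff.2 (by rw [mul_smul, ← e, inv_smul_smul])
    · exact (D.upSet_flip_disjoint hu (D.flip_mem_upSet_of_turnDown h')).elim
  · have hu := D.flip_mem_upSet_of_turnDown h
    have hc : (γ⁻¹ • γ • l).flip ∈ D.upSet i n := by rwa [hinv]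
    rcases β' with d' | ⟨j, m⟩ | ⟨j, m⟩ | ⟨j, m, q', hq'⟩ | ⟨j, m, q', hq'⟩
    · exact (D.flip_upSet_core_disjoint hu h').elim
    · exact (D.upSet_flip_disjoint (D.mem_upSet_of_up h') hc).elim
    · obtain ⟨rfl, rfl, rfl⟩ := D.upSet_unique htriv hu (D.flip_mem_upSet_of_down h')
      rw [one_smul] at h'
      obtain ⟨g, _, hg⟩ := h.2.1
      exact (D.ray_smul_ne_symm (γ := g⁻¹) (i := i) (j := i) (m := n) (n := n + 1) (by
        rw [← h'.2.1, hg])).elim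
    · exact (D.upSet_flip_disjoint (D.mem_upSet_of_turnUp h') hc).elim
    · obtain ⟨rfl, rfl, rfl⟩ := D.upSet_unique htriv hu (D.flip_mem_upSet_of_turnDown h')
      rw [one_smul] at h'
      obtain ⟨g, hgq, hg⟩ := h.2.1
      obtain ⟨g', hgq', hg'⟩ := h'.2.1
      congr 1
      refine Subtype.ext (hgq.symm.trans ((Quotient.sound ?_).trans hgq'))
      have e : g⁻¹ • (D.ray i n).fst = g'⁻¹ • (D.ray i n).fst :=
        congrArg (fun d : G.Dart => d.fst) (hg.symm.trans hg')
      exact QuotientGroup.rightRel_apply.2 (MulAction.mem_stabilizer_iff.2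
        (by rw [mul_smul, e, smul_inv_smul]))

omit htriv in
theorem exists_smul_mem_upSet_cases (hT : G.IsTree) {i : Fin D.r} {n : ℕ} {l : Line G} {γ : Γ}
    (h : γ • D.ray i n = l.edge 0) :
    ∃ h : Γ, h • l ∈ D.upSet i n ∧ ((h • l).edge 1 = D.ray i (n + 1) ∨
      ∃ g : Γ, g ∈ D.cuspGroup i (n + 1) ∧ g ∉ D.cuspGroup i n ∧
        (h • l).edge 1 = g • (D.ray i n).symm) := by
  have h1 : (γ⁻¹ • l).edge 0 = D.ray i n := by rw [Line.edge_smul, ← h, inv_smul_smul]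
  obtain ⟨k, hk, hk'⟩ := exists_smul_edge_eq hT (D.cuspidal i) h1
  rw [← mul_smul] at hk hk'
  exact ⟨k * γ⁻¹, ⟨hk, hk'⟩, edge_one_cases (D.cuspidal i) hk⟩

omit htriv in
theorem exists_smul_mem_cell (hT : G.IsTree) (l : Line G) :
    ∃ (γ : Γ) (β : D.Letter), γ • l ∈ D.cell β := by
  by_cases hc : l.edge 0 ∈ D.coreEdges
  · obtain ⟨e, ⟨he, γ, hγ⟩, _⟩ := D.edgeLift_unique _ hc
    refine ⟨γ⁻¹, .core ⟨e, he⟩, ?_⟩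
    change (γ⁻¹ • l).edge 0 = e
    rw [Line.edge_smul, ← hγ, inv_smul_smul]
  · have : ∃ i n, EdgeEquiv Γ (D.ray i n) (l.edge 0) ∨ EdgeEquiv Γ (D.ray i n).symm (l.edge 0) := by
      by_contra! hcon
      exact hc fun i n => hcon i n
    obtain ⟨i, n, ⟨γ, hγ⟩ | ⟨γ, hγ⟩⟩ := this
    · obtain ⟨h, hu, h1 | ⟨g, hg, hg', h1⟩⟩ := D.exists_smul_mem_upSet_cases hT hγ
      · exact ⟨h, .up i n, hu.1, h1, hu.2⟩
      · exact ⟨h, .turnUp i n ⟨QuotientGroup.mk g, g, hg, hg', rfl⟩, hu.1, ⟨g, rfl, h1⟩, hu.2⟩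
    · have hγ' : γ • D.ray i n = l.flip.edge 0 := by
        rw [Line.flip_edge, neg_zero, ← hγ, dart_smul_symm, SimpleGraph.Dart.symm_symm]
      have key : ∀ (k : Γ) (d : G.Dart), (k • l.flip).edge 1 = d → (k • l).edge (-1) = d.symm := by
        intro k d hd
        rw [← hd, ← Line.flip_smul, Line.flip_edge, SimpleGraph.Dart.symm_symm]
      obtain ⟨h, hu, h1 | ⟨g, hg, hg', h1⟩⟩ := D.exists_smul_mem_upSet_cases hT hγ'
      · rw [← Line.flip_smul] at hu
        have hu' := D.flip_mem_upSet.1 hu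
        exact ⟨h, .down i n, hu'.1, key _ _ h1, hu'.2⟩
      · rw [← Line.flip_smul] at hu
        have hu' := D.flip_mem_upSet.1 hu
        -- Reversing the direction replaces the left coset of `g` by the right coset of its inverse.
        refine ⟨h, .turnDown i n ⟨Quotient.mk _ g⁻¹, g⁻¹, inv_mem hg,
          fun hi => hg' (inv_mem_iff.1 hi), rfl⟩, hu'.1, ⟨g⁻¹, rfl, ?_⟩, hu'.2⟩
        rw [key _ _ h1, dart_smul_symm, SimpleGraph.Dart.symm_symm, inv_inv]

theorem isMeasurablePartition_piece [Countable Γ] (hT : G.IsTree) :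
    IsMeasurablePartition D.piece where
  measurable β := measurableSet_proj_image (D.measurableSet_cell β)
  disjoint β β' hne := by
    refine Set.disjoint_left.2 ?_
    rintro _ ⟨l, hl, rfl⟩ ⟨l', hl', h⟩
    obtain ⟨γ, rfl⟩ := proj_eq_iff.1 h.symm
    exact hne (D.cell_unique htriv hl hl')
  cover := by
    refine Set.eq_univ_of_forall fun o => ?_
    obtain ⟨l, rfl⟩ : ∃ l, proj Γ l = o := Quotient.exists_rep o
    obtain ⟨γ, β, h⟩ := D.exists_smul_mem_cell hT l
    exact Set.mem_iUnion.2 ⟨β, γ • l, h, (proj_eq_iff.2 ⟨γ, rfl⟩).symm⟩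

end CodingData

end TreeFlow

namespace TreeFlow

variable {V : Type*} {G : SimpleGraph V}

/-! ### Growth of balls -/

theorem finite_ball (hT : G.IsTree) (hlf : ∀ v : V, (G.neighborSet v).Finite) (v : V) (n : ℕ) :
    {w | G.dist v w ≤ n}.Finite := by
  induction n with
  | zero =>
    refine (Set.finite_singleton v).subset fun w hw => ?_
    have : G.dist v w = 0 := Nat.le_zero.1 hw
    exact (hT.connected.dist_eq_zero_iff.1 this).symm
  | succ n ih =>
    refine ((Set.finite_singleton v).union (ih.biUnion fun w _ => hlf w)).subset fun w hw => ?_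
    by_cases h : w = v
    · exact Or.inl h
    · obtain ⟨p, hp, hd⟩ := exists_parent hT h
      have hw' : G.dist v w ≤ n + 1 := hw
      exact Or.inr (Set.mem_biUnion (show G.dist v p ≤ n by omega) hp)

theorem countable_vertices (hT : G.IsTree) (hlf : ∀ v : V, (G.neighborSet v).Finite) :
    Countable V := by
  obtain ⟨b⟩ := hT.connected.nonempty
  have : (Set.univ : Set V) = ⋃ n, {w | G.dist b w ≤ n} := by
    ext w
    simp only [Set.mem_univ, Set.mem_iUnion, true_iff]
    exact ⟨G.dist b w, le_refl (G.dist b w)⟩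
  refine Set.countable_univ_iff.1 ?_
  rw [this]
  exact Set.countable_iUnion fun n => (finite_ball hT hlf b n).countable

/-- The number of vertices in a ball. -/
noncomputable def ballCount (G : SimpleGraph V) (x : V) (n : ℕ) : ℝ≥0∞ :=
  ∑' v, if G.dist x v ≤ n then 1 else 0

/-- The largest number of vertices in a ball of given radius. -/
noncomputable def ballSup (G : SimpleGraph V) (n : ℕ) : ℝ≥0∞ := ⨆ x, ballCount G x n

/-- The generating series of the spheres around `x`. -/
noncomputable def sphereSeries (G : SimpleGraph V) (x : V) (y : ℝ≥0∞) : ℝ≥0∞ :=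
  ∑' v, y ^ G.dist x v

/-- The generating series of the sizes of the largest balls. -/
noncomputable def ballSeries (G : SimpleGraph V) (y : ℝ≥0∞) : ℝ≥0∞ := ∑' n, ballSup G n * y ^ n

theorem ballCount_le (x : V) (n : ℕ) : ballCount G x n ≤ ballSup G n :=
  le_iSup (fun x => ballCount G x n) x

theorem tsum_mem_eq_card {α : Type*} (s : Set α) [DecidablePred (· ∈ s)] :
    ∑' v, (if v ∈ s then (1 : ℝ≥0∞) else 0) = s.encard := by
  rw [← ENNReal.tsum_set_one, tsum_subtype s (fun _ => (1 : ℝ≥0∞))]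
  exact tsum_congr fun v => by simp [Set.indicator_apply]

theorem ballCount_lt_top {x : V} {n : ℕ} (h : {w | G.dist x w ≤ n}.Finite) :
    ballCount G x n < ⊤ := by
  have := tsum_mem_eq_card {w | G.dist x w ≤ n}
  simp only [Set.mem_ofPred_eq] at this
  rw [ballCount, this]
  simpa using h

theorem ballCount_smul (hT : G.IsTree) (γ : G ≃g G) (x : V) (n : ℕ) :
    ballCount G (γ • x) n = ballCount G x n := by
  rw [ballCount, ← (MulAction.toPerm γ : Equiv.Perm V).tsum_eq]
  exact tsum_congr fun v => by rw [MulAction.toPerm_apply, dist_smul hT]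

/-- Ball sizes are constant on the orbits of the cocompact group given by uniformity. This is how
that hypothesis enters: the maximal ball sizes are finite. -/
theorem exists_finite_reps (hT : G.IsTree) (hu : IsUniform G) :
    ∃ R : Finset V, ∀ x, ∃ r ∈ R, ∀ n, ballCount G x n = ballCount G r n := by
  obtain ⟨Γ, _, _, hfin⟩ := hu
  have := Fintype.ofFinite (MulAction.orbitRel.Quotient Γ V)
  classical
  refine ⟨Finset.univ.image (Quotient.out : MulAction.orbitRel.Quotient Γ V → V), fun x => ?_⟩
  refine ⟨Quotient.out (Quotient.mk _ x : MulAction.orbitRel.Quotient Γ V),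
    Finset.mem_image_of_mem _ (Finset.mem_univ _), fun n => ?_⟩
  have : (Quotient.mk _ (Quotient.out (Quotient.mk _ x : MulAction.orbitRel.Quotient Γ V)) :
    MulAction.orbitRel.Quotient Γ V) = Quotient.mk _ x := Quotient.out_eq _
  obtain ⟨γ, hγ⟩ := MulAction.orbitRel_apply.1 (Quotient.exact this)
  rw [← hγ]
  exact (ballCount_smul hT γ.1 x n).symm

theorem ballSup_le_sum {R : Finset V}
    (hR : ∀ x, ∃ r ∈ R, ∀ n, ballCount G x n = ballCount G r n) (n : ℕ) :
    ballSup G n ≤ ∑ r ∈ R, ballCount G r n := by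
  refine iSup_le fun x => ?_
  obtain ⟨r, hr, h⟩ := hR x
  rw [h]
  exact Finset.single_le_sum (f := fun r => ballCount G r n) (fun _ _ => zero_le) hr

theorem ballSup_lt_top (hT : G.IsTree) (hlf : ∀ v : V, (G.neighborSet v).Finite)
    (hu : IsUniform G) (n : ℕ) : ballSup G n < ⊤ := by
  obtain ⟨R, hR⟩ := exists_finite_reps hT hu
  refine (ballSup_le_sum hR n).trans_lt (ENNReal.sum_lt_top.2 fun r _ => ?_)
  exact ballCount_lt_top (finite_ball hT hlf r n)

theorem exists_intermediate (hT : G.IsTree) (x : V) (m n : ℕ) : ∀ v, G.dist x v ≤ m + n →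
    ∃ w, G.dist x w ≤ m ∧ G.dist w v ≤ n := by
  induction n with
  | zero => exact fun v h => ⟨v, h, by simp⟩
  | succ n ih =>
    intro v h
    by_cases hv : v = x
    · exact ⟨v, by simp [hv], by simp⟩
    · obtain ⟨p, hp, hd⟩ := exists_parent hT hv
      obtain ⟨w, hw, hw'⟩ := ih p (by omega)
      refine ⟨w, hw, (hT.connected.dist_triangle (v := p)).trans ?_⟩
      rw [SimpleGraph.dist_eq_one_iff_adj.2 hp]
      omega

/-- A ball of radius m + n is covered by the balls of radius n centred in the ball of radius m. -/
theorem ballSup_add_le (hT : G.IsTree) (m n : ℕ) :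
    ballSup G (m + n) ≤ ballSup G m * ballSup G n := by
  refine iSup_le fun x => ?_
  calc ballCount G x (m + n)
      ≤ ∑' v, ∑' w, (if G.dist x w ≤ m then 1 else 0) * (if G.dist w v ≤ n then 1 else 0) := by
        refine ENNReal.tsum_le_tsum fun v => ?_
        split_ifs with h
        · obtain ⟨w, h1, h2⟩ := exists_intermediate hT x m n v h
          refine le_trans ?_ (ENNReal.le_tsum w)
          simp [h1, h2]
        · exact zero_le
    _ = ∑' w, (if G.dist x w ≤ m then 1 else 0) * ballCount G w n := by
        rw [ENNReal.tsum_comm]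
        exact tsum_congr fun w => ENNReal.tsum_mul_left
    _ ≤ ∑' w, (if G.dist x w ≤ m then 1 else 0) * ballSup G n :=
        ENNReal.tsum_le_tsum fun w => by gcongr; exact ballCount_le w n
    _ = ballCount G x m * ballSup G n := ENNReal.tsum_mul_right
    _ ≤ _ := by gcongr; exact ballCount_le x m

theorem ballSeries_mono {y z : ℝ≥0∞} (h : y ≤ z) : ballSeries G y ≤ ballSeries G z :=
  ENNReal.tsum_le_tsum fun n => by gcongr

/-- By submultiplicativity one term smaller than 1, of index n > 0, bounds the series by a geometric
one on each residue class modulo n. -/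
theorem ballSeries_lt_top_of_term (hT : G.IsTree) (hfin : ∀ n, ballSup G n < ⊤) {n : ℕ}
    (hn : n ≠ 0) {y : ℝ≥0∞} (hy : y ≠ ⊤) (h : ballSup G n * y ^ n < 1) : ballSeries G y < ⊤ := by
  have : NeZero n := ⟨hn⟩
  set f : ℕ → ℝ≥0∞ := fun m => ballSup G m * y ^ m
  have hadd : ∀ a b, f (a + b) ≤ f a * f b := fun a b =>
    calc f (a + b) ≤ ballSup G a * ballSup G b * y ^ (a + b) := by
          exact mul_le_mul_left (ballSup_add_le hT a b) _
      _ = f a * f b := by rw [pow_add]; ring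
  have hf : ∀ m, f m < ⊤ := fun m => ENNReal.mul_lt_top (hfin m) (ENNReal.pow_lt_top hy.lt_top)
  have hmul : ∀ k r, f (r + n * k) ≤ f n ^ k * f r := by
    intro k r
    induction k with
    | zero => simp
    | succ k ih =>
      calc f (r + n * (k + 1)) = f (n + (r + n * k)) := by congr 1; ring
        _ ≤ f n * f (r + n * k) := hadd _ _
        _ ≤ f n * (f n ^ k * f r) := by gcongr
        _ = _ := by rw [pow_succ]; ring
  calc ballSeries G y = ∑' p : ℕ × Fin n, f ((Nat.divModEquiv n).symm p) :=
        ((Nat.divModEquiv n).symm.tsum_eq f).symm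
    _ ≤ ∑' p : ℕ × Fin n, f n ^ p.1 * f p.2 := by
        refine ENNReal.tsum_le_tsum fun p => ?_
        have := hmul p.1 p.2
        rwa [add_comm, mul_comm n] at this
    _ = (1 - f n)⁻¹ * ∑ r : Fin n, f r := by
        rw [ENNReal.tsum_prod']
        simp_rw [ENNReal.tsum_mul_left, ENNReal.tsum_mul_right]
        rw [ENNReal.tsum_geometric, tsum_fintype]
    _ < ⊤ := ENNReal.mul_lt_top (ENNReal.inv_lt_top.2 (tsub_pos_of_lt h))
        (ENNReal.sum_lt_top.2 fun r _ => hf r)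

theorem tsum_ge_pow (y : ℝ≥0∞) (d : ℕ) :
    ∑' n, (if d ≤ n then (1 : ℝ≥0∞) else 0) * y ^ n = y ^ d * (1 - y)⁻¹ := by
  rw [← ENNReal.tsum_geometric, ← ENNReal.tsum_mul_left]
  rw [← (add_right_injective d).tsum_eq]
  · exact tsum_congr fun k => by simp [pow_add]
  · intro n hn
    by_contra h
    refine hn ?_
    have : ¬ d ≤ n := fun hd => h ⟨n - d, by simp; omega⟩
    simp [this]

theorem tsum_ballCount (x : V) (y : ℝ≥0∞) :
    ∑' n, ballCount G x n * y ^ n = sphereSeries G x y * (1 - y)⁻¹ := by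
  simp only [ballCount, ← ENNReal.tsum_mul_right]
  rw [ENNReal.tsum_comm, sphereSeries, ← ENNReal.tsum_mul_right]
  exact tsum_congr fun v => tsum_ge_pow y _

theorem pow_dist_mul_sphereSeries_le (hT : G.IsTree) (b x : V) {y : ℝ≥0∞} (hy : y ≤ 1) :
    y ^ G.dist b x * sphereSeries G x y ≤ sphereSeries G b y := by
  rw [sphereSeries, ← ENNReal.tsum_mul_left]
  refine ENNReal.tsum_le_tsum fun v => ?_
  rw [← pow_add]
  exact pow_le_pow_of_le_one zero_le hy hT.connected.dist_triangle

/-- The sphere series at different centres are comparable, and finitely many centres account for all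
ball sizes. -/
theorem ballSeries_lt_top_of_sphereSeries (hT : G.IsTree) (hu : IsUniform G) (b : V) {y : ℝ≥0∞}
    (hy0 : y ≠ 0) (hy : y < 1) (h : sphereSeries G b y < ⊤) : ballSeries G y < ⊤ := by
  obtain ⟨R, hR⟩ := exists_finite_reps hT hu
  calc ballSeries G y ≤ ∑' n, ∑ r ∈ R, ballCount G r n * y ^ n :=
        ENNReal.tsum_le_tsum fun n => by
          rw [← Finset.sum_mul]; gcongr; exact ballSup_le_sum hR n
    _ = ∑ r ∈ R, sphereSeries G r y * (1 - y)⁻¹ := by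
        rw [Summable.tsum_finsetSum fun _ _ => ENNReal.summable]
        exact Finset.sum_congr rfl fun r _ => tsum_ballCount r y
    _ < ⊤ := ENNReal.sum_lt_top.2 fun r _ => by
        refine ENNReal.mul_lt_top ?_ (ENNReal.inv_lt_top.2 (tsub_pos_of_lt hy))
        by_contra hr
        rw [not_lt_top_iff] at hr
        have := pow_dist_mul_sphereSeries_le hT b r hy.le
        rw [hr, ENNReal.mul_top (pow_ne_zero _ hy0)] at this
        exact absurd (this.trans_lt h) (lt_irrefl _)

theorem sphereSeries_le_ballSeries (b : V) (y : ℝ≥0∞) : sphereSeries G b y ≤ ballSeries G y := by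
  calc sphereSeries G b y ≤ ∑' v, ∑' n, (if G.dist b v ≤ n then 1 else 0) * y ^ n :=
        ENNReal.tsum_le_tsum fun v => by
          refine le_trans ?_ (ENNReal.le_tsum (G.dist b v))
          simp
    _ = ∑' n, ballCount G b n * y ^ n := by
        rw [ENNReal.tsum_comm]
        exact tsum_congr fun n => ENNReal.tsum_mul_right
    _ ≤ _ := ENNReal.tsum_le_tsum fun n => by gcongr; exact ballCount_le b n

end TreeFlow

namespace TreeFlow

variable {V : Type*} {G : SimpleGraph V} {Γ : Subgroup (G ≃g G)}

/-! ### Growth of the tree and growth of the core -/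

namespace CuspidalDecomposition

variable (D : CuspidalDecomposition Γ)

/-- The generating series of the spheres around `b` in the core. -/
noncomputable def coreSeries (b : V) (y : ℝ≥0∞) : ℝ≥0∞ := ∑' v : D.coreVertices, y ^ G.dist b v.1

variable {D} (htriv : ∀ v ∈ D.coreVertices, ∀ γ : Γ, γ • v = v → γ = 1)
include htriv

theorem tsum_base_le (b : V) (i : Fin D.r) (y : ℝ≥0∞) :
    ∑' γ : Γ, y ^ G.dist b (γ • (D.ray i 0).fst) ≤ D.coreSeries b y := by
  have hinj : Function.Injective fun γ : Γ =>
      (⟨γ • (D.ray i 0).fst, D.smul_mem_core (D.base_mem_core i) γ⟩ : D.coreVertices) :=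
    fun γ γ' h => D.smul_injective_of_core htriv (D.base_mem_core i) (congrArg Subtype.val h)
  exact ENNReal.tsum_comp_le_tsum_of_injective hinj fun v : D.coreVertices => y ^ G.dist b v.1

/-- A vertex outside the core lies in a horoball, at some level k. The geodesic from `b` climbs to
level k + j and descends j levels, so it has length d + k + 2j, with d the distance to its point of
entry. With the entry, k and j fixed, the vertex is in a ball of radius j; summing over j produces
the ball series at y². -/
theorem sphereSeries_le (hT : G.IsTree) {b : V} (hb : b ∈ D.coreVertices) (y : ℝ≥0∞) :
    sphereSeries G b y ≤ D.coreSeries b y +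
      D.r * (D.coreSeries b y * ((1 - y)⁻¹ * ballSeries G (y ^ 2))) := by
  classical
  -- The index is (cusp, element giving the entry, level k, descent j); `c` below is the highest
  -- point of the path.
  let w : Fin D.r × Γ × ℕ × ℕ → ℝ≥0∞ := fun p =>
    y ^ G.dist b (p.2.1 • (D.ray p.1 0).fst) * (y ^ p.2.2.1 * (y ^ 2) ^ p.2.2.2)
  let c : Fin D.r × Γ × ℕ × ℕ → V := fun p => p.2.1 • (D.ray p.1 (p.2.2.1 + p.2.2.2)).fst
  have hv : ∀ v, y ^ G.dist b v ≤ (D.coreVertices.indicator (fun v => y ^ G.dist b v) v) +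
      ∑' p, (if G.dist (c p) v ≤ p.2.2.2 then 1 else 0) * w p := by
    intro v
    by_cases hvc : v ∈ D.coreVertices
    · rw [Set.indicator_of_mem hvc]
      exact le_self_add
    · obtain ⟨i, n, γ, rfl⟩ := (D.core_or_cusp v).resolve_left hvc
      obtain ⟨j, γ', h1, h2, _⟩ := (D.cuspidal i).exists_entry hT (fun n γ => hb i n γ) γ (n + 1)
      refine le_trans ?_ (le_trans (ENNReal.le_tsum (i, γ', n + 1, j)) le_add_self)
      have h3 : G.dist (c (i, γ', n + 1, j)) (γ • (D.ray i (n + 1)).fst) ≤ j := by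
        simp only [c]
        rw [h1, dist_smul' hT, SimpleGraph.dist_comm, (D.cuspidal i).dist_fst hT]
      simp only at h3 ⊢
      rw [if_pos h3, one_mul, h2]
      simp only [w]
      rw [pow_add, pow_add, pow_mul, mul_assoc, mul_comm ((y ^ 2) ^ j)]
  calc sphereSeries G b y ≤ ∑' v, ((D.coreVertices.indicator (fun v => y ^ G.dist b v) v) +
      ∑' p, (if G.dist (c p) v ≤ p.2.2.2 then 1 else 0) * w p) := ENNReal.tsum_le_tsum hv
    _ = D.coreSeries b y + ∑' p, ballCount G (c p) p.2.2.2 * w p := by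
        rw [ENNReal.tsum_add, coreSeries, tsum_subtype D.coreVertices fun v => y ^ G.dist b v,
          ENNReal.tsum_comm]
        congr 1
        exact tsum_congr fun p => ENNReal.tsum_mul_right
    _ ≤ D.coreSeries b y + ∑' p : Fin D.r × Γ × ℕ × ℕ,
          y ^ G.dist b (p.2.1 • (D.ray p.1 0).fst) * (y ^ p.2.2.1 *
            (ballSup G p.2.2.2 * (y ^ 2) ^ p.2.2.2)) := by
        refine add_le_add_right (ENNReal.tsum_le_tsum fun p => ?_) _
        calc ballCount G (c p) p.2.2.2 * w p ≤ ballSup G p.2.2.2 * w p :=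
              mul_le_mul_left (ballCount_le _ _) _
          _ = _ := by simp only [w]; ring
    _ = D.coreSeries b y + ∑ i : Fin D.r, (∑' γ : Γ, y ^ G.dist b (γ • (D.ray i 0).fst)) *
          ((1 - y)⁻¹ * ballSeries G (y ^ 2)) := by
        simp_rw [ENNReal.tsum_prod', ENNReal.tsum_mul_left, ENNReal.tsum_mul_right]
        rw [tsum_fintype, ENNReal.tsum_geometric, ← Finset.sum_mul]
        rfl
    _ ≤ D.coreSeries b y + ∑ _i : Fin D.r, D.coreSeries b y *
          ((1 - y)⁻¹ * ballSeries G (y ^ 2)) := by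
        gcongr with i
        exact tsum_base_le htriv b i y
    _ = _ := by simp

theorem ballSeries_lt_top_of_sq (hT : G.IsTree) (hu : IsUniform G) {b : V} (hb : b ∈ D.coreVertices) {y : ℝ≥0∞} (hy0 : y ≠ 0)
    (hy : y < 1) (hc : D.coreSeries b y < ⊤) (h2 : ballSeries G (y ^ 2) < ⊤) :
    ballSeries G y < ⊤ := by
  refine ballSeries_lt_top_of_sphereSeries hT hu b hy0 hy
    ((sphereSeries_le htriv hT hb y).trans_lt ?_)
  exact ENNReal.add_lt_top.2 ⟨hc, ENNReal.mul_lt_top (ENNReal.natCast_lt_top _)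
    (ENNReal.mul_lt_top hc (ENNReal.mul_lt_top (ENNReal.inv_lt_top.2 (tsub_pos_of_lt hy)) h2))⟩

/-- Convergence at y² implies convergence at y as long as the core series converges there, and y
raised to a large power of 2 is in the range where submultiplicativity alone gives convergence. -/
theorem ballSeries_lt_top (hT : G.IsTree) (hlf : ∀ v : V, (G.neighborSet v).Finite)
    (hu : IsUniform G) {b : V} (hb : b ∈ D.coreVertices) {p : ℝ≥0∞} (hp : p ≤ 1)
    (hc : ∀ y < p, D.coreSeries b y < ⊤) {y : ℝ≥0∞} (hy : y < p) : ballSeries G y < ⊤ := by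
  have hfin := ballSup_lt_top hT hlf hu
  have key : ∀ k : ℕ, ∀ y, y ≠ 0 → y < p → ballSup G 1 * y ^ 2 ^ k < 1 → ballSeries G y < ⊤ := by
    intro k
    induction k with
    | zero =>
      intro y _ hy h
      exact ballSeries_lt_top_of_term hT hfin one_ne_zero (hy.trans_le le_top).ne (by simpa using h)
    | succ k ih =>
      intro y hy0 hy h
      have hy1 : y < 1 := hy.trans_le hp
      refine ballSeries_lt_top_of_sq htriv hT hu hb hy0 hy1 (hc y hy)
        (ih (y ^ 2) (pow_ne_zero _ hy0) ?_ ?_)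
      · exact (pow_le_of_le_one zero_le hy1.le two_ne_zero).trans_lt hy
      · rwa [← pow_mul, ← pow_succ']
  -- The recursion needs a non-zero argument, whereas `y` may vanish.
  obtain ⟨z, hyz, hzp⟩ := exists_between hy
  refine (ballSeries_mono hyz.le).trans_lt ?_
  have hz1 : z < 1 := hzp.trans_le hp
  have hlim : Tendsto (fun n => ballSup G 1 * z ^ n) atTop (𝓝 (ballSup G 1 * 0)) :=
    ENNReal.Tendsto.const_mul (ENNReal.tendsto_pow_atTop_nhds_zero_of_lt_one hz1)
      (Or.inr (hfin 1).ne)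
  rw [mul_zero] at hlim
  obtain ⟨n, hn⟩ := ((hlim.eventually_lt_const one_pos).and (eventually_ge_atTop 0)).exists
  refine key n z (zero_le.trans_lt hyz).ne' hzp (lt_of_le_of_lt ?_ hn.1)
  gcongr ballSup G 1 * ?_
  exact pow_le_pow_of_le_one zero_le hz1.le Nat.lt_two_pow_self.le

end CuspidalDecomposition

/-! ### The critical exponent -/

/-- The orbit of a core vertex is free, so its series is part of the sphere series; changing the
base point costs only a constant factor. -/
theorem criticalExponent_le {D : CuspidalDecomposition Γ}
    (htriv : ∀ v ∈ D.coreVertices, ∀ γ : Γ, γ • v = v → γ = 1) (hT : G.IsTree) (x : V) {s : ℝ≥0}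
    (h : ballSeries G (edgeFactor s) < ⊤) : criticalExponent Γ x ≤ s := by
  refine sInf_le ⟨s, rfl, ?_⟩
  set q := edgeFactor s
  have hq1 : q ≤ 1 := by
    rw [← ENNReal.ofReal_one]
    exact ENNReal.ofReal_le_ofReal (Real.exp_le_one_iff.2 (by simp))
  have := hT.connected.nonempty
  obtain ⟨b, hb⟩ := D.exists_core
  have h1 : q ^ (2 * G.dist b x) * ∑' γ : Γ, q ^ G.dist x (γ • x) ≤ ballSeries G q := by
    refine le_trans ?_ (sphereSeries_le_ballSeries b q)
    refine le_trans ?_ (ENNReal.tsum_comp_le_tsum_of_injective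
      (D.smul_injective_of_core htriv hb) fun v => q ^ G.dist b v)
    rw [← ENNReal.tsum_mul_left]
    refine ENNReal.tsum_le_tsum fun γ => ?_
    rw [← pow_add]
    refine pow_le_pow_of_le_one zero_le hq1 ?_
    have h2 : G.dist b (γ • b) ≤ G.dist b x + G.dist x (γ • b) := hT.connected.dist_triangle
    have h3 : G.dist x (γ • b) ≤ G.dist x (γ • x) + G.dist (γ • x) (γ • b) :=
      hT.connected.dist_triangle
    rw [dist_smul' hT, G.dist_comm (u := x) (v := b)] at h3
    omega
  have h2 : ∑' γ : Γ, q ^ G.dist x (γ • x) ≠ ⊤ := by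
    intro htop
    rw [htop, ENNReal.mul_top (pow_ne_zero _ (edgeFactor_ne_zero _))] at h1
    exact absurd (h1.trans_lt h) (lt_irrefl _)
  refine (ENNReal.summable_toReal h2).congr fun γ => ?_
  rw [edgeFactor_pow, ENNReal.toReal_ofReal (Real.exp_pos _).le]
  congr 1
  ring

/-- If the series converged, some term would be smaller than 1. This is an open condition on the
exponent, and it would give convergence of the Poincaré series below the critical exponent. -/
theorem ballSeries_eq_top {D : CuspidalDecomposition Γ}
    (htriv : ∀ v ∈ D.coreVertices, ∀ γ : Γ, γ • v = v → γ = 1) (hT : G.IsTree)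
    (hlf : ∀ v : V, (G.neighborSet v).Finite) (hu : IsUniform G) (x : V)
    (hδ : 0 < (criticalExponent Γ x).toReal) :
    ballSeries G (edgeFactor (criticalExponent Γ x).toReal) = ⊤ := by
  set δ := (criticalExponent Γ x).toReal
  have hfin := ballSup_lt_top hT hlf hu
  by_contra hne
  have hlim := ENNReal.tendsto_atTop_zero_of_tsum_ne_top hne
  obtain ⟨n, hn, hn0⟩ := ((hlim.eventually_lt_const one_pos).and (eventually_gt_atTop 0)).exists
  have hcont : Continuous fun s : ℝ => (ballSup G n).toReal * Real.exp (-(n * s)) := by fun_prop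
  have hof : ∀ s : ℝ, ballSup G n * edgeFactor s ^ n =
      ENNReal.ofReal ((ballSup G n).toReal * Real.exp (-(n * s))) := fun s => by
    rw [edgeFactor_pow, ENNReal.ofReal_mul ENNReal.toReal_nonneg, ENNReal.ofReal_toReal (hfin n).ne]
  have hlt : (ballSup G n).toReal * Real.exp (-(n * δ)) < 1 := by
    rw [hof] at hn
    exact ENNReal.ofReal_lt_one.1 hn
  have hev := (hcont.tendsto δ).eventually_lt_const hlt
  -- An exponent `s` with 0 < s < δ at which the chosen term is still smaller than 1.
  obtain ⟨s, ⟨hs1, hs2⟩, hs0⟩ := (((hev.filter_mono nhdsWithin_le_nhds).and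
    (self_mem_nhdsWithin (a := δ) (s := Set.Iio δ))).and
    ((lt_mem_nhds hδ).filter_mono nhdsWithin_le_nhds)).exists
  have hs0' : 0 < s := hs0
  have hle := criticalExponent_le (s := ⟨s, hs0'.le⟩) htriv hT x
    (ballSeries_lt_top_of_term hT hfin hn0.ne' (edgeFactor_ne_top _) (by
      rw [hof]; exact ENNReal.ofReal_lt_one.2 hs1))
  have := ENNReal.toReal_mono ENNReal.coe_ne_top hle
  exact absurd (this.trans_lt hs2) (lt_irrefl _)

end TreeFlow

namespace TreeFlow

variable {V : Type*} {G : SimpleGraph V} {Γ : Subgroup (G ≃g G)} {δ : ℝ}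
  {μ : V → Measure (Boundary G)}

/-! ### Estimates for Patterson-Sullivan measures -/

theorem exists_pos_le_of_finite {α : Type*} {s : Set α} (hs : s.Finite) {f : α → ℝ≥0∞}
    (hf : ∀ a ∈ s, 0 < f a) : ∃ c > 0, ∀ a ∈ s, c ≤ f a := by
  induction s, hs using Set.Finite.induction_on with
  | empty => exact ⟨1, one_pos, by simp⟩
  | @insert a s _ _ ih =>
    obtain ⟨c, hc, h⟩ := ih fun b hb => hf b (Set.mem_insert_of_mem _ hb)
    refine ⟨min c (f a), lt_min hc (hf a (Set.mem_insert _ _)), fun b hb => ?_⟩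
    rcases hb with rfl | hb
    · exact min_le_right _ _
    · exact (min_le_left _ _).trans (h b hb)

theorem finite_darts {Y : Set V} (hY : Y.Finite) (hlf : ∀ v : V, (G.neighborSet v).Finite) :
    {d : G.Dart | d.fst ∈ Y}.Finite := by
  refine Set.Finite.of_injOn (f := fun d : G.Dart => d.toProd)
    (t := ⋃ y ∈ Y, {y} ×ˢ G.neighborSet y) (fun d hd => ?_)
    (fun d _ e _ h => SimpleGraph.Dart.ext _ _ h)
    (hY.biUnion fun y _ => (Set.finite_singleton y).prod (hlf y))
  exact Set.mem_biUnion hd ⟨rfl, d.adj⟩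

theorem measure_shadow_smul (hT : G.IsTree) (hμ : IsPattersonSullivan Γ δ μ) (γ : Γ) (d : G.Dart) :
    μ (γ • d).fst (shadow (γ • d)) = μ d.fst (shadow d) := by
  rw [dart_smul_fst, measure_smul hT hμ γ _ (measurableSet_shadow _)]
  congr 1
  ext ξ
  exact smul_mem_shadow hT γ.1

theorem measure_shadow_pos (hT : G.IsTree) (hμ : IsPattersonSullivan Γ δ μ)
    (hne : NonElementary Γ) (hmin : IsMinimal Γ) (x : V) (d : G.Dart) : 0 < μ x (shadow d) :=
  hμ.support x _ (isOpen_shadow d) (shadow_nonempty hT hne hmin d)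

/-- Every vertex has a neighbour farther away from `b`, and the shadow of the edge to that neighbour
is seen from `b` behind the vertex. -/
theorem exists_outward_dart (hT : G.IsTree) (hne : NonElementary Γ) (hmin : IsMinimal Γ) (b v : V) :
    ∃ d : G.Dart, d.fst = v ∧ ∀ ξ ∈ shadow d, rayTo hT b ξ (G.dist b v) = v := by
  obtain ⟨w, hw, hd⟩ : ∃ w, G.Adj v w ∧ G.dist b w = G.dist b v + 1 := by
    obtain ⟨p, q, hpq, hp, hq⟩ := exists_two_neighbors hT hne hmin v
    rcases hT.dist_eq_dist_add_one_of_adj b hp with h | h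
    · rcases hT.dist_eq_dist_add_one_of_adj b hq with h' | h'
      · exact absurd (parent_unique hT b hp.symm hq.symm h h') hpq
      · exact ⟨q, hq, h'⟩
    · exact ⟨p, hp, h⟩
  refine ⟨⟨(v, w), hw⟩, rfl, fun ξ hξ => ?_⟩
  rw [mem_shadow hT] at hξ
  have hξ' : rayTo hT v ξ 1 = w := hξ
  have := rayTo_of_dist_one hT (x := b) (r := rayTo hT v ξ) (by rw [hξ', rayTo_zero, hd]) 0
  simpa using this

/-! ### Shadows seen from core vertices and convergence of the core series -/

namespace CuspidalDecomposition

variable {D : CuspidalDecomposition Γ}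

/-- Up to the group there are finitely many edges starting in the core, and each shadow is a
non-empty open set. -/
theorem exists_shadow_lower_bound (hT : G.IsTree) (hlf : ∀ v : V, (G.neighborSet v).Finite)
    (hμ : IsPattersonSullivan Γ δ μ) (hne : NonElementary Γ) (hmin : IsMinimal Γ) :
    ∃ c > 0, ∀ d : G.Dart, d.fst ∈ D.coreVertices → c ≤ μ d.fst (shadow d) := by
  obtain ⟨Y, hY, _, hrep⟩ := D.exists_reps
  obtain ⟨c, hc, h⟩ := exists_pos_le_of_finite (finite_darts hY hlf)
    (f := fun d => μ d.fst (shadow d)) fun d _ => measure_shadow_pos hT hμ hne hmin _ d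
  refine ⟨c, hc, fun d hd => ?_⟩
  obtain ⟨γ, y, hy, hγ⟩ := hrep _ hd
  rw [← smul_inv_smul γ d, measure_shadow_smul hT hμ]
  refine h _ ?_
  change γ⁻¹ • d.fst ∈ Y
  rwa [← hγ, inv_smul_smul]

/-- Each core vertex at distance n from `b` hides from `b` a set of ends of mass at least c p^n. At
fixed n these sets are disjoint, so the n-th sphere of the core has at most a constant times p^{-n}
vertices. -/
theorem coreSeries_lt_top (hT : G.IsTree) (hlf : ∀ v : V, (G.neighborSet v).Finite)
    (hμ : IsPattersonSullivan Γ δ μ) (hne : NonElementary Γ) (hmin : IsMinimal Γ) (b : V)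
    {y : ℝ≥0∞} (hy : y < edgeFactor δ) : D.coreSeries b y < ⊤ := by
  classical
  have := countable_vertices hT hlf
  have := hμ.finite b
  obtain ⟨c, hc, hlow⟩ := D.exists_shadow_lower_bound hT hlf hμ hne hmin
  set p := edgeFactor δ
  have hp0 : p ≠ 0 := edgeFactor_ne_zero δ
  have hpt : p ≠ ⊤ := edgeFactor_ne_top δ
  choose d hd hsh using exists_outward_dart hT hne hmin b
  have hn : ∀ n, ∑' v : D.coreVertices, (if G.dist b v.1 = n then 1 else 0) * p ^ n ≤
      μ b Set.univ / c := by
    intro n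
    rw [ENNReal.le_div_iff_mul_le (Or.inl hc.ne') (Or.inr (measure_ne_top _ _)),
      ← ENNReal.tsum_mul_right]
    let E : D.coreVertices → Set (Boundary G) := fun v =>
      if G.dist b v.1 = n then shadow (d v.1) else ∅
    have hE : ∀ v, MeasurableSet (E v) := fun v => by
      simp only [E]; split_ifs
      · exact measurableSet_shadow _
      · exact MeasurableSet.empty
    -- The n-th vertex of the ray from `b` recovers the core vertex behind which the end lies.
    have hdisj : Pairwise (Function.onFun Disjoint E) := by
      intro v w hvw
      refine Set.disjoint_left.2 fun ξ h1 h2 => hvw ?_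
      simp only [E] at h1 h2
      split_ifs at h1 h2 with e1 e2
      · have r1 := hsh _ ξ h1
        have r2 := hsh _ ξ h2
        rw [e1] at r1
        rw [e2] at r2
        exact Subtype.ext (r1.symm.trans r2)
      all_goals simp at *
    calc _ ≤ ∑' v, μ b (E v) := ENNReal.tsum_le_tsum fun v => by
          simp only [E]
          split_ifs with h
          · rw [measure_path hT hμ (measurableSet_shadow _) (hsh v.1), one_mul, h]
            gcongr
            have := hlow (d v.1) (by rw [hd]; exact v.2)
            rwa [hd] at this
          · simp
      _ = μ b (⋃ v, E v) := (measure_iUnion hdisj hE).symm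
      _ ≤ _ := measure_mono (Set.subset_univ _)
  calc D.coreSeries b y = ∑' v : D.coreVertices, ∑' n, (y / p) ^ n *
        ((if G.dist b v.1 = n then 1 else 0) * p ^ n) := by
        refine tsum_congr fun v => ?_
        rw [tsum_eq_single (G.dist b v.1) fun n hn => by rw [if_neg hn.symm]; simp]
        rw [if_pos rfl, one_mul, ← mul_pow, ENNReal.div_mul_cancel hp0 hpt]
    _ = ∑' n, (y / p) ^ n * ∑' v : D.coreVertices, (if G.dist b v.1 = n then 1 else 0) * p ^ n := by
        rw [ENNReal.tsum_comm]
        exact tsum_congr fun n => ENNReal.tsum_mul_left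
    _ ≤ ∑' n, (y / p) ^ n * (μ b Set.univ / c) :=
        ENNReal.tsum_le_tsum fun n => by gcongr; exact hn n
    _ = (1 - y / p)⁻¹ * (μ b Set.univ / c) := by
        rw [ENNReal.tsum_mul_right, ENNReal.tsum_geometric]
    _ < ⊤ := by
        refine ENNReal.mul_lt_top (ENNReal.inv_lt_top.2 (tsub_pos_of_lt ?_))
          (ENNReal.div_lt_top (measure_ne_top _ _) hc.ne')
        exact (ENNReal.div_lt_iff (Or.inl hp0) (Or.inl hpt)).2 (by rwa [one_mul])

end CuspidalDecomposition

/-! ### Masses seen from inside a horoball -/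

namespace IsCuspidalRay

variable {a : ℕ → G.Dart} (ha : IsCuspidalRay Γ a) (hT : G.IsTree)

/-- The ends of the rays leaving the horoball at the origin of the cuspidal ray. -/
def exterior (hT : G.IsTree) (a : ℕ → G.Dart) : Set (Boundary G) :=
  {ξ | rayTo hT (a 0).fst ξ 1 ≠ (a 1).fst}

theorem measurableSet_exterior : MeasurableSet (exterior hT a) :=
  (measurableSet_rayTo_eq hT _ 1 _).compl

include ha

theorem exterior_eq_shadow : exterior hT a = shadow (a 0).symm := by
  rw [shadow_symm hT]
  ext ξ
  rw [Set.mem_compl_iff, mem_shadow hT, ha.consecutive]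
  rfl

theorem rayTo_of_mem_exterior {ξ : Boundary G} (hξ : ξ ∈ exterior hT a) (m : ℕ) :
    rayTo hT (a m).fst ξ m = (a 0).fst ∧ rayTo hT (a m).fst ξ 1 ≠ (a (m + 1)).fst := by
  induction m with
  | zero => exact ⟨rayTo_zero _ _ _, hξ⟩
  | succ m ih =>
    refine ⟨by rw [rayTo_of_adj hT (ha.adj m).symm ih.2, ih.1], ?_⟩
    rw [rayTo_one_of_ne hT (ha.adj m).symm ih.2]
    intro h
    have := ha.toRay.inj (a₁ := m) (a₂ := m + 1 + 1) h
    omega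

theorem measure_exterior (hμ : IsPattersonSullivan Γ δ μ) (m : ℕ) :
    μ (a m).fst (exterior hT a) = edgeFactor δ ^ m * μ (a 0).fst (exterior hT a) :=
  measure_path hT hμ (measurableSet_exterior hT)
    fun _ hξ => (ha.rayTo_of_mem_exterior hT hξ m).1

theorem measure_smul_exterior (hμ : IsPattersonSullivan Γ δ μ) {m : ℕ} {h : Γ}
    (hh : h • (a m).fst = (a m).fst) :
    μ (a m).fst ((fun ξ => h⁻¹ • ξ) ⁻¹' exterior hT a) =
      edgeFactor δ ^ m * μ (a 0).fst (exterior hT a) := by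
  rw [← measure_smul hT hμ h⁻¹ _ (measurableSet_exterior hT), inv_smul_eq_iff.2 hh.symm,
    ha.measure_exterior hT hμ]

/-- A ray that does not go up descends to a translate of the origin of the cuspidal ray, where it
must leave the horoball since it cannot backtrack. -/
theorem not_up_subset (m : ℕ) : {ξ : Boundary G | rayTo hT (a m).fst ξ 1 ≠ (a (m + 1)).fst} ⊆
    ⋃ h : MulAction.stabilizer Γ (a m).fst, (fun ξ => h.1⁻¹ • ξ) ⁻¹' exterior hT a := by
  intro ξ hξ
  obtain ⟨h, h1, h2, h3⟩ := ha.descend_ray hT m ξ hξ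
  refine Set.mem_iUnion.2 ⟨⟨h, h1⟩, ?_⟩
  change rayTo hT (a 0).fst (h⁻¹ • ξ) 1 ≠ (a 1).fst
  intro hcon
  have h4 : rayTo hT (h • (a 0).fst) ξ 1 = h • (a 1).fst := by
    rw [← hcon, ← rayTo_smul', smul_inv_smul]
  cases m with
  | zero => exact hξ (by rw [← h2, ← h4, h1])
  | succ m =>
    have e1 := h3 (m + 1) le_rfl
    have e2 := h3 m (by omega)
    rw [Nat.sub_self] at e1
    rw [Nat.add_sub_cancel_left] at e2
    have := rayTo_add hT (a (m + 1)).fst ξ (m + 1) 1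
    rw [e1, h4, ← e2] at this
    exact (rayTo hT (a (m + 1)).fst ξ).ne_add_two m this

include hT in
-- The stabiliser acts freely on the orbit of the origin of the cuspidal ray, which lies at distance
-- `m` from the fixed vertex.
theorem tsum_stabilizer_le (htriv : ∀ γ : Γ, γ • (a 0).fst = (a 0).fst → γ = 1) (m : ℕ) :
    ∑' _ : MulAction.stabilizer Γ (a m).fst, (1 : ℝ≥0∞) ≤ ballSup G m := by
  have hinj : Function.Injective fun h : MulAction.stabilizer Γ (a m).fst => h.1 • (a 0).fst := by
    intro h h' e
    refine Subtype.ext (inv_mul_eq_one.1 (htriv (h'.1⁻¹ * h.1) ?_)).symm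
    rw [mul_smul]
    exact inv_smul_eq_iff.2 e
  refine le_trans ?_ (ballCount_le (a m).fst m)
  refine le_trans (ENNReal.tsum_le_tsum fun h => ?_) (ENNReal.tsum_comp_le_tsum_of_injective hinj _)
  have h1 : h.1 • (a m).fst = (a m).fst := h.2
  have h2 := dist_smul' hT h.1 (a m).fst (a 0).fst
  have h3 := ha.dist_fst hT 0 m
  rw [zero_add, SimpleGraph.dist_comm] at h3
  rw [h1, h3] at h2
  simp [h2]

theorem measure_not_up_le [Countable Γ] (hμ : IsPattersonSullivan Γ δ μ)
    (htriv : ∀ γ : Γ, γ • (a 0).fst = (a 0).fst → γ = 1) (m : ℕ) :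
    μ (a m).fst {ξ : Boundary G | rayTo hT (a m).fst ξ 1 ≠ (a (m + 1)).fst} ≤
      ballSup G m * (edgeFactor δ ^ m * μ (a 0).fst (exterior hT a)) := by
  refine (measure_mono (ha.not_up_subset hT m)).trans ((measure_iUnion_le _).trans ?_)
  calc _ = ∑' _ : MulAction.stabilizer Γ (a m).fst,
        1 * (edgeFactor δ ^ m * μ (a 0).fst (exterior hT a)) :=
        tsum_congr fun h => by rw [ha.measure_smul_exterior hT hμ h.2, one_mul]
    _ ≤ _ := by rw [ENNReal.tsum_mul_right]; gcongr; exact ha.tsum_stabilizer_le hT htriv m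

/-- Translates of the exterior of a horoball by different elements of the stabiliser are disjoint. -/
theorem tsum_stabilizer_mul_le [Countable Γ] (hμ : IsPattersonSullivan Γ δ μ)
    (htriv : ∀ γ : Γ, γ • (a 0).fst = (a 0).fst → γ = 1) (m : ℕ) :
    (∑' _ : MulAction.stabilizer Γ (a m).fst, (1 : ℝ≥0∞)) *
      (edgeFactor δ ^ m * μ (a 0).fst (exterior hT a)) ≤ μ (a m).fst Set.univ := by
  rw [← ENNReal.tsum_mul_right]
  let E : MulAction.stabilizer Γ (a m).fst → Set (Boundary G) :=
    fun h => (fun ξ => h.1⁻¹ • ξ) ⁻¹' exterior hT a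
  have hE : ∀ h, MeasurableSet (E h) := fun h =>
    measurable_smul_boundary hT (h.1⁻¹ : Γ).1 (measurableSet_exterior hT)
  have hray : ∀ h, ∀ ξ ∈ E h, rayTo hT (a m).fst ξ m = h.1 • (a 0).fst := by
    intro h ξ hξ
    have h1 := (ha.rayTo_of_mem_exterior hT hξ m).1
    have h2 : h.1 • (a m).fst = (a m).fst := h.2
    simp only at h1
    rw [← h1, ← rayTo_smul', smul_inv_smul, h2]
  have hdisj : Pairwise (Function.onFun Disjoint E) := by
    intro h h' hhh
    refine Set.disjoint_left.2 fun ξ h1 h2 => hhh ?_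
    have e := (hray h ξ h1).symm.trans (hray h' ξ h2)
    refine Subtype.ext (inv_mul_eq_one.1 (htriv (h'.1⁻¹ * h.1) ?_)).symm
    rw [mul_smul]
    exact inv_smul_eq_iff.2 e
  calc _ = ∑' h, μ (a m).fst (E h) :=
        tsum_congr fun h => by rw [ha.measure_smul_exterior hT hμ h.2, one_mul]
    _ = μ (a m).fst (⋃ h, E h) := (measure_iUnion hdisj hE).symm
    _ ≤ _ := measure_mono (Set.subset_univ _)

end IsCuspidalRay

end TreeFlow

namespace TreeFlow

variable {V : Type*} {G : SimpleGraph V} {Γ : Subgroup (G ≃g G)} {δ : ℝ}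
  {μ : V → Measure (Boundary G)}

/-! ### Positivity of the dimension, absence of atoms at the cusps, exponential decay -/

theorem edgeFactor_add (s t : ℝ) : edgeFactor (s + t) = edgeFactor s * edgeFactor t := by
  rw [edgeFactor, edgeFactor, edgeFactor, ← ENNReal.ofReal_mul (Real.exp_pos _).le, ← Real.exp_add,
    neg_add]

theorem edgeFactor_lt {s t : ℝ} (h : s < t) : edgeFactor t < edgeFactor s :=
  (ENNReal.ofReal_lt_ofReal_iff (Real.exp_pos _)).2 (Real.exp_lt_exp.2 (neg_lt_neg h))

theorem edgeFactor_lt_one {s : ℝ} (h : 0 < s) : edgeFactor s < 1 := by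
  refine (edgeFactor_lt h).trans_le ?_
  simp [edgeFactor]

namespace IsCuspidalRay

variable {a : ℕ → G.Dart} (ha : IsCuspidalRay Γ a)
include ha

theorem stabilizer_le {m n : ℕ} (hmn : m ≤ n) :
    MulAction.stabilizer Γ (a (m + 1)).fst ≤ MulAction.stabilizer Γ (a (n + 1)).fst :=
  fun _ hγ => ha.smul_eq_of_le hγ (ha.smul_succ hγ) (by omega)

theorem exists_le_encard_stabilizer (hT : G.IsTree) (hmin : IsMinimal Γ) (k : ℕ) :
    ∃ m, (k : ℕ∞) ≤ (MulAction.stabilizer Γ (a (m + 1)).fst : Set Γ).encard := by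
  induction k with
  | zero => exact ⟨0, by simp⟩
  | succ k ih =>
    obtain ⟨m, hm⟩ := ih
    obtain ⟨n, hn, γ, h1, h2⟩ := exists_stabilizer_growth hT hmin ha (m + 1)
    obtain ⟨n, rfl⟩ := Nat.exists_eq_add_of_le' (show 1 ≤ n by omega)
    refine ⟨n + 1, ?_⟩
    calc ((k + 1 : ℕ) : ℕ∞) ≤ (MulAction.stabilizer Γ (a (n + 1)).fst : Set Γ).encard + 1 := by
          push_cast
          gcongr
          exact hm.trans (Set.encard_le_encard (ha.stabilizer_le (by omega)))
      _ = (insert γ (MulAction.stabilizer Γ (a (n + 1)).fst : Set Γ)).encard :=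
          (Set.encard_insert_of_notMem
          (s := (MulAction.stabilizer Γ (a (n + 1)).fst : Set Γ)) h2).symm
      _ ≤ _ := Set.encard_le_encard
          (Set.insert_subset h1 (ha.stabilizer_le (Nat.le_succ n)))

theorem measure_exterior_pos (hT : G.IsTree) (hμ : IsPattersonSullivan Γ δ μ)
    (hne : NonElementary Γ) (hmin : IsMinimal Γ) (x : V) : 0 < μ x (exterior hT a) := by
  rw [ha.exterior_eq_shadow hT]
  exact measure_shadow_pos hT hμ hne hmin x _

/-- In dimension 0 all the measures coincide, and the disjoint translates of the exterior by the
stabilisers along the cusp all have the same positive mass, although their number is unbounded. -/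
theorem dimension_ne_zero [Countable Γ] (hT : G.IsTree) (hμ : IsPattersonSullivan Γ δ μ)
    (hne : NonElementary Γ) (hmin : IsMinimal Γ)
    (htriv : ∀ γ : Γ, γ • (a 0).fst = (a 0).fst → γ = 1) : δ ≠ 0 := by
  rintro rfl
  have hfin := hμ.finite (a 0).fst
  have hconst : ∀ x, μ x = μ (a 0).fst := fun x => by
    rw [hμ.conformal x (a 0).fst]
    simp
  have hA := ha.measure_exterior_pos hT hμ hne hmin (a 0).fst
  have hquot : μ (a 0).fst Set.univ / μ (a 0).fst (exterior hT a) < ⊤ :=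
    ENNReal.div_lt_top (measure_ne_top _ _) hA.ne'
  obtain ⟨k, hk⟩ := ENNReal.exists_nat_gt hquot.ne
  obtain ⟨m, hm⟩ := ha.exists_le_encard_stabilizer hT hmin k
  have h1 := ha.tsum_stabilizer_mul_le hT hμ htriv (m + 1)
  have h2 : ∑' _ : MulAction.stabilizer Γ (a (m + 1)).fst, (1 : ℝ≥0∞) =
      ((MulAction.stabilizer Γ (a (m + 1)).fst : Set Γ).encard : ℝ≥0∞) :=
    ENNReal.tsum_set_one (MulAction.stabilizer Γ (a (m + 1)).fst : Set Γ)
  have h3 : edgeFactor 0 = 1 := by simp [edgeFactor]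
  rw [h2, h3, one_pow, one_mul, hconst (a (m + 1)).fst] at h1
  have h4 : (k : ℝ≥0∞) ≤ ((MulAction.stabilizer Γ (a (m + 1)).fst : Set Γ).encard : ℝ≥0∞) := by
    exact_mod_cast ENat.toENNReal_le.2 hm
  refine absurd (hk.trans_le h4) (not_lt.2 ?_)
  exact (ENNReal.le_div_iff_mul_le (Or.inl hA.ne') (Or.inl (measure_ne_top _ _))).2 h1

theorem rayTo_lim (hT : G.IsTree) (m n : ℕ) :
    rayTo hT (a m).fst ha.toRay.lim n = (a (m + n)).fst := by
  rw [rayTo_eq hT (r := ha.toRay.drop m) (x := (a m).fst) rfl (Ray.lim_drop _ _)]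
  rfl

/-- The elements for which the geodesic from `b` enters the translated horoball through its base. -/
def entries (G : SimpleGraph V) (Γ : Subgroup (G ≃g G)) (a : ℕ → G.Dart) (b : V) : Set Γ :=
  {γ | G.dist b (γ • (a 1).fst) = G.dist b (γ • (a 0).fst) + 1}

/-- The geodesic from `b` to a point of the orbit enters the horoball at some translate of the
origin, climbs j levels and descends j. There are at most `ballSup G j` such points for each entry
and each j, with weight y^{2j} relative to the entry. -/
theorem tsum_orbit_le (hT : G.IsTree) {b : V} (hb : ∀ n, ∀ γ : Γ, γ • (a (n + 1)).fst ≠ b)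
    (htriv : ∀ γ : Γ, γ • (a 0).fst = (a 0).fst → γ = 1) (y : ℝ≥0∞) :
    ∑' γ : Γ, y ^ G.dist b (γ • (a 0).fst) ≤
      (∑' γ : entries G Γ a b, y ^ G.dist b (γ.1 • (a 0).fst)) * ballSeries G (y ^ 2) := by
  classical
  have hinj : Function.Injective fun γ : Γ => γ • (a 0).fst := fun γ γ' h =>
    (inv_mul_eq_one.1 (htriv (γ'⁻¹ * γ) (by rw [mul_smul]; exact inv_smul_eq_iff.2 h))).symm
  let w : entries G Γ a b × ℕ → ℝ≥0∞ := fun p => y ^ G.dist b (p.1.1 • (a 0).fst) * (y ^ 2) ^ p.2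
  let c : entries G Γ a b × ℕ → V := fun p => p.1.1 • (a p.2).fst
  have hv : ∀ γ : Γ, y ^ G.dist b (γ • (a 0).fst) ≤
      ∑' p, (if G.dist (c p) (γ • (a 0).fst) ≤ p.2 then 1 else 0) * w p := by
    intro γ
    obtain ⟨j, γ', h1, h2, h3⟩ := ha.exists_entry hT hb γ 0
    refine le_trans ?_ (ENNReal.le_tsum (⟨γ', h3⟩, j))
    have h4 := ha.dist_fst hT 0 j
    rw [zero_add] at h1 h4
    have h5 : G.dist (c (⟨γ', h3⟩, j)) (γ • (a 0).fst) ≤ j := by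
      simp only [c]
      rw [h1, dist_smul' hT, SimpleGraph.dist_comm, h4]
    simp only at h5 ⊢
    rw [if_pos h5, one_mul, h2]
    simp only [w]
    rw [add_zero, pow_add, pow_mul]
  calc _ ≤ ∑' γ : Γ, ∑' p, (if G.dist (c p) (γ • (a 0).fst) ≤ p.2 then 1 else 0) * w p :=
        ENNReal.tsum_le_tsum hv
    _ = ∑' p, (∑' γ : Γ, if G.dist (c p) (γ • (a 0).fst) ≤ p.2 then 1 else 0) * w p := by
        rw [ENNReal.tsum_comm]
        exact tsum_congr fun p => ENNReal.tsum_mul_right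
    _ ≤ ∑' p, ballSup G p.2 * w p := ENNReal.tsum_le_tsum fun p => by
        refine mul_le_mul_left (le_trans ?_ (ballCount_le (c p) p.2)) _
        exact ENNReal.tsum_comp_le_tsum_of_injective hinj fun v =>
          if G.dist (c p) v ≤ p.2 then (1 : ℝ≥0∞) else 0
    _ = ∑' p : entries G Γ a b × ℕ,
          y ^ G.dist b (p.1.1 • (a 0).fst) * (ballSup G p.2 * (y ^ 2) ^ p.2) :=
        tsum_congr fun p => by simp only [w]; ring
    _ = _ := by
        simp_rw [ENNReal.tsum_prod', ENNReal.tsum_mul_left, ENNReal.tsum_mul_right]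
        rfl

theorem measurableSet_singleton_lim (hT : G.IsTree) : MeasurableSet {ha.toRay.lim} := by
  have : ({ha.toRay.lim} : Set (Boundary G)) =
      ⋂ n, {ξ | rayTo hT (a 0).fst ξ n = (a n).fst} := by
    ext ξ
    simp only [Set.mem_singleton_iff, Set.mem_iInter, Set.mem_ofPred_eq]
    refine ⟨?_, fun h => ?_⟩
    · rintro rfl n
      rw [ha.rayTo_lim hT, zero_add]
    · refine eq_of_rayTo_eq hT (x := (a 0).fst) fun n => ?_
      rw [h, ha.rayTo_lim hT, zero_add]
  rw [this]
  exact MeasurableSet.iInter fun n => measurableSet_rayTo_eq hT _ _ _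

/-- From an entry on, the ray from `b` follows the translated cuspidal ray. So the translate of its
end has the mass of the original end times p to the distance of the entry, and different entries
give different ends. -/
theorem tsum_entries_mul_le [Countable Γ] (hT : G.IsTree) (hμ : IsPattersonSullivan Γ δ μ) (b : V)
    (htriv : ∀ γ : Γ, γ • (a 0).fst = (a 0).fst → γ = 1) :
    (∑' γ : entries G Γ a b, edgeFactor δ ^ G.dist b (γ.1 • (a 0).fst)) *
      μ (a 0).fst {ha.toRay.lim} ≤ μ b Set.univ := by
  rw [← ENNReal.tsum_mul_right]
  have hray : ∀ γ : entries G Γ a b, ∀ n,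
      rayTo hT b (γ.1 • ha.toRay.lim) (G.dist b (γ.1 • (a 0).fst) + n) = γ.1 • (a n).fst :=
    fun γ n => rayTo_of_dist_one hT (r := γ.1.1 • ha.toRay) γ.2 n
  let E : entries G Γ a b → Set (Boundary G) := fun γ =>
    (fun ξ => γ.1⁻¹ • ξ) ⁻¹' {ha.toRay.lim}
  have hmem : ∀ γ, ∀ ξ ∈ E γ, ξ = γ.1 • ha.toRay.lim := fun γ ξ h => inv_smul_eq_iff.1 h
  have hE : ∀ γ, MeasurableSet (E γ) := fun γ =>
    measurable_smul_boundary hT (γ.1⁻¹ : Γ).1 (ha.measurableSet_singleton_lim hT)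
  have hdisj : Pairwise (Function.onFun Disjoint E) := by
    -- If the ends agree, both translated rays lie on one ray from `b`; levels are distinct modulo
    -- the group, so the origins coincide, and their stabiliser is trivial.
    have key : ∀ γ γ' : entries G Γ a b,
        G.dist b (γ.1 • (a 0).fst) ≤ G.dist b (γ'.1 • (a 0).fst) →
        γ.1 • ha.toRay.lim = γ'.1 • ha.toRay.lim → γ = γ' := by
      intro γ γ' hle h
      obtain ⟨k, hk⟩ := Nat.exists_eq_add_of_le hle
      have h1 := hray γ k
      have h2 := hray γ' 0
      rw [add_zero, ← h, hk, h1] at h2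
      have h3 : (γ'.1⁻¹ * γ.1) • (a k).fst = (a 0).fst := by
        rw [mul_smul]; exact inv_smul_eq_iff.2 h2
      obtain rfl := ha.injective _ _ _ h3
      exact Subtype.ext (inv_mul_eq_one.1 (htriv _ h3)).symm
    intro γ γ' hne
    refine Set.disjoint_left.2 fun ξ h1 h2 => hne ?_
    have e := (hmem γ ξ h1).symm.trans (hmem γ' ξ h2)
    rcases le_total (G.dist b (γ.1 • (a 0).fst)) (G.dist b (γ'.1 • (a 0).fst)) with h | h
    · exact key γ γ' h e
    · exact (key γ' γ h e.symm).symm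
  calc _ = ∑' γ, μ b (E γ) := tsum_congr fun γ => by
        rw [measure_path hT hμ (hE γ) (y := γ.1 • (a 0).fst) (n := G.dist b (γ.1 • (a 0).fst)),
          measure_smul hT hμ γ.1 _ (hE γ)]
        · congr 2
          ext ξ
          simp [E]
        · intro ξ hξ
          rw [hmem γ ξ hξ]
          exact hray γ 0
    _ = μ b (⋃ γ, E γ) := (measure_iUnion hdisj hE).symm
    _ ≤ _ := measure_mono (Set.subset_univ _)

end IsCuspidalRay

namespace CuspidalDecomposition

variable {D : CuspidalDecomposition Γ}

theorem coreSeries_lt_top_of_orbit (hT : G.IsTree) (b w : V) {y : ℝ≥0∞} (hy0 : y ≠ 0) (hy : y ≤ 1)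
    (h : ∑' γ : Γ, y ^ G.dist b (γ • w) < ⊤) : D.coreSeries b y < ⊤ := by
  obtain ⟨Y, hY, _, hrep⟩ := D.exists_reps
  have := hY.fintype
  have hyt : y ≠ ⊤ := (hy.trans_lt ENNReal.one_lt_top).ne
  choose g u hu hgu using hrep
  have hinj : Function.Injective fun v : D.coreVertices =>
      ((⟨u v.1 v.2, hu v.1 v.2⟩, g v.1 v.2) : Y × Γ) := by
    intro v v' h
    simp only [Prod.mk.injEq, Subtype.mk.injEq] at h
    refine Subtype.ext ?_
    rw [← hgu v.1 v.2, ← hgu v'.1 v'.2, h.1, h.2]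
  calc D.coreSeries b y = ∑' v : D.coreVertices, y ^ G.dist b (g v.1 v.2 • u v.1 v.2) :=
        tsum_congr fun v => by rw [hgu]
    _ ≤ ∑' p : Y × Γ, y ^ G.dist b (p.2 • p.1.1) :=
        ENNReal.tsum_comp_le_tsum_of_injective hinj fun p => y ^ G.dist b (p.2 • p.1.1)
    _ = ∑ x : Y, ∑' γ : Γ, y ^ G.dist b (γ • x.1) := by rw [ENNReal.tsum_prod', tsum_fintype]
    _ < ⊤ := ENNReal.sum_lt_top.2 fun x _ => by
        have h1 : y ^ G.dist x.1 w * ∑' γ : Γ, y ^ G.dist b (γ • x.1) < ⊤ := by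
          refine lt_of_le_of_lt ?_ h
          rw [← ENNReal.tsum_mul_left]
          refine ENNReal.tsum_le_tsum fun γ => ?_
          rw [← pow_add]
          refine pow_le_pow_of_le_one zero_le hy ?_
          have := hT.connected.dist_triangle (u := b) (v := γ • x.1) (w := γ • w)
          rw [dist_smul' hT] at this
          omega
        by_contra hcon
        rw [not_lt_top_iff] at hcon
        rw [hcon, ENNReal.mul_top (pow_ne_zero _ hy0)] at h1
        exact lt_irrefl _ h1

variable (htriv : ∀ v ∈ D.coreVertices, ∀ γ : Γ, γ • v = v → γ = 1)
include htriv

/-- The ends of the cuspidal rays are not atoms. -/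
theorem measure_lim_eq_zero [Countable Γ] (hT : G.IsTree)
    (hlf : ∀ v : V, (G.neighborSet v).Finite) (hu : IsUniform G) (hne : NonElementary Γ)
    (hmin : IsMinimal Γ) (x : V) (hμ : IsPattersonSullivan Γ (criticalExponent Γ x).toReal μ)
    (hδ : 0 < (criticalExponent Γ x).toReal) (i : Fin D.r) :
    μ (D.ray i 0).fst {(D.cuspidal i).toRay.lim} = 0 := by
  set δ := (criticalExponent Γ x).toReal
  by_contra hα
  set b := (D.ray i 0).fst
  have hb : b ∈ D.coreVertices := D.base_mem_core i
  have := hμ.finite b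
  set p := edgeFactor δ
  have hp0 : p ≠ 0 := edgeFactor_ne_zero δ
  have hp1 : p < 1 := edgeFactor_lt_one hδ
  have hlt : ∀ y < p, D.coreSeries b y < ⊤ := fun y hy =>
    coreSeries_lt_top hT hlf hμ hne hmin b hy
  -- As δ > 0, the number p² is smaller than p and lies in the known range of convergence.
  have hsq : ballSeries G (p ^ 2) < ⊤ := by
    refine ballSeries_lt_top htriv hT hlf hu hb hp1.le hlt ?_
    rw [sq]
    calc p * p < 1 * p := ENNReal.mul_lt_mul_left hp0 (edgeFactor_ne_top δ) hp1
      _ = p := one_mul p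
  -- A positive atom forces the sum over the entries to be finite.
  have hent : ∑' γ : IsCuspidalRay.entries G Γ (D.ray i) b, p ^ G.dist b (γ.1 • b) < ⊤ := by
    have h1 := (D.cuspidal i).tsum_entries_mul_le hT hμ b (htriv b hb)
    by_contra hcon
    rw [not_lt_top_iff] at hcon
    rw [hcon, ENNReal.top_mul hα] at h1
    exact absurd (h1.trans_lt (measure_lt_top _ _)) (lt_irrefl _)
  have horb : ∑' γ : Γ, p ^ G.dist b (γ • b) < ⊤ :=
    ((D.cuspidal i).tsum_orbit_le hT (fun n γ => hb i n γ) (htriv b hb) p).trans_lt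
      (ENNReal.mul_lt_top hent hsq)
  -- Convergence along the orbit at p passes to the core and then to the tree, contradicting
  -- divergence at the critical exponent.
  have := ballSeries_lt_top_of_sq htriv hT hu hb hp0 hp1
    (coreSeries_lt_top_of_orbit hT b b hp0 hp1.le horb) hsq
  rw [ballSeries_eq_top htriv hT hlf hu x hδ] at this
  exact lt_irrefl _ this

/-- Exponential decay of the mass of the geodesics that climb `n` levels into a cusp. -/
theorem exists_horoball_bound [Countable Γ] (hT : G.IsTree)
    (hlf : ∀ v : V, (G.neighborSet v).Finite) (hu : IsUniform G) (hne : NonElementary Γ)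
    (hmin : IsMinimal Γ) (x : V) (hμ : IsPattersonSullivan Γ (criticalExponent Γ x).toReal μ)
    (i : Fin D.r) : ∃ C < (⊤ : ℝ≥0∞), ∃ ρ < (1 : ℝ≥0∞), ∀ n,
      μ (D.ray i n).fst (IsCuspidalRay.exterior hT (D.ray i)) *
        μ (D.ray i n).fst {ξ | rayTo hT (D.ray i n).fst ξ 1 = (D.ray i (n + 1)).fst} ≤
      C * ρ ^ n := by
  have hb : (D.ray i 0).fst ∈ D.coreVertices := D.base_mem_core i
  have ha := D.cuspidal i
  have htr := htriv _ hb
  have hδ : 0 < (criticalExponent Γ x).toReal := lt_of_le_of_ne ENNReal.toReal_nonneg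
    (ha.dimension_ne_zero hT hμ hne hmin htr).symm
  have hatom := measure_lim_eq_zero htriv hT hlf hu hne hmin x hμ hδ i
  set δ := (criticalExponent Γ x).toReal
  set a := D.ray i
  set A := μ (a 0).fst (IsCuspidalRay.exterior hT a)
  set p := edgeFactor δ
  -- The factor p² is split as y ρ: y < p keeps the ball series finite, and ρ < 1 is left over as
  -- the rate of decay.
  set y := edgeFactor (3 * δ / 2)
  set ρ := edgeFactor (δ / 2)
  have hp2 : p * p = y * ρ := by
    rw [← edgeFactor_add, ← edgeFactor_add]
    congr 1
    ring
  have := hμ.finite (a 0).fst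
  have hy : ballSeries G y < ⊤ := ballSeries_lt_top htriv hT hlf hu hb (edgeFactor_lt_one hδ).le
    (fun z hz => coreSeries_lt_top hT hlf hμ hne hmin _ hz) (edgeFactor_lt (by linarith))
  have hρ : ρ < 1 := edgeFactor_lt_one (by linarith)
  refine ⟨A * A * ballSeries G y, ENNReal.mul_lt_top
    (ENNReal.mul_lt_top (measure_lt_top _ _) (measure_lt_top _ _)) hy, ρ, hρ, fun n => ?_⟩
  rw [ha.measure_exterior hT hμ]
  -- The ends whose ray climbs exactly `k` levels above level n before turning.
  let S : ℕ → Set (Boundary G) := fun k => {ξ | rayTo hT (a n).fst ξ k = (a (n + k)).fst ∧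
    rayTo hT (a (n + k)).fst ξ 1 ≠ (a (n + k + 1)).fst}
  have hS : ∀ k, MeasurableSet (S k) := fun k =>
    (measurableSet_rayTo_eq hT _ _ _).inter (measurableSet_rayTo_eq hT _ _ _).compl
  have hzero : μ (a n).fst {ha.toRay.lim} = 0 := by
    have h1 := measure_path hT hμ (x := (a 0).fst) (n := n) (y := (a n).fst)
      (ha.measurableSet_singleton_lim hT) (by
        rintro ξ rfl
        rw [ha.rayTo_lim hT, zero_add])
    rw [hatom] at h1
    exact (mul_eq_zero.1 h1.symm).resolve_left (pow_ne_zero _ (edgeFactor_ne_zero δ))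
  have hcov : {ξ | rayTo hT (a n).fst ξ 1 = (a (n + 1)).fst} ⊆ {ha.toRay.lim} ∪ ⋃ k, S k := by
    intro ξ _
    by_contra hcon
    simp only [Set.mem_union, Set.mem_singleton_iff, Set.mem_iUnion, not_or, not_exists] at hcon
    refine hcon.1 (eq_of_rayTo_eq hT (x := (a n).fst) fun k => ?_)
    rw [ha.rayTo_lim hT]
    induction k with
    | zero => rw [rayTo_zero, add_zero]
    | succ k ih =>
      rw [rayTo_add, ih]
      by_contra h
      exact hcon.2 k ⟨ih, h⟩
  -- The base point is moved up to the level n + k of the turn, and then the translates of the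
  -- exterior are counted.
  have hSle : ∀ k, μ (a n).fst (S k) ≤ p ^ k * (ballSup G (n + k) * (p ^ (n + k) * A)) := by
    intro k
    rw [measure_path hT hμ (hS k) fun ξ hξ => hξ.1]
    gcongr
    exact (measure_mono fun ξ hξ => hξ.2).trans (ha.measure_not_up_le hT hμ htr (n + k))
  calc p ^ n * A * μ (a n).fst {ξ | rayTo hT (a n).fst ξ 1 = (a (n + 1)).fst}
      ≤ p ^ n * A * ∑' k, p ^ k * (ballSup G (n + k) * (p ^ (n + k) * A)) := by
        gcongr
        refine (measure_mono hcov).trans ((measure_union_le _ _).trans ?_)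
        rw [hzero, zero_add]
        exact (measure_iUnion_le _).trans (ENNReal.tsum_le_tsum hSle)
    _ = ∑' k, A * A * (ballSup G (n + k) * y ^ (n + k)) * (ρ ^ n * ρ ^ k) := by
        rw [← ENNReal.tsum_mul_left]
        refine tsum_congr fun k => ?_
        calc _ = A * A * ballSup G (n + k) * (p * p) ^ (n + k) := by ring
          _ = _ := by rw [hp2]; ring
    _ ≤ ∑' k, A * A * (ballSup G (n + k) * y ^ (n + k)) * ρ ^ n := by
        refine ENNReal.tsum_le_tsum fun k => ?_
        gcongr
        exact (mul_le_mul_right (pow_le_one₀ zero_le hρ.le) _).trans_eq (mul_one _)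
    _ = A * A * (∑' k, ballSup G (n + k) * y ^ (n + k)) * ρ ^ n := by
        rw [ENNReal.tsum_mul_right, ENNReal.tsum_mul_left]
    _ ≤ _ := by
        gcongr
        exact ENNReal.tsum_comp_le_tsum_of_injective (add_right_injective n)
          fun m => ballSup G m * y ^ m

end CuspidalDecomposition

end TreeFlow

namespace TreeFlow

variable {V : Type*} {G : SimpleGraph V} {Γ : Subgroup (G ≃g G)}

/-! ### Sums over the letters -/

/-- This is log u ≤ u - 1 at u = 1/√t, multiplied by 2t; the square root preserves exponential
decay. -/
theorem ofReal_negMulLog_le (t : ℝ≥0∞) :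
    ENNReal.ofReal (Real.negMulLog t.toReal) ≤ 2 * t ^ (1 / 2 : ℝ) := by
  rcases eq_or_ne t ⊤ with rfl | ht
  · simp
  · obtain ⟨x, hx, rfl⟩ : ∃ x : ℝ, 0 ≤ x ∧ t = ENNReal.ofReal x :=
      ⟨t.toReal, ENNReal.toReal_nonneg, (ENNReal.ofReal_toReal ht).symm⟩
    rw [ENNReal.toReal_ofReal hx, ENNReal.ofReal_rpow_of_nonneg hx (by norm_num),
      ← ENNReal.ofReal_ofNat, ← ENNReal.ofReal_mul (by norm_num), ← Real.sqrt_eq_rpow]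
    refine ENNReal.ofReal_le_ofReal ?_
    rcases hx.eq_or_lt with rfl | h0
    · simp
    · have hs := Real.sqrt_pos.2 h0
      have h1 := Real.log_le_sub_one_of_pos (inv_pos.2 hs)
      rw [Real.log_inv, Real.log_sqrt hx] at h1
      have h2 : x * (√x)⁻¹ = √x := by
        nth_rewrite 1 [← Real.mul_self_sqrt hx]
        rw [mul_assoc, mul_inv_cancel₀ hs.ne', mul_one]
      have h3 : x * -(Real.log x / 2) ≤ x * ((√x)⁻¹ - 1) := mul_le_mul_of_nonneg_left h1 hx
      rw [mul_sub, h2] at h3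
      rw [Real.negMulLog]
      linarith

theorem tsum_one_le_ballSup {α : Type*} {f : α → V} (hf : Function.Injective f) {x : V} {n : ℕ}
    (h : ∀ a, G.dist x (f a) ≤ n) : ∑' _ : α, (1 : ℝ≥0∞) ≤ ballSup G n := by
  refine le_trans ?_ (ballCount_le x n)
  refine le_trans (ENNReal.tsum_le_tsum fun a => ?_) (ENNReal.tsum_comp_le_tsum_of_injective hf _)
  rw [if_pos (h a)]

namespace CodingData

variable (D : CodingData Γ)

theorem finite_edgeLift (hlf : ∀ v : V, (G.neighborSet v).Finite) : Finite D.edgeLift := by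
  obtain ⟨Y, hY, _, hrep⟩ := D.exists_reps
  have := (finite_darts hY hlf).to_subtype
  choose g u hu hgu using fun d : D.edgeLift => hrep _ (D.fst_mem_core (D.edgeLift_core d.2))
  refine Finite.of_injective (β := {d : G.Dart | d.fst ∈ Y}) (fun d => ⟨(g d)⁻¹ • d.1, ?_⟩) ?_
  · change (g d)⁻¹ • d.1.fst ∈ Y
    rw [← hgu d, inv_smul_smul]
    exact hu d
  · intro d d' h
    have h1 : (g d)⁻¹ • d.1 = (g d')⁻¹ • d'.1 := congrArg Subtype.val h
    obtain ⟨e, _, he⟩ := D.edgeLift_unique d'.1 (D.edgeLift_core d'.2)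
    exact Subtype.ext ((he d.1 ⟨d.2, g d' * (g d)⁻¹, by rw [mul_smul, h1, smul_inv_smul]⟩).trans
      (he d'.1 ⟨d'.2, 1, one_smul _ _⟩).symm)

theorem dist_smul_ray_le (hT : G.IsTree) {i : Fin D.r} {n : ℕ} {g : Γ}
    (hg : g ∈ D.cuspGroup i (n + 1)) :
    G.dist (D.ray i (n + 1)).fst (g • (D.ray i n).fst) ≤ 1 := by
  have h : g • (D.ray i (n + 1)).fst = (D.ray i (n + 1)).fst := hg
  have h1 := (D.cuspidal i).dist_fst hT n 1
  nth_rewrite 1 [← h]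
  rw [dist_smul' hT, SimpleGraph.dist_comm, h1]

/-- The cosets inject into the neighbours of the vertex of level n + 1, so their number is bounded
independently of the level. -/
theorem tsum_turnUp_le (hT : G.IsTree) (i : Fin D.r) (n : ℕ) :
    ∑' _ : {q : Γ ⧸ D.cuspGroup i n //
      ∃ g, g ∈ D.cuspGroup i (n + 1) ∧ g ∉ D.cuspGroup i n ∧ QuotientGroup.mk g = q}, (1 : ℝ≥0∞) ≤
      ballSup G 1 := by
  refine tsum_one_le_ballSup (f := fun q => q.2.choose • (D.ray i n).fst) (fun q q' h => ?_)
    fun q => D.dist_smul_ray_le hT q.2.choose_spec.1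
  refine Subtype.ext (q.2.choose_spec.2.2.symm.trans
    ((QuotientGroup.eq.2 ?_).trans q'.2.choose_spec.2.2))
  exact MulAction.mem_stabilizer_iff.2 (by rw [mul_smul]; exact inv_smul_eq_iff.2 h.symm)

theorem tsum_turnDown_le (hT : G.IsTree) (i : Fin D.r) (n : ℕ) :
    ∑' _ : {q : Quotient (QuotientGroup.rightRel (D.cuspGroup i n)) //
      ∃ g, g ∈ D.cuspGroup i (n + 1) ∧ g ∉ D.cuspGroup i n ∧ Quotient.mk _ g = q}, (1 : ℝ≥0∞) ≤
      ballSup G 1 := by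
  refine tsum_one_le_ballSup (f := fun q => q.2.choose⁻¹ • (D.ray i n).fst) (fun q q' h => ?_)
    fun q => D.dist_smul_ray_le hT (inv_mem q.2.choose_spec.1)
  refine Subtype.ext (q.2.choose_spec.2.2.symm.trans
    ((Quotient.sound ?_).trans q'.2.choose_spec.2.2))
  exact QuotientGroup.rightRel_apply.2 (MulAction.mem_stabilizer_iff.2
    (by rw [mul_smul]; exact (eq_inv_smul_iff.1 h).symm ▸ rfl))

/-- `f` is at most `c` on the letters of level `n` of the `i`-th cuspidal ray. -/
structure LevelBound (f : D.Letter → ℝ≥0∞) (i : Fin D.r) (n : ℕ) (c : ℝ≥0∞) : Prop where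
  up : f (.up i n) ≤ c
  down : f (.down i n) ≤ c
  turnUp : ∀ q, f (.turnUp i n q) ≤ c
  turnDown : ∀ q, f (.turnDown i n q) ≤ c

/-- The letters as a disjoint union. -/
def letterOfSum : D.edgeLift ⊕ (Σ p : Fin D.r × ℕ, Unit ⊕ Unit ⊕ {q : Γ ⧸ D.cuspGroup p.1 p.2 //
        ∃ g, g ∈ D.cuspGroup p.1 (p.2 + 1) ∧ g ∉ D.cuspGroup p.1 p.2 ∧ QuotientGroup.mk g = q} ⊕
      {q : Quotient (QuotientGroup.rightRel (D.cuspGroup p.1 p.2)) //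
        ∃ g, g ∈ D.cuspGroup p.1 (p.2 + 1) ∧ g ∉ D.cuspGroup p.1 p.2 ∧ Quotient.mk _ g = q}) →
    D.Letter
  | .inl d => .core d
  | .inr ⟨p, .inl _⟩ => .up p.1 p.2
  | .inr ⟨p, .inr (.inl _)⟩ => .down p.1 p.2
  | .inr ⟨p, .inr (.inr (.inl q))⟩ => .turnUp p.1 p.2 q
  | .inr ⟨p, .inr (.inr (.inr q))⟩ => .turnDown p.1 p.2 q

theorem letterOfSum_surjective : Function.Surjective D.letterOfSum := by
  rintro (d | ⟨i, n⟩ | ⟨i, n⟩ | ⟨i, n, q⟩ | ⟨i, n, q⟩)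
  · exact ⟨.inl d, rfl⟩
  · exact ⟨.inr ⟨(i, n), .inl ()⟩, rfl⟩
  · exact ⟨.inr ⟨(i, n), .inr (.inl ())⟩, rfl⟩
  · exact ⟨.inr ⟨(i, n), .inr (.inr (.inl q))⟩, rfl⟩
  · exact ⟨.inr ⟨(i, n), .inr (.inr (.inr q))⟩, rfl⟩

theorem countable_letter [Countable Γ] (hlf : ∀ v : V, (G.neighborSet v).Finite) :
    Countable D.Letter := by
  have := D.finite_edgeLift hlf
  have (p : Fin D.r × ℕ) : Countable (Γ ⧸ D.cuspGroup p.1 p.2) := Quotient.countable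
  have (p : Fin D.r × ℕ) : Countable (Quotient (QuotientGroup.rightRel (D.cuspGroup p.1 p.2))) :=
    Quotient.countable
  have (p : Fin D.r × ℕ) : Countable (Unit ⊕ Unit ⊕ {q : Γ ⧸ D.cuspGroup p.1 p.2 //
        ∃ g, g ∈ D.cuspGroup p.1 (p.2 + 1) ∧ g ∉ D.cuspGroup p.1 p.2 ∧ QuotientGroup.mk g = q} ⊕
      {q : Quotient (QuotientGroup.rightRel (D.cuspGroup p.1 p.2)) //
        ∃ g, g ∈ D.cuspGroup p.1 (p.2 + 1) ∧ g ∉ D.cuspGroup p.1 p.2 ∧ Quotient.mk _ g = q}) :=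
    inferInstance
  exact D.letterOfSum_surjective.countable

theorem tsum_letter_le (f : D.Letter → ℝ≥0∞) :
    ∑' β, f β ≤ ∑' d, f (.core d) + ∑ i, ∑' n, (f (.up i n) + (f (.down i n) +
      (∑' q, f (.turnUp i n q) + ∑' q, f (.turnDown i n q)))) := by
  refine (ENNReal.tsum_le_tsum_comp_of_surjective D.letterOfSum_surjective f).trans_eq ?_
  rw [ENNReal.summable.tsum_sum ENNReal.summable, ENNReal.tsum_sigma', ENNReal.tsum_prod']
  congr 1
  rw [tsum_fintype]
  refine Finset.sum_congr rfl fun i _ => tsum_congr fun n => ?_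
  rw [ENNReal.summable.tsum_sum ENNReal.summable, ENNReal.summable.tsum_sum ENNReal.summable,
    ENNReal.summable.tsum_sum ENNReal.summable, tsum_fintype, tsum_fintype]
  simp [letterOfSum]

/-- The core letters and the cusps are finite in number, and each level has a bounded number of
letters, so a geometric bound on each level suffices. It is applied both to the masses and to the
entropy terms. -/
theorem tsum_letter_lt_top (hT : G.IsTree) (hlf : ∀ v : V, (G.neighborSet v).Finite)
    (hu : IsUniform G) {f : D.Letter → ℝ≥0∞} (hcore : ∀ d, f (.core d) < ⊤)
    (hf : ∀ i, ∃ C < (⊤ : ℝ≥0∞), ∃ ρ < (1 : ℝ≥0∞), ∀ n, D.LevelBound f i n (C * ρ ^ n)) :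
    ∑' β, f β < ⊤ := by
  have := D.finite_edgeLift hlf
  have := Fintype.ofFinite D.edgeLift
  refine (D.tsum_letter_le f).trans_lt (ENNReal.add_lt_top.2 ⟨?_, ?_⟩)
  · rw [tsum_fintype]
    exact ENNReal.sum_lt_top.2 fun d _ => hcore d
  · refine ENNReal.sum_lt_top.2 fun i _ => ?_
    obtain ⟨C, hC, ρ, hρ, h⟩ := hf i
    set N := ballSup G 1
    have hN : N < ⊤ := ballSup_lt_top hT hlf hu 1
    calc _ ≤ ∑' n, (1 + (1 + (N + N))) * C * ρ ^ n := by
          refine ENNReal.tsum_le_tsum fun n => ?_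
          have h1 : ∑' q, f (.turnUp i n q) ≤ N * (C * ρ ^ n) := by
            refine (ENNReal.tsum_le_tsum (h n).turnUp).trans ?_
            rw [← one_mul (C * ρ ^ n), ENNReal.tsum_mul_right, one_mul]
            exact mul_le_mul_left (D.tsum_turnUp_le hT i n) _
          have h2 : ∑' q, f (.turnDown i n q) ≤ N * (C * ρ ^ n) := by
            refine (ENNReal.tsum_le_tsum (h n).turnDown).trans ?_
            rw [← one_mul (C * ρ ^ n), ENNReal.tsum_mul_right, one_mul]
            exact mul_le_mul_left (D.tsum_turnDown_le hT i n) _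
          refine (add_le_add (h n).up (add_le_add (h n).down (add_le_add h1 h2))).trans_eq ?_
          ring
      _ = (1 + (1 + (N + N))) * C * (1 - ρ)⁻¹ := by
          rw [ENNReal.tsum_mul_left, ENNReal.tsum_geometric]
      _ < ⊤ := by
          refine ENNReal.mul_lt_top (ENNReal.mul_lt_top ?_ hC)
            (ENNReal.inv_lt_top.2 (tsub_pos_of_lt hρ))
          simp [hN]

/-! ### The masses of the pieces -/

variable {D} {μ : V → Measure (Boundary G)}

theorem ends_of_mem_upSet (hT : G.IsTree) {i : Fin D.r} {n : ℕ} {l : Line G} (h : l ∈ D.upSet i n) :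
    l 0 = (D.ray i n).fst ∧ l.endMinus ∈ IsCuspidalRay.exterior hT (D.ray i) ∧
      l.endPlus ∈ {ξ | rayTo hT (D.ray i n).fst ξ 1 = (D.ray i (n + 1)).fst} := by
  have h0 : l 0 = (D.ray i n).fst := congrArg (fun d : G.Dart => d.fst) h.1
  have h1 : l 1 = (D.ray i (n + 1)).fst := by
    rw [← (D.cuspidal i).consecutive]; exact congrArg (fun d : G.Dart => d.snd) h.1
  have h2 : l (-n) = (D.ray i 0).fst := congrArg (fun d : G.Dart => d.fst) h.2
  have h3 : l (-n + 1) = (D.ray i 1).fst := by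
    rw [← (D.cuspidal i).consecutive]; exact congrArg (fun d : G.Dart => d.snd) h.2
  refine ⟨h0, ?_, ?_⟩
  · change rayTo hT (D.ray i 0).fst l.endMinus 1 ≠ (D.ray i 1).fst
    rw [← h2, ← h3, l.rayTo_endMinus]
    intro h
    have := l.inj h
    push_cast at this
    omega
  · change rayTo hT (D.ray i n).fst l.endPlus 1 = _
    rw [← h0, ← h1, l.rayTo_endPlus]
    rfl

theorem ends_of_flip_mem_upSet (hT : G.IsTree) {i : Fin D.r} {n : ℕ} {l : Line G}
    (h : l.flip ∈ D.upSet i n) :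
    l 0 = (D.ray i (n + 1)).fst ∧
      l.endMinus ∈ {ξ | rayTo hT (D.ray i n).fst ξ 1 = (D.ray i (n + 1)).fst} ∧
      l.endPlus ∈ IsCuspidalRay.exterior hT (D.ray i) := by
  obtain ⟨e1, e2⟩ := D.flip_mem_upSet.1 h
  have h1 : l 0 = (D.ray i (n + 1)).fst := by
    rw [← (D.cuspidal i).consecutive]; exact congrArg (fun d : G.Dart => d.fst) e1
  have h0 : l 1 = (D.ray i n).fst := congrArg (fun d : G.Dart => d.snd) e1
  have h3 : l n = (D.ray i 1).fst := by
    rw [← (D.cuspidal i).consecutive]; exact congrArg (fun d : G.Dart => d.fst) e2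
  have h2 : l (n + 1) = (D.ray i 0).fst := congrArg (fun d : G.Dart => d.snd) e2
  refine ⟨h1, ?_, ?_⟩
  · change rayTo hT (D.ray i n).fst l.endMinus 1 = _
    rw [← h0, ← h1, l.rayTo_endMinus]
    rfl
  · change rayTo hT (D.ray i 0).fst l.endPlus 1 ≠ (D.ray i 1).fst
    rw [← h2, ← h3, l.rayTo_endPlus]
    intro h
    have := l.inj h
    push_cast at this
    omega

/-- A geodesic of a level n piece has one end in the exterior and the other above level n; the four
kinds of letters differ only by the direction and by conditions that can be dropped. -/
theorem levelBound_bowenMargulis {δ : ℝ} [Countable V] [Countable Γ] (hT : G.IsTree)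
    (hμ : IsPattersonSullivan Γ δ μ) (hfin : ∀ v : V, Finite (MulAction.stabilizer Γ v)) (x : V)
    (i : Fin D.r) (n : ℕ) :
    D.LevelBound (fun β => bowenMargulis Γ δ μ x (D.piece β)) i n
      (μ (D.ray i n).fst (IsCuspidalRay.exterior hT (D.ray i)) *
        μ (D.ray i n).fst {ξ | rayTo hT (D.ray i n).fst ξ 1 = (D.ray i (n + 1)).fst}) := by
  have hext := IsCuspidalRay.measurableSet_exterior hT (a := D.ray i)
  have hup := measurableSet_rayTo_eq hT (D.ray i n).fst 1 (D.ray i (n + 1)).fst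
  have hle : ∀ β, (∀ l ∈ D.cell β, l ∈ D.upSet i n) → bowenMargulis Γ δ μ x (D.piece β) ≤
      μ (D.ray i n).fst (IsCuspidalRay.exterior hT (D.ray i)) *
        μ (D.ray i n).fst {ξ | rayTo hT (D.ray i n).fst ξ 1 = (D.ray i (n + 1)).fst} :=
    fun β h => bowenMargulis_proj_image_le hT hμ hfin x _ (D.measurableSet_cell β) hext hup
      fun l hl => ends_of_mem_upSet hT (h l hl)
  have hle' : ∀ β, (∀ l ∈ D.cell β, l.flip ∈ D.upSet i n) → bowenMargulis Γ δ μ x (D.piece β) ≤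
      μ (D.ray i n).fst (IsCuspidalRay.exterior hT (D.ray i)) *
        μ (D.ray i n).fst {ξ | rayTo hT (D.ray i n).fst ξ 1 = (D.ray i (n + 1)).fst} := by
    intro β h
    refine (bowenMargulis_proj_image_le hT hμ hfin x _ (D.measurableSet_cell β) hup hext
      fun l hl => ends_of_flip_mem_upSet hT (h l hl)).trans_eq ?_
    -- The downward pieces are seen from level n + 1: the exterior then loses a factor e^{-δ}, which
    -- the set of ends above gains.
    rw [(D.cuspidal i).measure_exterior hT hμ (n + 1), (D.cuspidal i).measure_exterior hT hμ n,
      measure_edge hT hμ hup fun ξ hξ => hξ]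
    ring
  exact ⟨hle _ fun l => D.mem_upSet_of_up, hle' _ fun l => D.flip_mem_upSet_of_down,
    fun q => hle _ fun l => D.mem_upSet_of_turnUp,
    fun q => hle' _ fun l => D.flip_mem_upSet_of_turnDown⟩

theorem bowenMargulis_core_lt_top {δ : ℝ} [Countable V] [Countable Γ] (hT : G.IsTree)
    (hμ : IsPattersonSullivan Γ δ μ) (hfin : ∀ v : V, Finite (MulAction.stabilizer Γ v)) (x : V)
    (d : D.edgeLift) : bowenMargulis Γ δ μ x (D.piece (.core d)) < ⊤ := by
  have := hμ.finite d.1.fst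
  refine (bowenMargulis_proj_image_le hT hμ hfin x d.1.fst (D.measurableSet_cell _)
    MeasurableSet.univ MeasurableSet.univ fun l hl => ?_).trans_lt
    (ENNReal.mul_lt_top (measure_lt_top _ _) (measure_lt_top _ _))
  exact ⟨congrArg (fun d : G.Dart => d.fst) (show l.edge 0 = d from hl), trivial, trivial⟩

theorem LevelBound.comp {f : D.Letter → ℝ≥0∞} {i : Fin D.r} {n : ℕ} {c : ℝ≥0∞}
    (h : D.LevelBound f i n c) {φ : ℝ≥0∞ → ℝ≥0∞} (hφ : Monotone φ) :
    D.LevelBound (fun β => φ (f β)) i n (φ c) :=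
  ⟨hφ h.up, hφ h.down, fun q => hφ (h.turnUp q), fun q => hφ (h.turnDown q)⟩

theorem LevelBound.mono {f g : D.Letter → ℝ≥0∞} {i : Fin D.r} {n : ℕ} {c c' : ℝ≥0∞}
    (h : D.LevelBound f i n c) (hg : ∀ β, g β ≤ f β) (hc : c ≤ c') : D.LevelBound g i n c' :=
  ⟨(hg _).trans (h.up.trans hc), (hg _).trans (h.down.trans hc),
    fun q => (hg _).trans ((h.turnUp q).trans hc), fun q => (hg _).trans ((h.turnDown q).trans hc)⟩

end CodingData

end TreeFlow

/-! ### The main theorem -/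

theorem mainTheorem10 {V : Type*} (G : SimpleGraph V) (hT : G.IsTree)
    (hlf : ∀ v : V, (G.neighborSet v).Finite) (hu : TreeFlow.IsUniform G)
    (Γ : Subgroup (G ≃g G)) (hinv : TreeFlow.NoInversion Γ) (hdisc : TreeFlow.IsDiscrete Γ)
    (hgf : TreeFlow.IsGeometricallyFinite Γ) (hmin : TreeFlow.IsMinimal Γ)
    (D : TreeFlow.CodingData Γ)
    (htriv : ∀ v ∈ D.toCuspidalDecomposition.coreVertices, ∀ γ : Γ, γ • v = v → γ = 1)
    (x₀ : V) (μ : V → MeasureTheory.Measure (TreeFlow.Boundary G))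
    (hμ : TreeFlow.IsPattersonSullivan Γ (TreeFlow.criticalExponent Γ x₀).toReal μ)
    (m : MeasureTheory.Measure (TreeFlow.QuotientLines Γ))
    (hm : m = TreeFlow.bowenMargulis Γ (TreeFlow.criticalExponent Γ x₀).toReal μ x₀) :
    (0 < m Set.univ ∧ m Set.univ < ⊤) ∧
    TreeFlow.IsMeasurablePartition D.piece ∧
    TreeFlow.partitionEntropy ((m Set.univ)⁻¹ • m) D.piece < ⊤ := by
  have hne := hgf.1
  have : Nonempty V := ⟨x₀⟩
  have := TreeFlow.countable_vertices hT hlf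
  have := D.countable_group htriv
  have hfin := D.stabilizer_finite htriv hT (TreeFlow.finite_ball hT hlf)
  have hpart := D.isMeasurablePartition_piece htriv hT
  have hbound : ∀ i, ∃ C < (⊤ : ℝ≥0∞), ∃ ρ < (1 : ℝ≥0∞), ∀ n,
      D.LevelBound (fun β => m (D.piece β)) i n (C * ρ ^ n) := by
    intro i
    obtain ⟨C, hC, ρ, hρ, h⟩ := TreeFlow.CuspidalDecomposition.exists_horoball_bound htriv hT hlf hu
      hne hmin x₀ hμ i
    refine ⟨C, hC, ρ, hρ, fun n => ?_⟩
    rw [hm]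
    exact (TreeFlow.CodingData.levelBound_bowenMargulis hT hμ hfin x₀ i n).mono (fun _ => le_rfl)
      (h n)
  have hcore : ∀ d, m (D.piece (.core d)) < ⊤ := fun d => by
    rw [hm]
    exact TreeFlow.CodingData.bowenMargulis_core_lt_top hT hμ hfin x₀ d
  have hpos : 0 < m Set.univ := by
    rw [hm]
    exact TreeFlow.bowenMargulis_univ_pos hT hμ hne hmin x₀
  -- Finiteness is not known beforehand: it comes from summing the bounds on the pieces.
  have hlt : m Set.univ < ⊤ := by
    have hle : m Set.univ ≤ ∑' β, m (D.piece β) := by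
      have := D.countable_letter hlf
      rw [← hpart.cover]
      exact MeasureTheory.measure_iUnion_le _
    exact hle.trans_lt (D.tsum_letter_lt_top hT hlf hu hcore hbound)
  refine ⟨⟨hpos, hlt⟩, hpart, ?_⟩
  refine D.tsum_letter_lt_top hT hlf hu (fun d => ENNReal.ofReal_lt_top) fun i => ?_
  obtain ⟨C, hC, ρ, hρ, h⟩ := hbound i
  -- The normalised masses are at most C ρ^n divided by the total mass; the bound 2√t turns the rate
  -- ρ into its square root.
  refine ⟨2 * ((m Set.univ)⁻¹ * C) ^ (1 / 2 : ℝ), ?_, ρ ^ (1 / 2 : ℝ), ?_, fun n => ?_⟩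
  · exact ENNReal.mul_lt_top ENNReal.ofNat_lt_top (ENNReal.rpow_lt_top_of_nonneg (by norm_num)
      (ENNReal.mul_lt_top (ENNReal.inv_lt_top.2 hpos) hC).ne)
  · exact ENNReal.rpow_lt_one hρ (by norm_num)
  · have hφ : Monotone fun t : ℝ≥0∞ => 2 * ((m Set.univ)⁻¹ * t) ^ (1 / 2 : ℝ) := fun s t hst => by
      dsimp only
      gcongr
    refine ((h n).comp hφ).mono (fun β => TreeFlow.ofReal_negMulLog_le _) (le_of_eq ?_)
    rw [← mul_assoc, ENNReal.mul_rpow_of_nonneg _ _ (by norm_num), mul_assoc,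
      ← ENNReal.rpow_natCast, ← ENNReal.rpow_natCast, ← ENNReal.rpow_mul, ← ENNReal.rpow_mul,
      mul_comm (n : ℝ)]
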